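/- Let $(X^N,h)$ be a smooth complete Riemannian manifold without boundary (second countable), of dimension $N\ge 3$, with volume measure $dv_h$ and constant positive scalar curvature $s_h$. Put $a_N=\frac{4(N-1)}{N-2}$ and $p=\frac{2N}{N-2}$. Let $L^2_1(X)$ be the Sobolev space of functions $u\in L^2(X)$ with weak gradient $\nabla u\in L^2$, normed by $\left(\int_X(\|\nabla u\|^2+u^2)\,dv_h\right)^{1/2}$, and assume that the Sobolev embedding $L^2_1(X)\subset L^p(X)$ holds, i.e. that there is a constant $C$ with $\|u\|_p\le C\|u\|_{L^2_1}$ for all $u\in L^2_1(X)$. For $u\in L^2_1(X)\setminus\{0\}$ let $$E_h(u)=\int_X\left(a_N\|\nabla u\|^2+s_hu^2\right)dv_h,\qquad \|u\|_p^p=\int_X|u|^p\,dv_h,\qquad Y_h(u)=\frac{E_h(u)}{\|u\|_p^2}.$$ Let $f\in C^\infty(X)\cap L^2_1(X)$ be a positive critical point of $Y_h$: for every $u\in C_0^\infty(X)$ (smooth with compact support), the function $H_u(t)=Y_h(f+tu)$ satisfies $H_u'(0)=0$. Call $f$ stable if $H_u''(0)\ge 0$ for every $u\in C_0^\infty(X)$.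 Let $N(h,f)=\{u\in L^2_1(X)\setminus\{0\}:\int_X f^{p-1}u\,dv_h=0\}$ and $$\alpha(X,h,f)=\inf_{u\in N(h,f)}\frac{E_h(u)}{\int_X f^{p-2}u^2\,dv_h}.$$ Then $f$ is stable if and only if $$\alpha(X,h,f)\ \ge\ (p-1)\,\frac{E_h(f)}{\|f\|_p^p}.$$ -/

import Mathlib

open Bundle Manifold MeasureTheory Filter Topology
open scoped ContDiff

namespace Yamabe

noncomputable section

/-! ### Scalar curvature of a metric given by its coefficients in local coordinates -/

section Coordinates

variable {N : ℕ}

/-- The partial derivative `∂ᵢ F` of a function of `N` real variables. -/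
def partialDeriv (i : Fin N) (F : EuclideanSpace ℝ (Fin N) → ℝ)
    (y : EuclideanSpace ℝ (Fin N)) : ℝ :=
  fderiv ℝ F y (EuclideanSpace.single i 1)

/-- The Christoffel symbols
`Γᵏᵢⱼ = ½ ∑ₗ gᵏˡ (∂ᵢ gⱼₗ + ∂ⱼ gᵢₗ - ∂ₗ gᵢⱼ)` of a coordinate metric `g`. -/
def christoffel (g : EuclideanSpace ℝ (Fin N) → Matrix (Fin N) (Fin N) ℝ)
    (k i j : Fin N) (y : EuclideanSpace ℝ (Fin N)) : ℝ :=
  (1 / 2 : ℝ) * ∑ l, (g y)⁻¹ k l *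
    (partialDeriv i (fun z => g z j l) y + partialDeriv j (fun z => g z i l) y
      - partialDeriv l (fun z => g z i j) y)

/-- The Ricci tensor
`Rᵢⱼ = ∑ₖ (∂ₖ Γᵏᵢⱼ - ∂ⱼ Γᵏᵢₖ) + ∑ₖₗ (Γᵏₖₗ Γˡᵢⱼ - Γᵏⱼₗ Γˡᵢₖ)` of a coordinate metric `g`. -/
def ricci (g : EuclideanSpace ℝ (Fin N) → Matrix (Fin N) (Fin N) ℝ)
    (i j : Fin N) (y : EuclideanSpace ℝ (Fin N)) : ℝ :=
  ∑ k, (partialDeriv k (christoffel g k i j) y - partialDeriv j (christoffel g k i k) y)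
    + ∑ k, ∑ l, (christoffel g k k l y * christoffel g l i j y
        - christoffel g k j l y * christoffel g l i k y)

/-- The scalar curvature `∑ᵢⱼ gⁱʲ Rᵢⱼ` of a coordinate metric `g`. -/
def coordScalarCurvature (g : EuclideanSpace ℝ (Fin N) → Matrix (Fin N) (Fin N) ℝ)
    (y : EuclideanSpace ℝ (Fin N)) : ℝ :=
  ∑ i, ∑ j, (g y)⁻¹ i j * ricci g i j y

end Coordinates

/-! ### The Riemannian manifold: metric in charts, scalar curvature, volume -/

variable (N : ℕ) {X : Type*} [TopologicalSpace X] [ChartedSpace (EuclideanSpace ℝ (Fin N)) X]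

/-- The chart at `q` read backwards, from `ℝᴺ` to `X`; meaningful on `(extChartAt (𝓡 N) q).target`. -/
abbrev param (q : X) : EuclideanSpace ℝ (Fin N) → X := (extChartAt (𝓡 N) q).symm

/-- The tangent vector at `param N q y` with coordinates `v` in the chart at `q`. -/
def coordVector (q : X) (y v : EuclideanSpace ℝ (Fin N)) :
    TangentSpace (𝓡 N) (param N q y) :=
  mfderiv (𝓡 N) (𝓡 N) (param N q) y v

variable [RiemannianBundle (fun x : X => TangentSpace (𝓡 N) x)]

/-- The coefficients `hᵢⱼ` of the Riemannian metric in the chart at `q`. -/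
def coordMetric (q : X) (y : EuclideanSpace ℝ (Fin N)) : Matrix (Fin N) (Fin N) ℝ :=
  Matrix.of fun i j =>
    inner ℝ (coordVector N q y (EuclideanSpace.single i 1))
      (coordVector N q y (EuclideanSpace.single j 1))

/-- The scalar curvature `s_h` at `x`, computed in the chart at `x`. -/
def scalarCurvature (x : X) : ℝ :=
  coordScalarCurvature (coordMetric N x) (extChartAt (𝓡 N) x x)

variable [MeasurableSpace X]

/-- The volume measure `√(det hᵢⱼ) dy` of the domain of the chart at `q`. -/
def chartVolume (q : X) : Measure X :=
  (((volume : Measure (EuclideanSpace ℝ (Fin N))).restrict (extChartAt (𝓡 N) q).target).withDensity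
    (fun y => ENNReal.ofReal (Real.sqrt (coordMetric N q y).det))).map (param N q)

variable (X) in
/-- The Riemannian volume measure `dv_h`: the chart volumes agree on the overlaps of the charts,
and `dv_h` is their supremum, the measure that restricts to `√(det hᵢⱼ) dy` in each chart. -/
def riemannianVolume : Measure X := ⨆ q : X, chartVolume N q

/-! ### The Sobolev space `L²₁` -/

/-- `G` is a weak gradient of `u`: in every chart, the functions `h(G, ∂_v)` are the weak
derivatives of `u` in the directions `v`, tested against smooth functions with compact support
in the image of the chart. -/
structure HasWeakGradient {X : Type*} [TopologicalSpace X]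
    [ChartedSpace (EuclideanSpace ℝ (Fin N)) X]
    [RiemannianBundle (fun x : X => TangentSpace (𝓡 N) x)]
    (u : X → ℝ) (G : ∀ x : X, TangentSpace (𝓡 N) x) : Prop where
  locallyIntegrable (q : X) :
    LocallyIntegrableOn (fun y => u (param N q y)) (extChartAt (𝓡 N) q).target
  locallyIntegrable_gradient (q : X) (v : EuclideanSpace ℝ (Fin N)) :
    LocallyIntegrableOn (fun y => inner ℝ (G (param N q y)) (coordVector N q y v))
      (extChartAt (𝓡 N) q).target
  integral_eq (q : X) (v : EuclideanSpace ℝ (Fin N)) (η : EuclideanSpace ℝ (Fin N) → ℝ)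
    (_ : ContDiff ℝ ∞ η) (_ : HasCompactSupport η)
    (_ : tsupport η ⊆ (extChartAt (𝓡 N) q).target) :
    ∫ y, u (param N q y) * fderiv ℝ η y v
      = - ∫ y, inner ℝ (G (param N q y)) (coordVector N q y v) * η y

/-- Membership in the Sobolev space `L²₁(X)`: `u ∈ L²`, and `u` has a weak gradient in `L²`.
Functions equal almost everywhere represent the same element. -/
def MemSobolev (u : X → ℝ) : Prop :=
  MemLp u 2 (riemannianVolume N X) ∧
    ∃ G : ∀ x : X, TangentSpace (𝓡 N) x, HasWeakGradient N u G ∧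
      ∫⁻ x, ‖G x‖ₑ ^ 2 ∂(riemannianVolume N X) < ⊤

open Classical in
/-- The weak gradient `∇u` (unique up to null sets), and `0` if `u` has none. -/
def weakGradient {X : Type*} [TopologicalSpace X] [ChartedSpace (EuclideanSpace ℝ (Fin N)) X]
    [RiemannianBundle (fun x : X => TangentSpace (𝓡 N) x)]
    (u : X → ℝ) : ∀ x : X, TangentSpace (𝓡 N) x :=
  if hu : ∃ G : ∀ x : X, TangentSpace (𝓡 N) x, HasWeakGradient N u G then hu.choose
  else fun _ => 0

/-- The norm `‖u‖ = (∫ (‖∇u‖² + u²) dv_h)^{1/2}` of `L²₁(X)`. -/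
def sobolevNorm (u : X → ℝ) : ℝ :=
  Real.sqrt (∫ x, (‖weakGradient N u x‖ ^ 2 + u x ^ 2) ∂(riemannianVolume N X))

/-- The Yamabe exponent `p = 2N / (N - 2)`. -/
def yamabeExponent : ℝ := 2 * (N : ℝ) / ((N : ℝ) - 2)

/-- The constant `a_N = 4 (N - 1) / (N - 2)`. -/
def yamabeConst : ℝ := 4 * ((N : ℝ) - 1) / ((N : ℝ) - 2)

variable (X) in
/-- The Sobolev embedding `L²₁(X) ⊂ Lᵖ(X)` (a continuous inclusion) holds. -/
def SobolevEmbedding : Prop :=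
  ∃ C : ℝ, ∀ u : X → ℝ, MemSobolev N u →
    eLpNorm u (ENNReal.ofReal (yamabeExponent N)) (riemannianVolume N X)
      ≤ ENNReal.ofReal (C * sobolevNorm N u)

/-! ### The Yamabe functional, critical points, stability, and `α(X, h, f)` -/

/-- `E_h(u) = ∫ (a_N ‖∇u‖² + s_h u²) dv_h`. -/
def energy (u : X → ℝ) : ℝ :=
  ∫ x, (yamabeConst N * ‖weakGradient N u x‖ ^ 2 + scalarCurvature N x * u x ^ 2)
    ∂(riemannianVolume N X)

/-- `‖u‖ₚᵖ = ∫ |u|ᵖ dv_h`. -/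
def normPow (u : X → ℝ) : ℝ :=
  ∫ x, |u x| ^ yamabeExponent N ∂(riemannianVolume N X)

/-- The Yamabe functional `Y_h(u) = E_h(u) / ‖u‖ₚ²`. -/
def yamabeFunctional (u : X → ℝ) : ℝ :=
  energy N u / normPow N u ^ (2 / yamabeExponent N)

/-- The function `H_u(t) = Y_h(f + t u)`. -/
def variation (f u : X → ℝ) (t : ℝ) : ℝ :=
  yamabeFunctional N (fun x => f x + t * u x)

/-- `u ∈ C₀^∞(X)`: smooth with compact support. -/
def IsTestFunction {X : Type*} [TopologicalSpace X] [ChartedSpace (EuclideanSpace ℝ (Fin N)) X]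
    (u : X → ℝ) : Prop :=
  ContMDiff (𝓡 N) 𝓘(ℝ) ∞ u ∧ HasCompactSupport u

/-- `f` is a critical point of `Y_h`: `H_u'(0) = 0` for all `u ∈ C₀^∞(X)`. -/
def IsCriticalPoint (f : X → ℝ) : Prop :=
  ∀ u : X → ℝ, IsTestFunction N u → HasDerivAt (variation N f u) 0 0

/-- The critical point `f` of `Y_h` is stable: for all `u ∈ C₀^∞(X)`, the second derivative
`H_u''(0)` (exists and) is nonnegative. -/
def IsStable (f : X → ℝ) : Prop :=
  ∀ u : X → ℝ, IsTestFunction N u →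
    (∀ᶠ t in 𝓝 (0 : ℝ), DifferentiableAt ℝ (variation N f u) t) ∧
    DifferentiableAt ℝ (deriv (variation N f u)) 0 ∧
    0 ≤ deriv (deriv (variation N f u)) 0

/-- `N(h, f)`: the nonzero `u ∈ L²₁(X)` with `∫ f^{p-1} u dv_h = 0`. -/
def admissible (f : X → ℝ) : Set (X → ℝ) :=
  {u | MemSobolev N u ∧ ¬ (u =ᵐ[riemannianVolume N X] 0) ∧
    ∫ x, f x ^ (yamabeExponent N - 1) * u x ∂(riemannianVolume N X) = 0}

/-- `α(X, h, f)`: the infimum of `E_h(u) / ∫ f^{p-2} u² dv_h` over `u ∈ N(h, f)`,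
taken in the extended reals. -/
def alpha (f : X → ℝ) : EReal :=
  ⨅ u ∈ admissible N f,
    ((energy N u / ∫ x, f x ^ (yamabeExponent N - 2) * u x ^ 2 ∂(riemannianVolume N X) : ℝ) : EReal)

end

end Yamabe

/-!
# Stability of critical points of the Yamabe functional

Write `n = ‖f‖ₚᵖ`, `λ = E(f) / n`, `A(u) = ∫ f ^ (p - 1) u`, and `B(u) = ∫ f ^ (p - 2) u²`.

Along a line `f + t u` with `u` a test function, the energy is a quadratic polynomial in `t` and
`∫ |f + t u| ^ p` is twice differentiable near `t = 0`, because `f` is bounded below by a positive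
constant on the support of `u`, so that `f + t u` is positive for small `t`. The vanishing of the
first derivative says `E(f, u) = λ A(u)`, and then the second derivative is a positive multiple of
`Q(u) = E(u) - λ (p - 1) B(u) + λ (p - 2) A(u)² / n` (`hasDerivAt_quadratic_div_rpow`,
`exists_hasDerivAt_normPow`, `isStable_iff_forall_secondVariation_nonneg`). So `f` is stable if and
only if `Q ≥ 0` on test functions, while the bound for `α(X, h, f)` says that
`E(u) ≥ λ (p - 1) B(u)` for all Sobolev functions with `A(u) = 0` (`coe_le_alpha_iff`).

These two conditions are equivalent (`forall_secondVariation_nonneg_iff`). If the second holds and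
`u` is a test function, then `v = u - (A(u) / n) f` satisfies `A(v) = 0`, and
`Q(u) = E(v) - λ (p - 1) B(v) ≥ 0`. For the converse, approximate `u` by test functions in the
Sobolev norm: `Q` is continuous in this norm, as `B(u)` is bounded by a multiple of the squared
Sobolev norm through the Sobolev embedding (`weightedForm_le_of_sobolevForm_le`) and
`A(u)² ≤ n B(u)`.

The approximation is the density of test functions in the Sobolev space of a complete manifold
(`SobolevPair.isTestLimit`). In a chart it is mollification (`SobolevPair.isTestLimit_of_chart`),
and a partition of unity handles compact supports (`SobolevPair.isTestLimit_of_isCompact`). In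
general, closed balls are compact by the argument of Hopf and Rinow (`isCompact_closedEBall`), so
there are cutoff functions `χ` with compact support and Lipschitz constant `1` that are equal to `1`
on larger and larger compact sets. Such a `χ` is differentiable almost everywhere with `‖∇χ‖ ≤ 1`
(`norm_grad_le_one`), and its gradient in this sense is a weak gradient (`hasWeakGradient_grad`).
Since the product of `χ` with an arbitrary Sobolev function would need a product rule for Lipschitz
functions, `u` is first replaced by a test function near the support of `χ`
(`SobolevPair.isTestLimit_of_exhaustion`).
-/

set_option linter.unusedSectionVars false

namespace Yamabe

noncomputable section

/-! ### The metric in a chart -/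

section ChartMetric

variable {N : ℕ} {X : Type*} [TopologicalSpace X] [ChartedSpace (EuclideanSpace ℝ (Fin N)) X]

lemma isOpen_target (q : X) : IsOpen (extChartAt (𝓡 N) q).target := isOpen_extChartAt_target q

lemma continuousOn_param (q : X) : ContinuousOn (param N q) (extChartAt (𝓡 N) q).target :=
  continuousOn_extChartAt_symm q

variable [IsManifold (𝓡 N) ∞ X]

lemma contMDiffOn_param (q : X) :
    ContMDiffOn (𝓡 N) (𝓡 N) ∞ (param N q) (extChartAt (𝓡 N) q).target :=
  contMDiffOn_extChartAt_symm q

lemma mdifferentiableAt_param (q : X) {y : EuclideanSpace ℝ (Fin N)}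
    (hy : y ∈ (extChartAt (𝓡 N) q).target) :
    MDifferentiableAt (𝓡 N) (𝓡 N) (param N q) y :=
  ((contMDiffOn_param q).contMDiffAt ((isOpen_target q).mem_nhds hy)).mdifferentiableAt (by simp)

lemma coordVector_add (q : X) (y v w : EuclideanSpace ℝ (Fin N)) :
    coordVector N q y (v + w) = coordVector N q y v + coordVector N q y w :=
  map_add (mfderiv (𝓡 N) (𝓡 N) (param N q) y) v w

lemma coordVector_smul (q : X) (y : EuclideanSpace ℝ (Fin N)) (c : ℝ)
    (v : EuclideanSpace ℝ (Fin N)) :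
    coordVector N q y (c • v) = c • coordVector N q y v :=
  map_smul (mfderiv (𝓡 N) (𝓡 N) (param N q) y) c v

lemma coordVector_eq_sum (q : X) (y v : EuclideanSpace ℝ (Fin N)) :
    coordVector N q y v = ∑ i, v i • coordVector N q y (EuclideanSpace.single i 1) := by
  have : v = ∑ i, v i • (EuclideanSpace.single i (1 : ℝ)) := by
    ext j; simp [Finset.sum_apply, Pi.single_apply]
  let L : EuclideanSpace ℝ (Fin N) →ₗ[ℝ] TangentSpace (𝓡 N) (param N q y) :=
    { toFun := coordVector N q y
      map_add' := coordVector_add q y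
      map_smul' := fun c v => coordVector_smul q y c v }
  change L v = ∑ i, v i • L (EuclideanSpace.single i 1)
  conv_lhs => rw [this]
  rw [map_sum]
  simp only [map_smul]

lemma isInvertible_mfderiv_param (q : X) {y : EuclideanSpace ℝ (Fin N)}
    (hy : y ∈ (extChartAt (𝓡 N) q).target) :
    (mfderiv (𝓡 N) (𝓡 N) (param N q) y).IsInvertible := by
  have := isInvertible_mfderivWithin_extChartAt_symm (I := 𝓡 N) hy
  rwa [ModelWithCorners.range_eq_univ, mfderivWithin_univ] at this

lemma exists_coordVector_eq (q : X) {y : EuclideanSpace ℝ (Fin N)}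
    (hy : y ∈ (extChartAt (𝓡 N) q).target) (ξ : TangentSpace (𝓡 N) (param N q y)) :
    ∃ v, coordVector N q y v = ξ :=
  (isInvertible_mfderiv_param q hy).bijective.2 ξ

lemma coordVector_eq_zero (q : X) {y : EuclideanSpace ℝ (Fin N)}
    (hy : y ∈ (extChartAt (𝓡 N) q).target) {v : EuclideanSpace ℝ (Fin N)}
    (h : coordVector N q y v = 0) : v = 0 :=
  (isInvertible_mfderiv_param q hy).injective (h.trans (map_zero _).symm)

variable [RiemannianBundle (fun x : X => TangentSpace (𝓡 N) x)]

lemma inner_coordVector (q : X) (y v w : EuclideanSpace ℝ (Fin N)) :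
    inner ℝ (coordVector N q y v) (coordVector N q y w)
      = (v : Fin N → ℝ) ⬝ᵥ (coordMetric N q y).mulVec w := by
  rw [coordVector_eq_sum q y v, coordVector_eq_sum q y w]
  simp only [sum_inner, inner_sum, inner_smul_left, inner_smul_right, dotProduct, Matrix.mulVec,
    coordMetric, Matrix.of_apply, Finset.mul_sum]
  rw [Finset.sum_comm]
  simp [mul_comm, mul_left_comm]

lemma inner_coordVector_single (q : X) (y v : EuclideanSpace ℝ (Fin N)) (i : Fin N) :
    inner ℝ (coordVector N q y v) (coordVector N q y (EuclideanSpace.single i 1))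
      = (coordMetric N q y).mulVec v i := by
  rw [real_inner_comm, inner_coordVector]
  simp [dotProduct]

lemma posDef_coordMetric (q : X) {y : EuclideanSpace ℝ (Fin N)}
    (hy : y ∈ (extChartAt (𝓡 N) q).target) : (coordMetric N q y).PosDef := by
  rw [Matrix.posDef_iff_dotProduct_mulVec]
  refine ⟨?_, fun v hv => ?_⟩
  · ext i j
    simp [coordMetric, real_inner_comm]
  · have := inner_coordVector q y (WithLp.toLp 2 v) (WithLp.toLp 2 v)
    simp only at this
    rw [star_trivial, ← this, real_inner_self_eq_norm_sq]
    have h : coordVector N q y (WithLp.toLp 2 v) ≠ 0 := fun h =>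
      hv (by simpa using coordVector_eq_zero q hy h)
    positivity

lemma det_coordMetric_pos (q : X) {y : EuclideanSpace ℝ (Fin N)}
    (hy : y ∈ (extChartAt (𝓡 N) q).target) : 0 < (coordMetric N q y).det :=
  (posDef_coordMetric q hy).det_pos

/-- The norm of a vector in terms of its inner products with the coordinate vectors, which are the
quantities that weak gradients control. -/
lemma norm_sq_eq_sum (q : X) {y : EuclideanSpace ℝ (Fin N)}
    (hy : y ∈ (extChartAt (𝓡 N) q).target) (ξ : TangentSpace (𝓡 N) (param N q y)) :
    ‖ξ‖ ^ 2 = ∑ i, ∑ j, (coordMetric N q y)⁻¹ i j *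
      (inner ℝ ξ (coordVector N q y (EuclideanSpace.single i 1)) *
        inner ℝ ξ (coordVector N q y (EuclideanSpace.single j 1))) := by
  obtain ⟨v, rfl⟩ := exists_coordVector_eq q hy ξ
  rw [← real_inner_self_eq_norm_sq, inner_coordVector]
  simp only [inner_coordVector_single]
  set g := coordMetric N q y with hg
  have hdet : IsUnit g.det := (det_coordMetric_pos q hy).ne'.isUnit
  have h1 : ∀ i, ∑ j, g⁻¹ i j * g.mulVec v j = v i := by
    intro i
    have : (g⁻¹).mulVec (g.mulVec v) = v := by
      rw [Matrix.mulVec_mulVec, Matrix.nonsing_inv_mul _ hdet, Matrix.one_mulVec]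
    exact congrFun this i
  simp only [dotProduct]
  refine Finset.sum_congr rfl fun i _ => ?_
  rw [← h1 i, Finset.sum_mul]
  exact Finset.sum_congr rfl fun j _ => by ring

variable [hsm : IsContMDiffRiemannianBundle (𝓡 N) ∞ (EuclideanSpace ℝ (Fin N))
      (fun x : X => TangentSpace (𝓡 N) x)]

/-- Continuity of the metric, which instance search cannot deduce from its smoothness. -/
lemma isContinuousRiemannianBundle_tangentSpace :
    IsContinuousRiemannianBundle (EuclideanSpace ℝ (Fin N))
      (fun x : X => TangentSpace (𝓡 N) x) := by
  obtain ⟨g, hg, h⟩ := hsm.exists_contMDiff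
  exact ⟨g, hg.continuous, h⟩

lemma continuousOn_coordVector (q : X) (v : EuclideanSpace ℝ (Fin N)) :
    ContinuousOn
      (fun y => (⟨param N q y, coordVector N q y v⟩ :
        TotalSpace (EuclideanSpace ℝ (Fin N)) (fun x : X => TangentSpace (𝓡 N) x)))
      (extChartAt (𝓡 N) q).target := by
  have h := (contMDiffOn_param (N := N) q).continuousOn_tangentMapWithin (by simp)
    (isOpen_target (N := N) q).uniqueMDiffOn
  have h2 : Continuous (fun y : EuclideanSpace ℝ (Fin N) =>
      (⟨y, v⟩ : TangentBundle (𝓡 N) (EuclideanSpace ℝ (Fin N)))) := by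
    rw [continuous_iff_continuousAt]
    intro y
    rw [FiberBundle.continuousAt_totalSpace]
    refine ⟨continuousAt_id, ?_⟩
    simp
    exact continuousAt_const
  refine (h.comp h2.continuousOn (fun y hy => hy)).congr fun y hy => ?_
  simp only [Function.comp, tangentMapWithin, coordVector]
  rw [mfderivWithin_of_isOpen (isOpen_target q) hy]

lemma continuousOn_inner_coordVector (q : X) (v w : EuclideanSpace ℝ (Fin N)) :
    ContinuousOn (fun y => inner ℝ (coordVector N q y v) (coordVector N q y w))
      (extChartAt (𝓡 N) q).target := by
  have := isContinuousRiemannianBundle_tangentSpace (N := N) (X := X)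
  exact ContinuousOn.inner_bundle (continuousOn_coordVector q v) (continuousOn_coordVector q w)

lemma continuousOn_coordMetric (q : X) :
    ContinuousOn (coordMetric N q) (extChartAt (𝓡 N) q).target := by
  refine continuousOn_pi.2 fun i => continuousOn_pi.2 fun j => ?_
  exact continuousOn_inner_coordVector q _ _

lemma continuousOn_coordMetric_inv (q : X) (i j : Fin N) :
    ContinuousOn (fun y => (coordMetric N q y)⁻¹ i j) (extChartAt (𝓡 N) q).target := by
  have h1 : ContinuousOn (fun y => (coordMetric N q y).det) (extChartAt (𝓡 N) q).target :=
    (Continuous.matrix_det continuous_id).comp_continuousOn (continuousOn_coordMetric q)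
  have h2 : ContinuousOn (fun y => (coordMetric N q y).adjugate i j) (extChartAt (𝓡 N) q).target :=
    (((Continuous.matrix_adjugate continuous_id).matrix_elem i j)).comp_continuousOn
      (continuousOn_coordMetric q)
  refine ((h1.inv₀ fun y hy => (det_coordMetric_pos q hy).ne').mul h2).congr fun y hy => ?_
  simp [Matrix.inv_def, Ring.inverse_eq_inv']

/-- The Riemannian density `√(det hᵢⱼ)` in the chart at `q`. -/
def density (q : X) (y : EuclideanSpace ℝ (Fin N)) : ℝ := Real.sqrt (coordMetric N q y).det

lemma density_pos (q : X) {y : EuclideanSpace ℝ (Fin N)}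
    (hy : y ∈ (extChartAt (𝓡 N) q).target) : 0 < density q y :=
  Real.sqrt_pos.2 (det_coordMetric_pos q hy)

lemma continuousOn_density (q : X) :
    ContinuousOn (density (N := N) q) (extChartAt (𝓡 N) q).target :=
  ((Continuous.matrix_det continuous_id).comp_continuousOn (continuousOn_coordMetric q)).sqrt

end ChartMetric

/-! ### The Riemannian volume in charts -/

section Volume

variable {N : ℕ} {X : Type*} [TopologicalSpace X] [ChartedSpace (EuclideanSpace ℝ (Fin N)) X]
  [IsManifold (𝓡 N) ∞ X] [RiemannianBundle (fun x : X => TangentSpace (𝓡 N) x)]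

/-- The change of coordinates from the chart at `q` to the chart at `q'`. -/
def transition (q q' : X) (y : EuclideanSpace ℝ (Fin N)) : EuclideanSpace ℝ (Fin N) :=
  extChartAt (𝓡 N) q' (param N q y)

lemma param_mem_source (q : X) {y : EuclideanSpace ℝ (Fin N)}
    (hy : y ∈ (extChartAt (𝓡 N) q).target) : param N q y ∈ (extChartAt (𝓡 N) q).source :=
  (extChartAt (𝓡 N) q).map_target hy

lemma param_transition (q q' : X) {y : EuclideanSpace ℝ (Fin N)}
    (hy' : param N q y ∈ (extChartAt (𝓡 N) q').source) :
    param N q' (transition q q' y) = param N q y :=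
  (extChartAt (𝓡 N) q').left_inv hy'

lemma mdifferentiableAt_transition (q q' : X) {y : EuclideanSpace ℝ (Fin N)}
    (hy : y ∈ (extChartAt (𝓡 N) q).target)
    (hy' : param N q y ∈ (extChartAt (𝓡 N) q').source) :
    MDifferentiableAt (𝓡 N) (𝓡 N) (transition (N := N) q q') y := by
  have h1 : MDifferentiableAt (𝓡 N) (𝓡 N) (extChartAt (𝓡 N) q') (param N q y) :=
    mdifferentiableAt_extChartAt (by simpa using hy')
  exact h1.comp y (mdifferentiableAt_param q hy)

lemma differentiableAt_transition (q q' : X) {y : EuclideanSpace ℝ (Fin N)}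
    (hy : y ∈ (extChartAt (𝓡 N) q).target)
    (hy' : param N q y ∈ (extChartAt (𝓡 N) q').source) :
    DifferentiableAt ℝ (transition (N := N) q q') y :=
  (mdifferentiableAt_transition q q' hy hy').differentiableAt

lemma isOpen_overlap (q q' : X) :
    IsOpen ((extChartAt (𝓡 N) q).target ∩ param N q ⁻¹' (extChartAt (𝓡 N) q').source) :=
  (continuousOn_param q).isOpen_inter_preimage (isOpen_target q) (isOpen_extChartAt_source q')

lemma hasMFDerivAt_param_transition (q q' : X) {y : EuclideanSpace ℝ (Fin N)}
    (hy : y ∈ (extChartAt (𝓡 N) q).target)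
    (hy' : param N q y ∈ (extChartAt (𝓡 N) q').source) :
    HasMFDerivAt (𝓡 N) (𝓡 N) (param N q) y
      ((mfderiv (𝓡 N) (𝓡 N) (param N q') (transition q q' y)).comp
        (mfderiv (𝓡 N) (𝓡 N) (transition (N := N) q q') y)) := by
  have ht : transition q q' y ∈ (extChartAt (𝓡 N) q').target :=
    (extChartAt (𝓡 N) q').map_source hy'
  have h := (mdifferentiableAt_param q' ht).hasMFDerivAt.comp y
    (mdifferentiableAt_transition q q' hy hy').hasMFDerivAt
  refine h.congr_of_eventuallyEq ?_
  filter_upwards [(isOpen_overlap q q').mem_nhds ⟨hy, hy'⟩] with z hz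
  exact (param_transition q q' hz.2).symm

lemma inner_coordVector_transition (q q' : X) {y : EuclideanSpace ℝ (Fin N)}
    (hy : y ∈ (extChartAt (𝓡 N) q).target)
    (hy' : param N q y ∈ (extChartAt (𝓡 N) q').source) (v w : EuclideanSpace ℝ (Fin N)) :
    inner ℝ (coordVector N q y v) (coordVector N q y w)
      = inner ℝ (coordVector N q' (transition q q' y) (fderiv ℝ (transition q q') y v))
        (coordVector N q' (transition q q' y) (fderiv ℝ (transition q q') y w)) := by
  have h := (hasMFDerivAt_param_transition q q' hy hy').mfderiv
  have key : ∀ (z z' : X), z = z' → ∀ a b : EuclideanSpace ℝ (Fin N),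
      @inner ℝ (TangentSpace (𝓡 N) z) _ a b = @inner ℝ (TangentSpace (𝓡 N) z') _ a b := by
    rintro z _ rfl a b; rfl
  have e : ∀ v, coordVector N q y v
      = coordVector N q' (transition q q' y) (fderiv ℝ (transition q q') y v) := by
    intro v
    rw [← mfderiv_eq_fderiv]
    exact DFunLike.congr_fun h v
  refine (key _ _ (param_transition q q' hy').symm
    (coordVector N q y v) (coordVector N q y w)).trans ?_
  exact congrArg₂ (fun a b : EuclideanSpace ℝ (Fin N) =>
    @inner ℝ (TangentSpace (𝓡 N) (param N q' (transition q q' y))) _ a b) (e v) (e w)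

/-- The density transforms by the Jacobian determinant of the change of charts. -/
lemma density_transition (q q' : X) {y : EuclideanSpace ℝ (Fin N)}
    (hy : y ∈ (extChartAt (𝓡 N) q).target)
    (hy' : param N q y ∈ (extChartAt (𝓡 N) q').source) :
    density q y = |(fderiv ℝ (transition (N := N) q q') y).det| *
      density q' (transition q q' y) := by
  set D := fderiv ℝ (transition (N := N) q q') y with hD
  let b := (EuclideanSpace.basisFun (Fin N) ℝ).toBasis
  let J := LinearMap.toMatrix b b (D : EuclideanSpace ℝ (Fin N) →ₗ[ℝ] EuclideanSpace ℝ (Fin N))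
  have hJ : ∀ k i, J k i = D (EuclideanSpace.single i 1) k := by
    intro k i
    simp [J, LinearMap.toMatrix_apply, b]
  have hg : coordMetric N q y = J.transpose * coordMetric N q' (transition q q' y) * J := by
    ext i j
    rw [coordMetric, Matrix.of_apply, inner_coordVector_transition q q' hy hy',
      inner_coordVector, Matrix.mul_assoc, Matrix.mul_apply]
    simp only [dotProduct, Matrix.mulVec, Matrix.transpose_apply, Matrix.mul_apply, hJ, ← hD]
  have hdet : D.det = J.det := by
    simp only [J, LinearMap.det_toMatrix]
  rw [density, density, hg, Matrix.det_mul, Matrix.det_mul, Matrix.det_transpose, hdet,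
    show J.det * (coordMetric N q' (transition q q' y)).det * J.det
      = J.det ^ 2 * (coordMetric N q' (transition q q' y)).det by ring,
    Real.sqrt_mul (sq_nonneg _), Real.sqrt_sq_eq_abs]

variable [MeasurableSpace X] [BorelSpace X]
  [hsm : IsContMDiffRiemannianBundle (𝓡 N) ∞ (EuclideanSpace ℝ (Fin N))
      (fun x : X => TangentSpace (𝓡 N) x)]

/-- The measure `√(det hᵢⱼ) dy` on the image of the chart at `q`. -/
def coordVolume (q : X) : Measure (EuclideanSpace ℝ (Fin N)) :=
  ((volume : Measure (EuclideanSpace ℝ (Fin N))).restrict (extChartAt (𝓡 N) q).target).withDensity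
    (fun y => ENNReal.ofReal (density q y))

lemma chartVolume_eq_map (q : X) : chartVolume N q = (coordVolume (N := N) q).map (param N q) := rfl

lemma measurableSet_target (q : X) : MeasurableSet (extChartAt (𝓡 N) q).target :=
  (isOpen_target q).measurableSet

lemma measurableSet_source (q : X) : MeasurableSet (extChartAt (𝓡 N) q).source :=
  (isOpen_extChartAt_source q).measurableSet

lemma aemeasurable_param (q : X) :
    AEMeasurable (param N q) (volume.restrict (extChartAt (𝓡 N) q).target) :=
  (continuousOn_param q).aemeasurable (measurableSet_target q)

lemma coordVolume_ac (q : X) :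
    coordVolume (N := N) q ≪ volume.restrict (extChartAt (𝓡 N) q).target :=
  withDensity_absolutelyContinuous _ _

lemma aemeasurable_density (q : X) :
    AEMeasurable (fun y => ENNReal.ofReal (density (N := N) q y))
      (volume.restrict (extChartAt (𝓡 N) q).target) :=
  ((continuousOn_density q).aemeasurable (measurableSet_target q)).ennreal_ofReal

lemma ac_coordVolume (q : X) :
    volume.restrict (extChartAt (𝓡 N) q).target ≪ coordVolume (N := N) q := by
  refine withDensity_absolutelyContinuous' (aemeasurable_density q) ?_
  filter_upwards [ae_restrict_mem (measurableSet_target q)] with y hy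
  simpa using density_pos q hy

lemma aemeasurable_param_coordVolume (q : X) : AEMeasurable (param N q) (coordVolume q) :=
  (aemeasurable_param q).mono_ac (coordVolume_ac q)

lemma ae_coordVolume_mem (q : X) :
    ∀ᵐ y ∂(coordVolume (N := N) q), y ∈ (extChartAt (𝓡 N) q).target :=
  (coordVolume_ac q).ae_le (ae_restrict_mem (measurableSet_target q))

lemma measurableSet_target_inter_preimage (q : X) {A : Set X} (hA : MeasurableSet A) :
    MeasurableSet ((extChartAt (𝓡 N) q).target ∩ param N q ⁻¹' A) := by
  classical
  have h : Measurable ((extChartAt (𝓡 N) q).target.piecewise (param N q) fun _ => q) :=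
    (continuousOn_param q).measurable_piecewise continuousOn_const (measurableSet_target q)
  have e : (extChartAt (𝓡 N) q).target ∩ param N q ⁻¹' A = (extChartAt (𝓡 N) q).target ∩
      ((extChartAt (𝓡 N) q).target.piecewise (param N q) fun _ => q) ⁻¹' A := by
    ext y
    simp only [Set.mem_inter_iff, Set.mem_preimage]
    refine and_congr_right fun hy => ?_
    rw [Set.piecewise_eq_of_mem _ _ _ hy]
  rw [e]
  exact (measurableSet_target q).inter (h hA)

lemma chartVolume_apply (q : X) {A : Set X} (hA : MeasurableSet A) :
    chartVolume N q A = ∫⁻ y in (extChartAt (𝓡 N) q).target ∩ param N q ⁻¹' A,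
      ENNReal.ofReal (density q y) := by
  rw [chartVolume_eq_map, Measure.map_apply_of_aemeasurable (aemeasurable_param_coordVolume q) hA]
  have h1 : coordVolume (N := N) q (param N q ⁻¹' A)
      = coordVolume q ((extChartAt (𝓡 N) q).target ∩ param N q ⁻¹' A) := by
    refine measure_congr ?_
    filter_upwards [ae_coordVolume_mem q] with y hy
    exact propext ⟨fun h => ⟨hy, h⟩, fun h => h.2⟩
  rw [h1, coordVolume, withDensity_apply _ (measurableSet_target_inter_preimage q hA),
    Measure.restrict_restrict (measurableSet_target_inter_preimage q hA),
    Set.inter_eq_left.2 Set.inter_subset_left]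

/-- The volumes of two charts agree on the overlap, by the change of variables formula. -/
lemma chartVolume_eq_of_subset (q q' : X) {A : Set X} (hA : MeasurableSet A)
    (h : A ⊆ (extChartAt (𝓡 N) q).source) (h' : A ⊆ (extChartAt (𝓡 N) q').source) :
    chartVolume N q A = chartVolume N q' A := by
  rw [chartVolume_apply q hA, chartVolume_apply q' hA]
  -- the transition map carries the part of the chart at `q` over `A` to that of the chart at `q'`
  have him : transition (N := N) q q' '' ((extChartAt (𝓡 N) q).target ∩ param N q ⁻¹' A)
      = (extChartAt (𝓡 N) q').target ∩ param N q' ⁻¹' A := by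
    ext z
    constructor
    · rintro ⟨y, ⟨hy, hyA⟩, rfl⟩
      refine ⟨(extChartAt (𝓡 N) q').map_source (h' hyA), ?_⟩
      rw [Set.mem_preimage, param_transition q q' (h' hyA)]
      exact hyA
    · rintro ⟨hz, hzA⟩
      refine ⟨transition q' q z, ⟨(extChartAt (𝓡 N) q).map_source (h hzA), ?_⟩, ?_⟩
      · rw [Set.mem_preimage, param_transition q' q (h hzA)]
        exact hzA
      · rw [transition, param_transition q' q (h hzA)]
        exact (extChartAt (𝓡 N) q').right_inv hz
  have hinj : Set.InjOn (transition (N := N) q q')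
      ((extChartAt (𝓡 N) q).target ∩ param N q ⁻¹' A) := by
    rintro y ⟨hy, hyA⟩ z ⟨hz, hzA⟩ e
    have e' : param N q y = param N q z := by
      rw [← param_transition q q' (h' hyA), ← param_transition q q' (h' hzA), e]
    exact (extChartAt (𝓡 N) q).symm.injOn hy hz e'
  have key := lintegral_image_eq_lintegral_abs_det_fderiv_mul volume
    (measurableSet_target_inter_preimage q hA)
    (fun y hy => (differentiableAt_transition q q' hy.1 (h' hy.2)).hasFDerivAt.hasFDerivWithinAt)
    hinj (fun z => ENNReal.ofReal (density q' z))
  rw [← him, key]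
  refine setLIntegral_congr_fun (measurableSet_target_inter_preimage q hA) fun y hy => ?_
  rw [density_transition q q' hy.1 (h' hy.2), ENNReal.ofReal_mul (abs_nonneg _)]

lemma chartVolume_le_riemannianVolume (q : X) : chartVolume N q ≤ riemannianVolume N X :=
  le_iSup (fun q : X => chartVolume N q) q

lemma chartVolume_compl_source (q : X) :
    chartVolume N q (extChartAt (𝓡 N) q).sourceᶜ = 0 := by
  rw [chartVolume_apply q (measurableSet_source q).compl]
  have : (extChartAt (𝓡 N) q).target ∩ param N q ⁻¹' (extChartAt (𝓡 N) q).sourceᶜ = ∅ := by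
    ext y
    simp only [Set.mem_inter_iff, Set.mem_preimage, Set.mem_compl_iff, Set.mem_empty_iff_false,
      iff_false, not_and, not_not]
    exact fun hy => param_mem_source q hy
  rw [this, Measure.restrict_empty, lintegral_zero_measure]

/-- The volume restricts to the domain of each chart as the volume of that chart. -/
lemma riemannianVolume_restrict_source (q : X) :
    (riemannianVolume N X).restrict (extChartAt (𝓡 N) q).source = chartVolume N q := by
  set S := (extChartAt (𝓡 N) q).source with hS
  have hSm : MeasurableSet S := measurableSet_source q
  -- the comparison measure is infinite on every nonempty set outside of `S`
  let ν : Measure X := chartVolume N q + ((⊤ : ENNReal) • Measure.count).restrict Sᶜ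
  have hle : riemannianVolume N X ≤ ν := by
    refine iSup_le fun q' => Measure.le_iff.2 fun B hB => ?_
    rw [← measure_inter_add_sdiff B hSm]
    -- outside of `S` the comparison measure dominates, inside of `S` the chart volumes agree
    have hd : chartVolume N q' (B \ S) ≤ (((⊤ : ENNReal) • Measure.count).restrict Sᶜ) B := by
      rw [Measure.restrict_apply hB]
      rcases (B ∩ Sᶜ).eq_empty_or_nonempty with h | h
      · rw [show B \ S = ∅ from h]; simp
      · have : (Measure.count (B ∩ Sᶜ) : ENNReal) ≠ 0 := by
          simpa [Measure.count_eq_zero_iff] using h.ne_empty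
        rw [Measure.smul_apply, smul_eq_mul, ENNReal.top_mul this]
        exact le_top
    have hi : chartVolume N q' (B ∩ S) ≤ chartVolume N q B := by
      have e : chartVolume N q' (B ∩ S)
          = chartVolume N q' (B ∩ S ∩ (extChartAt (𝓡 N) q').source) := by
        rw [← measure_inter_add_sdiff (B ∩ S) (measurableSet_source (N := N) q')]
        have : chartVolume N q' ((B ∩ S) \ (extChartAt (𝓡 N) q').source) = 0 :=
          measure_mono_null (fun x hx => hx.2) (chartVolume_compl_source q')
        rw [this, add_zero]
      rw [e, chartVolume_eq_of_subset q' q ((hB.inter hSm).inter (measurableSet_source q'))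
        (fun x hx => hx.2) (fun x hx => hx.1.2)]
      exact measure_mono fun x hx => hx.1.1
    exact add_le_add hi hd
  refine le_antisymm ?_ ?_
  · refine Measure.le_iff.2 fun B hB => ?_
    rw [Measure.restrict_apply hB]
    refine (hle (B ∩ S)).trans ?_
    have : (((⊤ : ENNReal) • Measure.count).restrict Sᶜ) (B ∩ S) = 0 := by
      rw [Measure.restrict_apply (hB.inter hSm)]
      have : B ∩ S ∩ Sᶜ = ∅ := by ext x; simp
      simp [this]
    rw [Measure.add_apply, this, add_zero]
    exact measure_mono Set.inter_subset_left
  · refine Measure.le_iff.2 fun B hB => ?_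
    rw [Measure.restrict_apply hB, ← measure_inter_add_sdiff B hSm]
    have : chartVolume N q (B \ S) = 0 :=
      measure_mono_null (fun x hx => hx.2) (chartVolume_compl_source q)
    rw [this, add_zero]
    exact chartVolume_le_riemannianVolume q _

lemma map_extChartAt_riemannianVolume (q : X) :
    AEMeasurable (extChartAt (𝓡 N) q)
      ((riemannianVolume N X).restrict (extChartAt (𝓡 N) q).source) ∧
    ((riemannianVolume N X).restrict (extChartAt (𝓡 N) q).source).map (extChartAt (𝓡 N) q)
      = coordVolume q := by
  have hm : AEMeasurable (extChartAt (𝓡 N) q)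
      ((riemannianVolume N X).restrict (extChartAt (𝓡 N) q).source) :=
    (continuousOn_extChartAt q).aemeasurable (measurableSet_source q)
  refine ⟨hm, ?_⟩
  rw [riemannianVolume_restrict_source, chartVolume_eq_map] at *
  rw [AEMeasurable.map_map_of_aemeasurable hm (aemeasurable_param_coordVolume q)]
  conv_rhs => rw [← Measure.map_id (μ := coordVolume (N := N) q)]
  refine Measure.map_congr ?_
  filter_upwards [ae_coordVolume_mem q] with y hy
  exact (extChartAt (𝓡 N) q).right_inv hy

lemma ae_chart_of_ae (q : X) {P : X → Prop} (h : ∀ᵐ x ∂(riemannianVolume N X), P x) :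
    ∀ᵐ y ∂(volume.restrict (extChartAt (𝓡 N) q).target), P (param N q y) := by
  have h1 : ∀ᵐ x ∂(chartVolume N q), P x := by
    rw [← riemannianVolume_restrict_source]; exact ae_restrict_of_ae h
  rw [chartVolume_eq_map] at h1
  exact (ac_coordVolume q).ae_le (ae_of_ae_map (aemeasurable_param_coordVolume q) h1)

lemma ae_source_of_ae_chart (q : X) {P : X → Prop}
    (h : ∀ᵐ y ∂(volume.restrict (extChartAt (𝓡 N) q).target), P (param N q y)) :
    ∀ᵐ x ∂((riemannianVolume N X).restrict (extChartAt (𝓡 N) q).source), P x := by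
  obtain ⟨h1, h2⟩ := map_extChartAt_riemannianVolume (N := N) q
  have h3 := (coordVolume_ac q).ae_le h
  rw [← h2] at h3
  filter_upwards [ae_of_ae_map h1 h3, ae_restrict_mem (measurableSet_source q)] with x hx hxS
  have : param N q (extChartAt (𝓡 N) q x) = x := (extChartAt (𝓡 N) q).left_inv hxS
  rwa [this] at hx

lemma aestronglyMeasurable_source_of_chart (q : X) {u : X → ℝ}
    (h : AEStronglyMeasurable (fun y => u (param N q y))
      (volume.restrict (extChartAt (𝓡 N) q).target)) :
    AEStronglyMeasurable u ((riemannianVolume N X).restrict (extChartAt (𝓡 N) q).source) := by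
  obtain ⟨h1, h2⟩ := map_extChartAt_riemannianVolume (N := N) q
  have h3 := h.mono_ac (coordVolume_ac q)
  rw [← h2] at h3
  refine (h3.comp_aemeasurable h1).congr ?_
  filter_upwards [ae_restrict_mem (measurableSet_source q)] with x hxS
  have : param N q (extChartAt (𝓡 N) q x) = x := (extChartAt (𝓡 N) q).left_inv hxS
  exact congrArg u this

/-- Integration over the domain of a chart, in coordinates. -/
lemma setLIntegral_source (q : X) {F : X → ENNReal}
    (hF : AEMeasurable F ((riemannianVolume N X).restrict (extChartAt (𝓡 N) q).source)) :
    ∫⁻ x in (extChartAt (𝓡 N) q).source, F x ∂(riemannianVolume N X)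
      = ∫⁻ y in (extChartAt (𝓡 N) q).target,
          ENNReal.ofReal (density q y) * F (param N q y) := by
  rw [riemannianVolume_restrict_source, chartVolume_eq_map] at *
  rw [lintegral_map' hF (aemeasurable_param_coordVolume q), coordVolume,
    lintegral_withDensity_eq_lintegral_mul₀' (g := fun y => F (param N q y))
      (aemeasurable_density q) (hF.comp_aemeasurable (aemeasurable_param_coordVolume q))]
  rfl

variable [SecondCountableTopology X]

variable (N X) in
lemma exists_countable_cover :
    ∃ s : Set X, s.Countable ∧ ⋃ q ∈ s, (extChartAt (𝓡 N) q).source = Set.univ :=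
  TopologicalSpace.countable_cover_nhds fun q : X => extChartAt_source_mem_nhds (I := 𝓡 N) q

lemma ae_of_forall_chart {P : X → Prop}
    (h : ∀ q : X, ∀ᵐ y ∂(volume.restrict (extChartAt (𝓡 N) q).target), P (param N q y)) :
    ∀ᵐ x ∂(riemannianVolume N X), P x := by
  obtain ⟨s, hs, hc⟩ := exists_countable_cover N X
  rw [← Measure.restrict_univ (μ := riemannianVolume N X), ← hc, ae_restrict_biUnion_eq _ hs]
  simp only [eventually_iSup]
  exact fun q _ => ae_source_of_ae_chart q (h q)

lemma aestronglyMeasurable_of_forall_chart {u : X → ℝ}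
    (h : ∀ q : X, AEStronglyMeasurable (fun y => u (param N q y))
      (volume.restrict (extChartAt (𝓡 N) q).target)) :
    AEStronglyMeasurable u (riemannianVolume N X) := by
  obtain ⟨s, hs, hc⟩ := exists_countable_cover N X
  have := hs.to_subtype
  rw [← Measure.restrict_univ (μ := riemannianVolume N X), ← hc, Set.biUnion_eq_iUnion,
    aestronglyMeasurable_iUnion_iff]
  exact fun q => aestronglyMeasurable_source_of_chart q.1 (h q.1)

end Volume

/-! ### Gradients and weak gradients -/

section WeakGradient

section Euclidean

variable {E : Type*} [NormedAddCommGroup E] [NormedSpace ℝ E] [MeasurableSpace E] [BorelSpace E]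
  [FiniteDimensional ℝ E] {μ : Measure E} {U : Set E}

lemma integrable_mul_of_locallyIntegrableOn {g η : E → ℝ} (hg : LocallyIntegrableOn g U μ)
    (hη : Continuous η) (hc : HasCompactSupport η) (hs : tsupport η ⊆ U) :
    Integrable (fun y => g y * η y) μ := by
  have h1 : IntegrableOn g (tsupport η) μ := hg.integrableOn_compact_subset hs hc
  have h2 : IntegrableOn (fun y => g y * η y) (tsupport η) μ :=
    h1.mul_continuousOn hη.continuousOn hc
  refine (integrableOn_iff_integrable_of_support_subset fun y hy => ?_).1 h2
  exact subset_tsupport _ (fun h => hy (by simp [h]))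

lemma locallyIntegrableOn_congr_ae (hU : IsOpen U) {g g' : E → ℝ} (hg : LocallyIntegrableOn g U μ)
    (h : ∀ᵐ y ∂(μ.restrict U), g y = g' y) : LocallyIntegrableOn g' U μ := by
  have := FiniteDimensional.proper_real E
  rw [locallyIntegrableOn_iff hU.isLocallyClosed] at hg ⊢
  intro k hk hkc
  exact (hg k hk hkc).congr_fun_ae (ae_mono (Measure.restrict_mono_set μ hk) h)

variable [μ.IsAddHaarMeasure]

/-- Rademacher's theorem on an open set. -/
lemma ae_differentiableAt_of_locallyLipschitzOn (hU : IsOpen U) {w : E → ℝ}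
    (hw : LocallyLipschitzOn U w) : ∀ᵐ y ∂(μ.restrict U), DifferentiableAt ℝ w y := by
  rw [ae_restrict_iff' hU.measurableSet]
  have : μ {y | y ∈ U ∧ ¬ DifferentiableAt ℝ w y} = 0 := by
    refine measure_null_of_locally_null _ fun y hy => ?_
    obtain ⟨K, t, ht, hK⟩ := hw hy.1
    rw [hU.nhdsWithin_eq hy.1] at ht
    obtain ⟨s, hst, hs, hys⟩ := mem_nhds_iff.1 ht
    refine ⟨_, inter_mem_nhdsWithin _ (hs.mem_nhds hys), ?_⟩
    have h := (hK.mono hst).ae_differentiableWithinAt_of_mem (μ := μ)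
    refine measure_mono_null (fun z hz => ?_) h
    simp only [Set.mem_inter_iff, Set.mem_ofPred_eq, Set.mem_compl_iff] at hz ⊢
    intro h'
    exact hz.1.2 ((h' hz.2).differentiableAt (hs.mem_nhds hz.2))
  rw [ae_iff]
  convert this using 2
  ext y; simp

lemma locallyIntegrableOn_fderiv_of_locallyLipschitzOn (hU : IsOpen U) {w : E → ℝ}
    (hw : LocallyLipschitzOn U w) (v : E) :
    LocallyIntegrableOn (fun y => fderiv ℝ w y v) U μ := by
  intro y hy
  obtain ⟨K, t, ht, hK⟩ := hw hy
  rw [hU.nhdsWithin_eq hy] at ht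
  obtain ⟨s, hst, hs, hys⟩ := mem_nhds_iff.1 ht
  obtain ⟨r, hr, hrs⟩ := Metric.isOpen_iff.1 hs y hys
  refine ⟨Metric.ball y r, mem_nhdsWithin_of_mem_nhds (Metric.ball_mem_nhds y hr), ?_⟩
  refine Measure.integrableOn_of_bounded (M := K * ‖v‖) measure_ball_lt_top.ne
    (measurable_fderiv_apply_const ℝ w v).aestronglyMeasurable ?_
  filter_upwards [ae_restrict_mem Metric.isOpen_ball.measurableSet] with z hz
  refine (ContinuousLinearMap.le_opNorm _ _).trans ?_
  gcongr
  exact norm_fderiv_le_of_lipschitzOn ℝ (Metric.isOpen_ball.mem_nhds hz) (hK.mono (hrs.trans hst))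

/-- Integration by parts for a locally Lipschitz function on an open set, against a test function
with support in this set: extend the restriction to a compact neighbourhood of the support to a
globally Lipschitz function, and apply Rademacher's theorem. -/
lemma integral_mul_fderiv_eq_of_locallyLipschitzOn (hU : IsOpen U) {w : E → ℝ}
    (hw : LocallyLipschitzOn U w) (v : E) {η : E → ℝ} (hη : ContDiff ℝ ∞ η)
    (hc : HasCompactSupport η) (hs : tsupport η ⊆ U) :
    ∫ y, w y * fderiv ℝ η y v ∂μ = - ∫ y, fderiv ℝ w y v * η y ∂μ := by
  have := FiniteDimensional.proper_real E
  obtain ⟨δ, hδ, hδU⟩ := hc.isCompact.exists_cthickening_subset_open hU hs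
  obtain ⟨C, hC⟩ := LocallyLipschitzOn.exists_lipschitzOnWith_of_compact
    (hc.isCompact.cthickening (r := δ)) (hw.mono hδU)
  obtain ⟨w', hw', hww'⟩ := hC.extend_real
  obtain ⟨D, hD⟩ := ContDiff.lipschitzWith_of_hasCompactSupport hc hη (by simp)
  have key := LipschitzWith.integral_lineDeriv_mul_eq (μ := μ) hw' hD hc v
  have hev : ∀ y ∈ tsupport η, w' =ᶠ[𝓝 y] w := by
    intro y hy
    filter_upwards [Metric.isOpen_thickening.mem_nhds (Metric.self_subset_thickening hδ _ hy)]
      with z hz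
    exact (hww' (Metric.thickening_subset_cthickening _ _ hz)).symm
  have h1 : ∀ y, w y * fderiv ℝ η y v = - (lineDeriv ℝ η y (-v) * w' y) := by
    intro y
    rw [((hη.differentiable (by simp)) y).lineDeriv_eq_fderiv, map_neg]
    by_cases hy : y ∈ tsupport η
    · rw [(hev y hy).eq_of_nhds]; ring
    · have : fderiv ℝ η y = 0 := by
        by_contra h
        exact hy (tsupport_fderiv_subset ℝ (f := η) (subset_tsupport _ h))
      simp [this]
  have h2 : ∀ᵐ y ∂μ, fderiv ℝ w y v * η y = lineDeriv ℝ w' y v * η y := by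
    filter_upwards [(ae_restrict_iff' hU.measurableSet).1
      (ae_differentiableAt_of_locallyLipschitzOn (μ := μ) hU hw)] with y hd
    by_cases hy : y ∈ tsupport η
    · have hd' : DifferentiableAt ℝ w' y := (hd (hs hy)).congr_of_eventuallyEq (hev y hy)
      rw [hd'.lineDeriv_eq_fderiv, (hev y hy).fderiv_eq]
    · rw [image_eq_zero_of_notMem_tsupport hy]; simp
  simp only [h1]
  rw [integral_neg, integral_congr_ae h2, key]

end Euclidean

variable {N : ℕ} {X : Type*} [TopologicalSpace X] [ChartedSpace (EuclideanSpace ℝ (Fin N)) X]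
  [IsManifold (𝓡 N) ∞ X] [RiemannianBundle (fun x : X => TangentSpace (𝓡 N) x)]

/-- The gradient of a function: the vector representing its differential, hence `0` at points where
the function is not differentiable. -/
def grad (w : X → ℝ) (x : X) : TangentSpace (𝓡 N) x :=
  haveI : FiniteDimensional ℝ (TangentSpace (𝓡 N) x) :=
    inferInstanceAs (FiniteDimensional ℝ (EuclideanSpace ℝ (Fin N)))
  haveI : CompleteSpace (TangentSpace (𝓡 N) x) := FiniteDimensional.complete ℝ _
  (InnerProductSpace.toDual ℝ (TangentSpace (𝓡 N) x)).symm
    (show TangentSpace (𝓡 N) x →L[ℝ] ℝ from mfderiv (𝓡 N) 𝓘(ℝ) w x)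

lemma inner_grad (w : X → ℝ) (x : X) (ξ : TangentSpace (𝓡 N) x) :
    inner ℝ (grad w x) ξ = (mfderiv (𝓡 N) 𝓘(ℝ) w x ξ : ℝ) := by
  have : FiniteDimensional ℝ (TangentSpace (𝓡 N) x) :=
    inferInstanceAs (FiniteDimensional ℝ (EuclideanSpace ℝ (Fin N)))
  have : CompleteSpace (TangentSpace (𝓡 N) x) := FiniteDimensional.complete ℝ _
  rw [grad, InnerProductSpace.toDual_symm_apply]
  rfl

lemma mdifferentiableAt_of_chart (q : X) {w : X → ℝ} {y : EuclideanSpace ℝ (Fin N)}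
    (hy : y ∈ (extChartAt (𝓡 N) q).target)
    (hw : DifferentiableAt ℝ (fun y => w (param N q y)) y) :
    MDifferentiableAt (𝓡 N) 𝓘(ℝ) w (param N q y) := by
  have hy' := param_mem_source q hy
  have h1 : MDifferentiableAt (𝓡 N) (𝓡 N) (extChartAt (𝓡 N) q) (param N q y) :=
    mdifferentiableAt_extChartAt (by simpa using hy')
  have e : extChartAt (𝓡 N) q (param N q y) = y := (extChartAt (𝓡 N) q).right_inv hy
  have h2 : MDifferentiableAt (𝓡 N) 𝓘(ℝ) (fun y => w (param N q y))
      (extChartAt (𝓡 N) q (param N q y)) := by rw [e]; exact hw.mdifferentiableAt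
  refine (h2.comp _ h1).congr_of_eventuallyEq ?_
  filter_upwards [(isOpen_extChartAt_source q).mem_nhds hy'] with x hx
  exact (congrArg w ((extChartAt (𝓡 N) q).left_inv hx)).symm

lemma inner_grad_coordVector (q : X) {w : X → ℝ} {y : EuclideanSpace ℝ (Fin N)}
    (hy : y ∈ (extChartAt (𝓡 N) q).target)
    (hw : MDifferentiableAt (𝓡 N) 𝓘(ℝ) w (param N q y)) (v : EuclideanSpace ℝ (Fin N)) :
    inner ℝ (grad w (param N q y)) (coordVector N q y v)
      = fderiv ℝ (fun y => w (param N q y)) y v := by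
  rw [inner_grad, ← mfderiv_eq_fderiv, coordVector]
  have := (hw.hasMFDerivAt.comp y (mdifferentiableAt_param q hy).hasMFDerivAt).mfderiv
  exact (DFunLike.congr_fun this v).symm

lemma differentiableAt_chart (q : X) {w : X → ℝ} {y : EuclideanSpace ℝ (Fin N)}
    (hy : y ∈ (extChartAt (𝓡 N) q).target)
    (hw : MDifferentiableAt (𝓡 N) 𝓘(ℝ) w (param N q y)) :
    DifferentiableAt ℝ (fun y => w (param N q y)) y :=
  (hw.comp y (mdifferentiableAt_param q hy)).differentiableAt

lemma contDiffOn_chart (q : X) {φ : X → ℝ} (hφ : ContMDiff (𝓡 N) 𝓘(ℝ) ∞ φ) :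
    ContDiffOn ℝ ∞ (fun y => φ (param N q y)) (extChartAt (𝓡 N) q).target :=
  (hφ.comp_contMDiffOn (contMDiffOn_param q)).contDiffOn

variable (N) in
/-- A function on a manifold which is locally Lipschitz in every chart. -/
def LocallyLipschitzInCharts {X : Type*} [TopologicalSpace X]
    [ChartedSpace (EuclideanSpace ℝ (Fin N)) X] (w : X → ℝ) : Prop :=
  ∀ q : X, LocallyLipschitzOn (extChartAt (𝓡 N) q).target (fun y => w (param N q y))

lemma locallyLipschitzInCharts_of_contMDiff {φ : X → ℝ} (hφ : ContMDiff (𝓡 N) 𝓘(ℝ) ∞ φ) :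
    LocallyLipschitzInCharts N φ := by
  intro q y hy
  obtain ⟨K, t, ht, h⟩ := (((contDiffOn_chart q hφ).contDiffAt
    ((isOpen_target q).mem_nhds hy)).of_le (m := 1) (by simp)).exists_lipschitzOnWith
  exact ⟨K, t, mem_nhdsWithin_of_mem_nhds ht, h⟩

/-- The gradient of a locally Lipschitz function, defined almost everywhere, is a weak gradient. -/
lemma hasWeakGradient_grad {w : X → ℝ} (hw : LocallyLipschitzInCharts N w) :
    HasWeakGradient N w (grad w) := by
  have hae : ∀ (q : X) (v : EuclideanSpace ℝ (Fin N)),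
      ∀ᵐ y ∂(volume.restrict (extChartAt (𝓡 N) q).target),
        fderiv ℝ (fun y => w (param N q y)) y v
          = inner ℝ (grad w (param N q y)) (coordVector N q y v) := by
    intro q v
    filter_upwards [ae_differentiableAt_of_locallyLipschitzOn (isOpen_target q) (hw q),
      ae_restrict_mem (isOpen_target q).measurableSet] with y h1 h2
    exact (inner_grad_coordVector q h2 (mdifferentiableAt_of_chart q h2 h1) v).symm
  refine ⟨fun q => ?_, fun q v => ?_, fun q v η hη hc hs => ?_⟩
  · exact (hw q).continuousOn.locallyIntegrableOn (isOpen_target q).measurableSet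
  · exact locallyIntegrableOn_congr_ae (isOpen_target q)
      (locallyIntegrableOn_fderiv_of_locallyLipschitzOn (isOpen_target q) (hw q) v) (hae q v)
  · rw [integral_mul_fderiv_eq_of_locallyLipschitzOn (isOpen_target q) (hw q) v hη hc hs]
    congr 1
    refine integral_congr_ae ?_
    filter_upwards [(ae_restrict_iff' (isOpen_target q).measurableSet).1 (hae q v)] with y h
    by_cases hy : y ∈ tsupport η
    · rw [h (hs hy)]
    · rw [image_eq_zero_of_notMem_tsupport hy]; simp

lemma contDiff_mul_of_tsupport_subset {E : Type*} [NormedAddCommGroup E] [NormedSpace ℝ E]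
    {U : Set E} (hU : IsOpen U) {g η : E → ℝ} (hg : ContDiffOn ℝ ∞ g U) (hη : ContDiff ℝ ∞ η)
    (hs : tsupport η ⊆ U) : ContDiff ℝ ∞ (fun y => g y * η y) := by
  rw [contDiff_iff_contDiffAt]
  intro y
  by_cases hy : y ∈ tsupport η
  · exact (hg.contDiffAt (hU.mem_nhds (hs hy))).mul hη.contDiffAt
  · refine (contDiffAt_const (c := (0 : ℝ))).congr_of_eventuallyEq ?_
    filter_upwards [(isClosed_tsupport η).isOpen_compl.mem_nhds hy] with z hz
    rw [image_eq_zero_of_notMem_tsupport hz, mul_zero]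

namespace HasWeakGradient

variable {u u' : X → ℝ} {G G' : ∀ x : X, TangentSpace (𝓡 N) x}

lemma add (h : HasWeakGradient N u G) (h' : HasWeakGradient N u' G') :
    HasWeakGradient N (fun x => u x + u' x) (fun x => G x + G' x) := by
  refine ⟨fun q => (h.locallyIntegrable q).add (h'.locallyIntegrable q), fun q v => ?_,
    fun q v η hη hc hs => ?_⟩
  · simp only [inner_add_left]
    exact (h.locallyIntegrable_gradient q v).add (h'.locallyIntegrable_gradient q v)
  · have hc' : HasCompactSupport (fun y => fderiv ℝ η y v) := hc.fderiv_apply (𝕜 := ℝ) v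
    have hη' : Continuous (fun y => fderiv ℝ η y v) :=
      (hη.continuous_fderiv (by simp)).clm_apply continuous_const
    have hs' : tsupport (fun y => fderiv ℝ η y v) ⊆ (extChartAt (𝓡 N) q).target :=
      (tsupport_fderiv_apply_subset ℝ v).trans hs
    simp only [inner_add_left, add_mul]
    rw [integral_add (integrable_mul_of_locallyIntegrableOn (h.locallyIntegrable q) hη' hc' hs')
        (integrable_mul_of_locallyIntegrableOn (h'.locallyIntegrable q) hη' hc' hs'),
      integral_add
        (integrable_mul_of_locallyIntegrableOn (h.locallyIntegrable_gradient q v) hη.continuous hc hs)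
        (integrable_mul_of_locallyIntegrableOn (h'.locallyIntegrable_gradient q v) hη.continuous hc hs),
      h.integral_eq q v η hη hc hs, h'.integral_eq q v η hη hc hs]
    ring

lemma const_mul (h : HasWeakGradient N u G) (c : ℝ) :
    HasWeakGradient N (fun x => c * u x) (fun x => c • G x) := by
  refine ⟨fun q => (h.locallyIntegrable q).smul c, fun q v => ?_, fun q v η hη hc hs => ?_⟩
  · simp only [inner_smul_left]
    exact (h.locallyIntegrable_gradient q v).smul c
  · simp only [inner_smul_left, mul_assoc, integral_const_mul, h.integral_eq q v η hη hc hs]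
    simp

lemma sub (h : HasWeakGradient N u G) (h' : HasWeakGradient N u' G') :
    HasWeakGradient N (fun x => u x - u' x) (fun x => G x - G' x) := by
  have := h.add (h'.const_mul (-1))
  simpa [sub_eq_add_neg] using this

/-- Product rule for a smooth and a weakly differentiable function. -/
lemma contMDiff_mul (h : HasWeakGradient N u G) {φ : X → ℝ} (hφ : ContMDiff (𝓡 N) 𝓘(ℝ) ∞ φ) :
    HasWeakGradient N (fun x => φ x * u x) (fun x => φ x • G x + u x • grad φ x) := by
  have hT := fun q : X => isOpen_target (N := N) q
  have hd : ∀ (q : X) (y : EuclideanSpace ℝ (Fin N)), y ∈ (extChartAt (𝓡 N) q).target →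
      DifferentiableAt ℝ (fun y => φ (param N q y)) y := fun q y hy =>
    ((contDiffOn_chart q hφ).contDiffAt ((hT q).mem_nhds hy)).differentiableAt (by simp)
  have hg : ∀ (q : X) (y : EuclideanSpace ℝ (Fin N)), y ∈ (extChartAt (𝓡 N) q).target → ∀ v,
      inner ℝ (grad φ (param N q y)) (coordVector N q y v)
        = fderiv ℝ (fun y => φ (param N q y)) y v := fun q y hy v =>
    inner_grad_coordVector q hy (mdifferentiableAt_of_chart q hy (hd q y hy)) v
  have hcf : ∀ (q : X) (v : EuclideanSpace ℝ (Fin N)), ContinuousOn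
      (fun y => fderiv ℝ (fun y => φ (param N q y)) y v) (extChartAt (𝓡 N) q).target :=
    fun q v => (((contDiffOn_chart q hφ).continuousOn_fderiv_of_isOpen (hT q)
      (by simp)).clm_apply continuousOn_const)
  have hcφ := fun q : X => (contDiffOn_chart (N := N) q hφ).continuousOn
  refine ⟨fun q => ?_, fun q v => ?_, fun q v η hη hc hs => ?_⟩
  · exact (h.locallyIntegrable q).continuousOn_mul (hcφ q) (hT q).isLocallyClosed
  · have h1 := ((h.locallyIntegrable_gradient q v).continuousOn_mul (hcφ q)
      (hT q).isLocallyClosed).add ((h.locallyIntegrable q).mul_continuousOn (hcf q v)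
      (hT q).isLocallyClosed)
    refine locallyIntegrableOn_congr_ae (hT q) h1 ?_
    filter_upwards [ae_restrict_mem (hT q).measurableSet] with y hy
    simp only [inner_add_left, inner_smul_left, Pi.add_apply, hg q y hy, conj_trivial]
  · have hθ := contDiff_mul_of_tsupport_subset (hT q) (contDiffOn_chart q hφ) hη hs
    have hθc : HasCompactSupport (fun y => φ (param N q y) * η y) := hc.mul_left
    have key := h.integral_eq q v _ hθ hθc ((tsupport_mul_subset_right).trans hs)
    have hc' : HasCompactSupport (fun y => fderiv ℝ η y v) := hc.fderiv_apply (𝕜 := ℝ) v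
    have hη' : Continuous (fun y => fderiv ℝ η y v) :=
      (hη.continuous_fderiv (by simp)).clm_apply continuous_const
    have hs' : tsupport (fun y => fderiv ℝ η y v) ⊆ (extChartAt (𝓡 N) q).target :=
      (tsupport_fderiv_apply_subset ℝ v).trans hs
    have i1 := integrable_mul_of_locallyIntegrableOn ((h.locallyIntegrable q).continuousOn_mul
      (hcφ q) (hT q).isLocallyClosed) hη' hc' hs'
    have i2 := integrable_mul_of_locallyIntegrableOn ((h.locallyIntegrable q).mul_continuousOn
      (hcf q v) (hT q).isLocallyClosed) hη.continuous hc hs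
    have i3 := integrable_mul_of_locallyIntegrableOn
      ((h.locallyIntegrable_gradient q v).continuousOn_mul (hcφ q) (hT q).isLocallyClosed)
      hη.continuous hc hs
    have e1 : ∀ y, u (param N q y) * fderiv ℝ (fun y => φ (param N q y) * η y) y v
        = φ (param N q y) * u (param N q y) * fderiv ℝ η y v
          + u (param N q y) * fderiv ℝ (fun y => φ (param N q y)) y v * η y := by
      intro y
      by_cases hy : y ∈ tsupport η
      · rw [fderiv_fun_mul (hd q y (hs hy)) (hη.differentiable (by simp) y)]
        simp only [add_apply, smul_apply, smul_eq_mul]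
        ring
      · have h1 : fderiv ℝ η y = 0 := by
          by_contra h
          exact hy (tsupport_fderiv_subset ℝ (f := η) (subset_tsupport _ h))
        have h2 : fderiv ℝ (fun y => φ (param N q y) * η y) y = 0 := by
          by_contra h
          exact hy (tsupport_mul_subset_right (tsupport_fderiv_subset ℝ
            (f := fun y => φ (param N q y) * η y) (subset_tsupport _ h)))
        simp [h1, h2, image_eq_zero_of_notMem_tsupport hy]
    have e2 : ∀ y, inner ℝ (φ (param N q y) • G (param N q y)
          + u (param N q y) • grad φ (param N q y)) (coordVector N q y v) * η y
        = φ (param N q y) * inner ℝ (G (param N q y)) (coordVector N q y v) * η y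
          + u (param N q y) * fderiv ℝ (fun y => φ (param N q y)) y v * η y := by
      intro y
      by_cases hy : y ∈ tsupport η
      · simp only [inner_add_left, inner_smul_left, hg q y (hs hy), conj_trivial]
        ring
      · simp [image_eq_zero_of_notMem_tsupport hy]
    have e3 : ∀ y, inner ℝ (G (param N q y)) (coordVector N q y v) * (φ (param N q y) * η y)
        = φ (param N q y) * inner ℝ (G (param N q y)) (coordVector N q y v) * η y :=
      fun y => by ring
    simp only [e1, e3] at key
    rw [integral_add i1 i2] at key
    simp only [e2]
    rw [integral_add i3 i2]
    linarith

end HasWeakGradient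

variable [hsm : IsContMDiffRiemannianBundle (𝓡 N) ∞ (EuclideanSpace ℝ (Fin N))
      (fun x : X => TangentSpace (𝓡 N) x)] [MeasurableSpace X] [BorelSpace X]
  [SecondCountableTopology X]

namespace HasWeakGradient

variable {u : X → ℝ} {G G' : ∀ x : X, TangentSpace (𝓡 N) x}

/-- Two weak gradients of a function agree almost everywhere, by the fundamental lemma of the calculus
of variations for their components in the charts. -/
lemma ae_unique (h : HasWeakGradient N u G) (h' : HasWeakGradient N u G') :
    ∀ᵐ x ∂(riemannianVolume N X), G x = G' x := by
  refine ae_of_forall_chart fun q => ?_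
  have hi : ∀ i : Fin N, ∀ᵐ y ∂(volume : Measure (EuclideanSpace ℝ (Fin N))),
      y ∈ (extChartAt (𝓡 N) q).target →
        inner ℝ (G (param N q y)) (coordVector N q y (EuclideanSpace.single i 1))
          - inner ℝ (G' (param N q y)) (coordVector N q y (EuclideanSpace.single i 1)) = 0 := by
    intro i
    refine (isOpen_target q).ae_eq_zero_of_integral_contDiff_smul_eq_zero
      ((h.locallyIntegrable_gradient q _).sub (h'.locallyIntegrable_gradient q _))
      fun η hη hc hs => ?_
    have e1 := h.integral_eq q (EuclideanSpace.single i 1) η hη hc hs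
    have e2 := h'.integral_eq q (EuclideanSpace.single i 1) η hη hc hs
    simp only [smul_eq_mul, mul_comm (η _), sub_mul]
    rw [integral_sub
      (integrable_mul_of_locallyIntegrableOn (h.locallyIntegrable_gradient q _) hη.continuous hc hs)
      (integrable_mul_of_locallyIntegrableOn (h'.locallyIntegrable_gradient q _) hη.continuous hc hs)]
    linarith
  rw [ae_restrict_iff' (isOpen_target q).measurableSet]
  filter_upwards [ae_all_iff.2 hi] with y hy hyT
  have : ‖G (param N q y) - G' (param N q y)‖ ^ 2 = 0 := by
    rw [norm_sq_eq_sum q hyT]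
    refine Finset.sum_eq_zero fun i _ => Finset.sum_eq_zero fun j _ => ?_
    rw [inner_sub_left, hy i hyT]
    simp
  rw [sq_eq_zero_iff, norm_eq_zero, sub_eq_zero] at this
  exact this

lemma weakGradient_ae_eq (h : HasWeakGradient N u G) :
    ∀ᵐ x ∂(riemannianVolume N X), weakGradient N u x = G x := by
  have he : ∃ G : ∀ x : X, TangentSpace (𝓡 N) x, HasWeakGradient N u G := ⟨G, h⟩
  have : HasWeakGradient N u (weakGradient N u) := by
    rw [weakGradient, dif_pos he]; exact he.choose_spec
  exact this.ae_unique h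

/-- Weak gradients are not assumed to be measurable sections; the norm is measurable because the
components in the charts are locally integrable. -/
lemma aestronglyMeasurable_norm_sq (h : HasWeakGradient N u G) :
    AEStronglyMeasurable (fun x => ‖G x‖ ^ 2) (riemannianVolume N X) := by
  refine aestronglyMeasurable_of_forall_chart fun q => ?_
  have h1 : AEStronglyMeasurable (fun y => ∑ i, ∑ j, (coordMetric N q y)⁻¹ i j *
      (inner ℝ (G (param N q y)) (coordVector N q y (EuclideanSpace.single i 1)) *
        inner ℝ (G (param N q y)) (coordVector N q y (EuclideanSpace.single j 1))))
      (volume.restrict (extChartAt (𝓡 N) q).target) := by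
    refine Finset.aestronglyMeasurable_fun_sum _ fun i _ =>
      Finset.aestronglyMeasurable_fun_sum _ fun j _ => ?_
    exact ((continuousOn_coordMetric_inv q i j).aestronglyMeasurable
      (isOpen_target q).measurableSet).mul
      ((h.locallyIntegrable_gradient q _).aestronglyMeasurable.mul
        (h.locallyIntegrable_gradient q _).aestronglyMeasurable)
  refine h1.congr ?_
  filter_upwards [ae_restrict_mem (isOpen_target q).measurableSet] with y hy
  exact (norm_sq_eq_sum q hy _).symm

lemma aestronglyMeasurable (h : HasWeakGradient N u G) :
    AEStronglyMeasurable u (riemannianVolume N X) :=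
  aestronglyMeasurable_of_forall_chart fun q => (h.locallyIntegrable q).aestronglyMeasurable

end HasWeakGradient

end WeakGradient

/-! ### Mollification in `L²` -/

section Mollify

section Mollification

open ContinuousLinearMap
open scoped Convolution

lemma eLpNorm_two_pow {α : Type*} [MeasurableSpace α] {μ : Measure α} (g : α → ℝ) :
    eLpNorm g 2 μ ^ 2 = ∫⁻ x, ‖g x‖ₑ ^ 2 ∂μ := by
  have := eLpNorm_nnreal_pow_eq_lintegral (μ := μ) (f := g) (p := 2) (by norm_num)
  simpa using this

variable {E : Type*} [NormedAddCommGroup E] [NormedSpace ℝ E] [MeasurableSpace E] [BorelSpace E]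
  [FiniteDimensional ℝ E] {μ : Measure E} [μ.IsAddHaarMeasure]

/-- Young's inequality `‖ρ ⋆ g‖₂ ≤ ‖g‖₂` for a probability density `ρ`. -/
lemma eLpNorm_convolution_le {ρ g : E → ℝ} (hρ : Continuous ρ) (hρ0 : ∀ x, 0 ≤ ρ x)
    (hρ1 : ∫ x, ρ x ∂μ = 1) (hg : AEStronglyMeasurable g μ) :
    eLpNorm (ρ ⋆[lsmul ℝ ℝ, μ] g : E → ℝ) 2 μ ≤ eLpNorm g 2 μ := by
  have := FiniteDimensional.proper_real E
  have hρi : Integrable ρ μ := integrable_of_integral_eq_one hρ1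
  have hρl : ∫⁻ t, ‖ρ t‖ₑ ∂μ = 1 := by
    rw [← ENNReal.ofReal_one, ← hρ1, ofReal_integral_eq_lintegral_ofReal hρi (ae_of_all _ hρ0)]
    exact lintegral_congr fun t => Real.enorm_of_nonneg (hρ0 t)
  have hprod : AEStronglyMeasurable (fun p : E × E => g (p.1 - p.2)) (μ.prod μ) :=
    (hg.mono_ac (quasiMeasurePreserving_sub_of_right_invariant μ μ).absolutelyContinuous
      ).comp_measurable measurable_sub
  have hslice : ∀ x, AEStronglyMeasurable (fun t => g (x - t)) μ := fun x =>
    hg.comp_quasiMeasurePreserving (quasiMeasurePreserving_sub_left_of_right_invariant μ x)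
  have hpt : ∀ x, ‖(ρ ⋆[lsmul ℝ ℝ, μ] g : E → ℝ) x‖ₑ ^ 2
      ≤ ∫⁻ t, ‖ρ t‖ₑ * ‖g (x - t)‖ₑ ^ 2 ∂μ := by
    intro x
    rw [convolution_lsmul]
    have h1 : ‖∫ t, ρ t • g (x - t) ∂μ‖ₑ ≤ ∫⁻ t, ‖ρ t‖ₑ * ‖g (x - t)‖ₑ ∂μ := by
      refine (enorm_integral_le_lintegral_enorm _).trans_eq ?_
      simp only [enorm_smul]
    -- Cauchy–Schwarz for the factorization `ρ |g| = ρ ^ (1 / 2) (ρ |g| ^ 2) ^ (1 / 2)`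
    have h2 := ENNReal.lintegral_mul_norm_pow_le (μ := μ) (f := fun t => ‖ρ t‖ₑ)
      (g := fun t => ‖ρ t‖ₑ * ‖g (x - t)‖ₑ ^ 2) (p := 1 / 2) (q := 1 / 2)
      hρ.aestronglyMeasurable.enorm
      (hρ.aestronglyMeasurable.enorm.mul ((hslice x).enorm.pow_const 2))
      (by norm_num) (by norm_num) (by norm_num)
    have h3 : ∀ t, ‖ρ t‖ₑ ^ (1 / 2 : ℝ) * (‖ρ t‖ₑ * ‖g (x - t)‖ₑ ^ 2) ^ (1 / 2 : ℝ)
        = ‖ρ t‖ₑ * ‖g (x - t)‖ₑ := by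
      intro t
      rw [ENNReal.mul_rpow_of_nonneg _ _ (by norm_num), ← mul_assoc,
        ← ENNReal.rpow_add_of_nonneg _ _ (by norm_num) (by norm_num), ← ENNReal.rpow_natCast,
        ← ENNReal.rpow_mul]
      norm_num
    simp only [h3, hρl, ENNReal.one_rpow, one_mul] at h2
    calc ‖∫ t, ρ t • g (x - t) ∂μ‖ₑ ^ 2
        ≤ ((∫⁻ t, ‖ρ t‖ₑ * ‖g (x - t)‖ₑ ^ 2 ∂μ) ^ (1 / 2 : ℝ)) ^ 2 := by
          gcongr; exact h1.trans h2
      _ = _ := by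
          rw [← ENNReal.rpow_natCast, ← ENNReal.rpow_mul]; norm_num
  have hsq : eLpNorm (ρ ⋆[lsmul ℝ ℝ, μ] g : E → ℝ) 2 μ ^ 2 ≤ eLpNorm g 2 μ ^ 2 := by
    rw [eLpNorm_two_pow, eLpNorm_two_pow]
    calc ∫⁻ x, ‖(ρ ⋆[lsmul ℝ ℝ, μ] g : E → ℝ) x‖ₑ ^ 2 ∂μ
        ≤ ∫⁻ x, ∫⁻ t, ‖ρ t‖ₑ * ‖g (x - t)‖ₑ ^ 2 ∂μ ∂μ := lintegral_mono hpt
      _ = ∫⁻ t, ∫⁻ x, ‖ρ t‖ₑ * ‖g (x - t)‖ₑ ^ 2 ∂μ ∂μ := by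
          refine lintegral_lintegral_swap ?_
          exact (hρ.aestronglyMeasurable.comp_snd.enorm).mul (hprod.enorm.pow_const 2)
      _ = ∫⁻ t, ‖ρ t‖ₑ * ∫⁻ x, ‖g x‖ₑ ^ 2 ∂μ ∂μ := by
          refine lintegral_congr fun t => ?_
          rw [lintegral_const_mul' _ _ enorm_ne_top]
          congr 1
          exact lintegral_sub_right_eq_self (fun x => ‖g x‖ₑ ^ 2) t
      _ = ∫⁻ x, ‖g x‖ₑ ^ 2 ∂μ := by
          rw [lintegral_mul_const'' _ hρ.aestronglyMeasurable.enorm, hρl, one_mul]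
  exact le_of_not_gt fun h => hsq.not_gt (ENNReal.pow_right_strictMono two_ne_zero h)

/-- Mollification converges in `L²`: approximate by a continuous function with compact support. -/
lemma tendsto_eLpNorm_convolution_sub {φ : ℕ → ContDiffBump (0 : E)}
    (hφ : Tendsto (fun n => (φ n).rOut) atTop (𝓝 0)) {g : E → ℝ} (hg : MemLp g 2 μ) :
    Tendsto (fun n => eLpNorm (((φ n).normed μ ⋆[lsmul ℝ ℝ, μ] g : E → ℝ) - g) 2 μ) atTop
      (𝓝 0) := by
  have := FiniteDimensional.proper_real E
  rw [ENNReal.tendsto_nhds_zero]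
  intro ε hε
  have hε3 : ε / 3 ≠ 0 := (ENNReal.div_pos hε.ne' (by simp)).ne'
  -- `c` is continuous with compact support; outside of `s` both `c` and its mollifications vanish
  obtain ⟨c, hcs, hgc, hcc, hc2⟩ := hg.exists_hasCompactSupport_eLpNorm_sub_le (by simp) hε3
  set s := Metric.cthickening 1 (tsupport c) with hs
  have hsc : IsCompact s := hcs.isCompact.cthickening
  obtain ⟨δ, hδ, hδs⟩ : ∃ δ : ℝ, 0 < δ ∧ ENNReal.ofReal δ * μ s ^ (1 / (2 : ENNReal).toReal) ≤ ε / 3 := by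
    have hfin : μ s ^ (1 / (2 : ENNReal).toReal) ≠ ⊤ :=
      ENNReal.rpow_ne_top_of_nonneg (by simp) hsc.measure_lt_top.ne
    have ht : Tendsto (fun δ : ℝ => ENNReal.ofReal δ * μ s ^ (1 / (2 : ENNReal).toReal)) (𝓝[>] 0)
        (𝓝 0) := by
      have h1 : Tendsto (fun δ : ℝ => ENNReal.ofReal δ) (𝓝[>] 0) (𝓝 0) := by
        have := (ENNReal.continuous_ofReal.tendsto 0).mono_left (nhdsWithin_le_nhds (s := Set.Ioi 0))
        simpa using this
      simpa using ENNReal.Tendsto.mul_const h1 (Or.inr hfin)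
    obtain ⟨δ, h1, h2⟩ := ((ht.eventually_le_const (pos_iff_ne_zero.2 hε3)).and
      self_mem_nhdsWithin).exists
    exact ⟨δ, h2, h1⟩
  obtain ⟨r, hr, hrc⟩ := Metric.uniformContinuous_iff.1
    (hcs.uniformContinuous_of_continuous hcc) δ hδ
  filter_upwards [hφ.eventually_lt_const (lt_min hr one_pos)] with n hn
  have hnr := lt_of_lt_of_le hn (min_le_left _ _)
  have hn1 := lt_of_lt_of_le hn (min_le_right _ _)
  set ρ := (φ n).normed μ with hρ
  have hρc : Continuous ρ := (φ n).continuous_normed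
  have hρs : HasCompactSupport ρ := (φ n).hasCompactSupport_normed
  have hmid : eLpNorm ((ρ ⋆[lsmul ℝ ℝ, μ] c : E → ℝ) - c) 2 μ ≤ ε / 3 := by
    refine le_trans (eLpNorm_sub_le_of_dist_bdd μ (by simp) hsc.measurableSet hδ.le (fun x => ?_)
      ?_ ?_) hδs
    · refine (φ n).dist_normed_convolution_le hcc.aestronglyMeasurable fun y hy => ?_
      exact (hrc (lt_trans (Metric.mem_ball.1 hy) hnr)).le
    · refine (support_convolution_subset (lsmul ℝ ℝ)).trans ?_
      rintro _ ⟨a, ha, b, hb, rfl⟩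
      rw [hρ, (φ n).support_normed_eq, mem_ball_zero_iff] at ha
      refine Metric.mem_cthickening_of_dist_le _ b _ _ (subset_tsupport _ hb) ?_
      simp only [dist_add_self_left]
      exact (ha.trans hn1).le
    · exact (subset_tsupport c).trans (Metric.self_subset_cthickening _)
  -- three terms, the first estimated by Young's inequality
  have hd : (ρ ⋆[lsmul ℝ ℝ, μ] g : E → ℝ) - g = (ρ ⋆[lsmul ℝ ℝ, μ] (g - c) : E → ℝ)
      + (((ρ ⋆[lsmul ℝ ℝ, μ] c : E → ℝ) - c) + (c - g)) := by
    have hgl : LocallyIntegrable (g - c) μ := (hg.sub hc2).locallyIntegrable (by norm_num)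
    have hcl : LocallyIntegrable c μ := hc2.locallyIntegrable (by norm_num)
    have := ConvolutionExists.distrib_add (hρs.convolutionExists_left (lsmul ℝ ℝ) hρc hgl)
      (hρs.convolutionExists_left (lsmul ℝ ℝ) hρc hcl)
    rw [sub_add_cancel] at this
    rw [this]
    abel
  have hconv : ∀ h : E → ℝ, LocallyIntegrable h μ →
      AEStronglyMeasurable (ρ ⋆[lsmul ℝ ℝ, μ] h : E → ℝ) μ := fun h hh =>
    (hρs.continuous_convolution_left (lsmul ℝ ℝ) hρc hh).aestronglyMeasurable
  rw [hd]
  have hgl : LocallyIntegrable (g - c) μ := (hg.sub hc2).locallyIntegrable (by norm_num)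
  have hcl : LocallyIntegrable c μ := hc2.locallyIntegrable (by norm_num)
  refine (eLpNorm_add_le (hconv _ hgl) (((hconv _ hcl).sub hc2.1).add (hc2.1.sub hg.1))
    (by norm_num)).trans ?_
  refine (add_le_add le_rfl (eLpNorm_add_le ((hconv _ hcl).sub hc2.1) (hc2.1.sub hg.1)
    (by norm_num))).trans ?_
  have h1 := (eLpNorm_convolution_le (μ := μ) hρc (φ n).nonneg_normed (φ n).integral_normed
    (hg.sub hc2).1).trans hgc
  have h3 : eLpNorm (c - g) 2 μ ≤ ε / 3 := by rw [eLpNorm_sub_comm]; exact hgc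
  refine (add_le_add h1 (add_le_add hmid h3)).trans_eq ?_
  rw [← add_assoc, ENNReal.add_thirds]

/-- The derivative of a mollified function is the mollification of the weak derivative. -/
lemma fderiv_convolution_eq {ρ w w' : E → ℝ} {v : E} (hρ : ContDiff ℝ ∞ ρ)
    (hc : HasCompactSupport ρ) (hw : LocallyIntegrable w μ)
    (hww' : ∀ η : E → ℝ, ContDiff ℝ ∞ η → HasCompactSupport η →
      ∫ y, w y * fderiv ℝ η y v ∂μ = - ∫ y, w' y * η y ∂μ) (x : E) :
    fderiv ℝ (ρ ⋆[lsmul ℝ ℝ, μ] w : E → ℝ) x v = (ρ ⋆[lsmul ℝ ℝ, μ] w' : E → ℝ) x := by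
  have := FiniteDimensional.proper_real E
  have hd := hc.hasFDerivAt_convolution_left (lsmul ℝ ℝ) (hρ.of_le (by simp)) hw x
  have hex := (hc.fderiv ℝ).convolutionExists_left ((lsmul ℝ ℝ).precompL E)
    (hρ.continuous_fderiv (by simp)) hw x
  rw [hd.fderiv, convolution_def, ContinuousLinearMap.integral_apply hex, convolution_lsmul]
  -- test the weak derivative with the reflected kernel
  let η : E → ℝ := fun s => ρ (x - s)
  have hη : ContDiff ℝ ∞ η := hρ.comp (contDiff_const.sub contDiff_id)
  have hηc : HasCompactSupport η := hc.comp_homeomorph (Homeomorph.subLeft x)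
  have hηd : ∀ s, fderiv ℝ η s v = - fderiv ℝ ρ (x - s) v := by
    intro s
    have h1 : HasFDerivAt η ((fderiv ℝ ρ (x - s)).comp (-ContinuousLinearMap.id ℝ E)) s :=
      ((hρ.differentiable (by simp)) (x - s)).hasFDerivAt.comp s
        ((hasFDerivAt_id s).const_sub x)
    rw [h1.fderiv]; simp
  have key := hww' η hη hηc
  simp only [hηd] at key
  rw [← integral_sub_left_eq_self _ μ x, ← integral_sub_left_eq_self (fun t => ρ t • _) μ x]
  simp only [sub_sub_cancel, precompL_apply, lsmul_apply, smul_eq_mul]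
  simp only [mul_neg, integral_neg, neg_inj] at key
  simp only [mul_comm (fderiv ℝ ρ _ v), mul_comm (ρ _), key, η]

end Mollification

end Mollify

/-! ### Approximation of Sobolev functions in a chart -/

section ChartDensity

variable {N : ℕ} {X : Type*} [TopologicalSpace X] [ChartedSpace (EuclideanSpace ℝ (Fin N)) X]
  [IsManifold (𝓡 N) ∞ X] [RiemannianBundle (fun x : X => TangentSpace (𝓡 N) x)]
  [hsm : IsContMDiffRiemannianBundle (𝓡 N) ∞ (EuclideanSpace ℝ (Fin N))
      (fun x : X => TangentSpace (𝓡 N) x)]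

lemma enorm_sq_eq_ofReal {V : Type*} [SeminormedAddCommGroup V] (x : V) :
    ‖x‖ₑ ^ 2 = ENNReal.ofReal (‖x‖ ^ 2) := by
  rw [ENNReal.ofReal_pow (norm_nonneg _), ofReal_norm]

lemma enorm_add_sq_le {V : Type*} [SeminormedAddCommGroup V] (x y : V) :
    ‖x + y‖ₑ ^ 2 ≤ 2 * ‖x‖ₑ ^ 2 + 2 * ‖y‖ₑ ^ 2 := by
  rw [enorm_sq_eq_ofReal, enorm_sq_eq_ofReal, enorm_sq_eq_ofReal,
    show (2 : ENNReal) = ENNReal.ofReal 2 by simp, ← ENNReal.ofReal_mul (by norm_num),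
    ← ENNReal.ofReal_mul (by norm_num), ← ENNReal.ofReal_add (by positivity) (by positivity)]
  refine ENNReal.ofReal_le_ofReal ?_
  have := norm_add_le x y
  nlinarith [norm_nonneg (x + y), norm_nonneg x, norm_nonneg y, sq_nonneg (‖x‖ - ‖y‖)]

/-- On a compact subset of a chart, the Riemannian norm is controlled by the components in the
chart. -/
lemma exists_norm_sq_le_of_isCompact (q : X) {K : Set (EuclideanSpace ℝ (Fin N))}
    (hK : IsCompact K) (hKT : K ⊆ (extChartAt (𝓡 N) q).target) :
    ∃ M : ℝ, 0 ≤ M ∧ ∀ y ∈ K, ∀ ξ : TangentSpace (𝓡 N) (param N q y),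
      ‖ξ‖ ^ 2 ≤ M * ∑ i, (inner ℝ ξ (coordVector N q y (EuclideanSpace.single i 1))) ^ 2 := by
  have hb : ∀ i j : Fin N, ∃ C, ∀ y ∈ K, ‖(coordMetric N q y)⁻¹ i j‖ ≤ C := fun i j =>
    hK.exists_bound_of_continuousOn ((continuousOn_coordMetric_inv q i j).mono hKT)
  choose C hC using hb
  refine ⟨∑ i, ∑ j, |C i j|, Finset.sum_nonneg fun i _ => Finset.sum_nonneg fun j _ =>
    abs_nonneg _, fun y hy ξ => ?_⟩
  rw [norm_sq_eq_sum q (hKT hy)]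
  set c : Fin N → ℝ := fun i => inner ℝ ξ (coordVector N q y (EuclideanSpace.single i 1)) with hc
  change ∑ i, ∑ j, (coordMetric N q y)⁻¹ i j * (c i * c j) ≤ _ * ∑ i, c i ^ 2
  have hs : ∀ i, c i ^ 2 ≤ ∑ i, c i ^ 2 := fun i =>
    Finset.single_le_sum (f := fun i => c i ^ 2) (fun i _ => sq_nonneg _) (Finset.mem_univ i)
  rw [Finset.sum_mul]
  refine Finset.sum_le_sum fun i _ => ?_
  rw [Finset.sum_mul]
  refine Finset.sum_le_sum fun j _ => ?_
  have h1 : |c i * c j| ≤ ∑ i, c i ^ 2 := by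
    rw [abs_mul]
    nlinarith [hs i, hs j, sq_nonneg (|c i| - |c j|), sq_abs (c i), sq_abs (c j)]
  have h2 : |(coordMetric N q y)⁻¹ i j| ≤ |C i j| := (hC i j y hy).trans (le_abs_self _)
  calc _ ≤ |(coordMetric N q y)⁻¹ i j * (c i * c j)| := le_abs_self _
    _ = |(coordMetric N q y)⁻¹ i j| * |c i * c j| := abs_mul _ _
    _ ≤ _ := by gcongr

lemma continuousOn_norm_sq_grad_chart (q : X) {φ : X → ℝ} (hφ : ContMDiff (𝓡 N) 𝓘(ℝ) ∞ φ) :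
    ContinuousOn (fun y => ‖grad (N := N) φ (param N q y)‖ ^ 2) (extChartAt (𝓡 N) q).target := by
  have hT := isOpen_target (N := N) q
  have hd := contDiffOn_chart q hφ
  have hcf : ∀ v : EuclideanSpace ℝ (Fin N), ContinuousOn
      (fun y => fderiv ℝ (fun y => φ (param N q y)) y v) (extChartAt (𝓡 N) q).target :=
    fun v => ((hd.continuousOn_fderiv_of_isOpen hT (by simp)).clm_apply continuousOn_const)
  have h : ContinuousOn (fun y => ∑ i, ∑ j, (coordMetric N q y)⁻¹ i j *
      (fderiv ℝ (fun y => φ (param N q y)) y (EuclideanSpace.single i 1) *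
        fderiv ℝ (fun y => φ (param N q y)) y (EuclideanSpace.single j 1)))
      (extChartAt (𝓡 N) q).target :=
    continuousOn_finsetSum _ fun i _ => continuousOn_finsetSum _ fun j _ =>
      (continuousOn_coordMetric_inv q i j).mul ((hcf _).mul (hcf _))
  refine h.congr fun y hy => ?_
  have hm : MDifferentiableAt (𝓡 N) 𝓘(ℝ) φ (param N q y) := hφ.mdifferentiableAt (by simp)
  simp only [norm_sq_eq_sum q hy, inner_grad_coordVector q hy hm]

lemma continuous_norm_sq_grad {φ : X → ℝ} (hφ : ContMDiff (𝓡 N) 𝓘(ℝ) ∞ φ) :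
    Continuous (fun x => ‖grad (N := N) φ x‖ ^ 2) := by
  rw [continuous_iff_continuousAt]
  intro x
  have hx : extChartAt (𝓡 N) x x ∈ (extChartAt (𝓡 N) x).target := mem_extChartAt_target x
  have h1 : ContinuousAt (fun y => ‖grad (N := N) φ (param N x y)‖ ^ 2) (extChartAt (𝓡 N) x x) :=
    (continuousOn_norm_sq_grad_chart x hφ).continuousAt ((isOpen_target x).mem_nhds hx)
  refine (ContinuousAt.comp (f := extChartAt (𝓡 N) x) h1
    (continuousAt_extChartAt x)).congr ?_
  filter_upwards [extChartAt_source_mem_nhds (I := 𝓡 N) x] with z hz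
  have : param N x (extChartAt (𝓡 N) x z) = z := (extChartAt (𝓡 N) x).left_inv hz
  exact congrArg (fun x => ‖grad (N := N) φ x‖ ^ 2) this

omit hsm in
lemma grad_eq_zero_of_notMem_tsupport {φ : X → ℝ} {x : X} (hx : x ∉ tsupport φ) :
    grad (N := N) φ x = 0 := by
  have h : φ =ᶠ[𝓝 x] fun _ => 0 := notMem_tsupport_iff_eventuallyEq.1 hx
  refine ext_inner_right ℝ fun ξ => ?_
  rw [inner_grad, h.mfderiv_eq, mfderiv_const, inner_zero_left]
  rfl

variable [MeasurableSpace X] [BorelSpace X]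

section Compact

variable [T2Space X]

lemma isCompact_image_param (q : X) {K : Set (EuclideanSpace ℝ (Fin N))} (hK : IsCompact K)
    (hKT : K ⊆ (extChartAt (𝓡 N) q).target) : IsCompact (param N q '' K) :=
  hK.image_of_continuousOn ((continuousOn_param q).mono hKT)

/-- The integral of a function supported in a compact subset of a chart. -/
lemma lintegral_eq_chart (q : X) {F : X → ENNReal} (hF : AEMeasurable F (riemannianVolume N X))
    {K : Set (EuclideanSpace ℝ (Fin N))} (hK : IsCompact K)
    (hKT : K ⊆ (extChartAt (𝓡 N) q).target) (h0 : ∀ x ∉ param N q '' K, F x = 0) :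
    ∫⁻ x, F x ∂(riemannianVolume N X)
      = ∫⁻ y in K, ENNReal.ofReal (density q y) * F (param N q y) := by
  have h1 : ∫⁻ x, F x ∂(riemannianVolume N X)
      = ∫⁻ x in (extChartAt (𝓡 N) q).source, F x ∂(riemannianVolume N X) := by
    rw [← lintegral_indicator (measurableSet_source q)]
    refine lintegral_congr fun x => ?_
    by_cases hx : x ∈ (extChartAt (𝓡 N) q).source
    · rw [Set.indicator_of_mem hx]
    · rw [Set.indicator_of_notMem hx]
      refine h0 x ?_
      rintro ⟨y, hy, rfl⟩
      exact hx (param_mem_source q (hKT hy))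
  rw [h1, setLIntegral_source q hF.restrict, ← lintegral_indicator (measurableSet_target q),
    ← lintegral_indicator hK.measurableSet]
  refine lintegral_congr fun y => ?_
  by_cases hy : y ∈ K
  · rw [Set.indicator_of_mem hy, Set.indicator_of_mem (hKT hy)]
  · rw [Set.indicator_of_notMem hy]
    by_cases hyT : y ∈ (extChartAt (𝓡 N) q).target
    · rw [Set.indicator_of_mem hyT, h0 (param N q y), mul_zero]
      rintro ⟨z, hz, hzy⟩
      have : z = y := (extChartAt (𝓡 N) q).symm.injOn (hKT hz) hyT hzy
      exact hy (this ▸ hz)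
    · rw [Set.indicator_of_notMem hyT]

/-- On a compact subset of a chart, the volume is at most a multiple of Lebesgue measure. -/
lemma exists_lintegral_le_chart (q : X) {K : Set (EuclideanSpace ℝ (Fin N))} (hK : IsCompact K)
    (hKT : K ⊆ (extChartAt (𝓡 N) q).target) :
    ∃ C : ENNReal, C ≠ ⊤ ∧ ∀ F : X → ENNReal, AEMeasurable F (riemannianVolume N X) →
      (∀ x ∉ param N q '' K, F x = 0) →
        ∫⁻ x, F x ∂(riemannianVolume N X) ≤ C * ∫⁻ y in K, F (param N q y) := by
  obtain ⟨M, hM⟩ := hK.exists_bound_of_continuousOn ((continuousOn_density q).mono hKT)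
  refine ⟨ENNReal.ofReal M, ENNReal.ofReal_ne_top, fun F hF h0 => ?_⟩
  rw [lintegral_eq_chart q hF hK hKT h0, ← lintegral_const_mul' _ _ ENNReal.ofReal_ne_top]
  refine setLIntegral_mono' hK.measurableSet fun y hy => ?_
  gcongr
  exact (le_abs_self _).trans (hM y hy)

/-- On a compact subset of a chart, Lebesgue measure is at most a multiple of the volume. -/
lemma exists_chart_le_lintegral (q : X) {K : Set (EuclideanSpace ℝ (Fin N))} (hK : IsCompact K)
    (hKT : K ⊆ (extChartAt (𝓡 N) q).target) :
    ∃ C : ENNReal, C ≠ ⊤ ∧ ∀ F : X → ENNReal, AEMeasurable F (riemannianVolume N X) →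
      ∫⁻ y in K, F (param N q y) ≤ C * ∫⁻ x, F x ∂(riemannianVolume N X) := by
  have hc : ContinuousOn (fun y => (density (N := N) q y)⁻¹) K :=
    ((continuousOn_density q).mono hKT).inv₀ fun y hy => (density_pos q (hKT hy)).ne'
  obtain ⟨M, hM⟩ := hK.exists_bound_of_continuousOn hc
  refine ⟨ENNReal.ofReal M, ENNReal.ofReal_ne_top, fun F hF => ?_⟩
  calc ∫⁻ y in K, F (param N q y)
      ≤ ∫⁻ y in K, ENNReal.ofReal M * (ENNReal.ofReal (density q y) * F (param N q y)) := by
        refine setLIntegral_mono' hK.measurableSet fun y hy => ?_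
        rw [← mul_assoc]
        refine le_mul_of_one_le_left zero_le ?_
        have hp := density_pos q (hKT hy)
        have := (le_abs_self _).trans (hM y hy)
        rw [← ENNReal.ofReal_mul' hp.le, ENNReal.one_le_ofReal]
        rwa [inv_le_iff_one_le_mul₀ hp] at this
    _ = ENNReal.ofReal M * ∫⁻ y in K, ENNReal.ofReal (density q y) * F (param N q y) :=
        lintegral_const_mul' _ _ ENNReal.ofReal_ne_top
    _ ≤ ENNReal.ofReal M * ∫⁻ y in (extChartAt (𝓡 N) q).target,
          ENNReal.ofReal (density q y) * F (param N q y) := by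
        gcongr
    _ ≤ _ := by
        rw [← setLIntegral_source q hF.restrict]
        gcongr
        exact Measure.restrict_le_self

/-- The volume of a compact set is finite. -/
lemma isFiniteMeasureOnCompacts_riemannianVolume :
    IsFiniteMeasureOnCompacts (riemannianVolume N X) := by
  have : LocallyCompactSpace X := Manifold.locallyCompact_of_finiteDimensional (𝓡 N)
  refine ⟨fun K hK => hK.measure_lt_top_of_nhdsWithin fun x hx => ?_⟩
  obtain ⟨K', hK', hxK', hKS⟩ := exists_compact_subset (isOpen_extChartAt_source (I := 𝓡 N) x)
    (mem_extChartAt_source x)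
  refine ⟨K', mem_nhdsWithin_of_mem_nhds (mem_interior_iff_mem_nhds.1 hxK'), ?_⟩
  set L := extChartAt (𝓡 N) x '' K' with hL
  have hLc : IsCompact L := hK'.image_of_continuousOn ((continuousOn_extChartAt x).mono hKS)
  have hLT : L ⊆ (extChartAt (𝓡 N) x).target := by
    rintro _ ⟨z, hz, rfl⟩; exact (extChartAt (𝓡 N) x).map_source (hKS hz)
  obtain ⟨C, hC, h⟩ := exists_lintegral_le_chart x hLc hLT
  have := h (K'.indicator 1) ((measurable_one.indicator hK'.measurableSet).aemeasurable) ?_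
  · rw [lintegral_indicator_one hK'.measurableSet] at this
    refine this.trans_lt (ENNReal.mul_lt_top hC.lt_top ?_)
    calc ∫⁻ y in L, K'.indicator (1 : X → ENNReal) (param N x y) ≤ ∫⁻ y in L, 1 :=
          lintegral_mono fun y => Set.indicator_le_self' (by simp) _
      _ = volume L := by simp
      _ < ⊤ := hLc.measure_lt_top
  · intro z hz
    refine Set.indicator_of_notMem (fun hzK => hz ?_) _
    exact ⟨extChartAt (𝓡 N) x z, ⟨z, hzK, rfl⟩, (extChartAt (𝓡 N) x).left_inv (hKS hzK)⟩

end Compact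

variable (N) in
/-- `u ∈ L²` has the weak gradient `G ∈ L²`. -/
structure SobolevPair {X : Type*} [TopologicalSpace X] [ChartedSpace (EuclideanSpace ℝ (Fin N)) X]
    [RiemannianBundle (fun x : X => TangentSpace (𝓡 N) x)] [MeasurableSpace X]
    (u : X → ℝ) (G : ∀ x : X, TangentSpace (𝓡 N) x) : Prop where
  memLp : MemLp u 2 (riemannianVolume N X)
  hasWeakGradient : HasWeakGradient N u G
  lintegral_lt_top : ∫⁻ x, ‖G x‖ₑ ^ 2 ∂(riemannianVolume N X) < ⊤

variable (N) in
/-- The pair `(u, G)` is a limit in `L²` of pairs `(ψ, ∇ψ)` with `ψ` a test function. -/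
def IsTestLimit {X : Type*} [TopologicalSpace X] [ChartedSpace (EuclideanSpace ℝ (Fin N)) X]
    [RiemannianBundle (fun x : X => TangentSpace (𝓡 N) x)] [MeasurableSpace X]
    (u : X → ℝ) (G : ∀ x : X, TangentSpace (𝓡 N) x) : Prop :=
  ∀ ε : ENNReal, 0 < ε → ∃ ψ : X → ℝ, IsTestFunction N ψ ∧
    ∫⁻ x, (‖u x - ψ x‖ₑ ^ 2 + ‖G x - grad ψ x‖ₑ ^ 2) ∂(riemannianVolume N X) ≤ ε

variable [T2Space X]

/-- A smooth function with compact support in the image of a chart, extended by zero to the manifold,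
is a test function. -/
lemma contMDiff_extend_chart (q : X) {w : EuclideanSpace ℝ (Fin N) → ℝ} (hw : ContDiff ℝ ∞ w)
    {K : Set (EuclideanSpace ℝ (Fin N))} (hK : IsCompact K)
    (hKT : K ⊆ (extChartAt (𝓡 N) q).target) (h0 : ∀ y ∉ K, w y = 0) :
    IsTestFunction N
      ((extChartAt (𝓡 N) q).source.indicator fun x => w (extChartAt (𝓡 N) q x)) := by
  have hc := isCompact_image_param q hK hKT
  have hsupp : ∀ x ∉ param N q '' K,
      (extChartAt (𝓡 N) q).source.indicator (fun x => w (extChartAt (𝓡 N) q x)) x = 0 := by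
    intro x hx
    by_cases hxS : x ∈ (extChartAt (𝓡 N) q).source
    · rw [Set.indicator_of_mem hxS]
      refine h0 _ fun hxK => hx ⟨_, hxK, (extChartAt (𝓡 N) q).left_inv hxS⟩
    · rw [Set.indicator_of_notMem hxS]
  refine ⟨fun x => ?_, HasCompactSupport.intro hc hsupp⟩
  by_cases hx : x ∈ param N q '' K
  · have hxS : x ∈ (extChartAt (𝓡 N) q).source := by
      obtain ⟨y, hy, rfl⟩ := hx
      exact param_mem_source q (hKT hy)
    have h1 : ContMDiffAt (𝓡 N) 𝓘(ℝ) ∞ (fun x => w (extChartAt (𝓡 N) q x)) x :=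
      hw.contMDiff.contMDiffAt.comp x (contMDiffAt_extChartAt' (by simpa using hxS))
    refine h1.congr_of_eventuallyEq ?_
    filter_upwards [(isOpen_extChartAt_source q).mem_nhds hxS] with z hz
    rw [Set.indicator_of_mem hz]
  · refine (contMDiffAt_const (c := (0 : ℝ))).congr_of_eventuallyEq ?_
    filter_upwards [hc.isClosed.isOpen_compl.mem_nhds hx] with z hz
    exact hsupp z hz

variable [SecondCountableTopology X]

/-- A Sobolev function supported in a compact subset of a chart is approximated by test functions,
by mollification in the chart. -/
lemma SobolevPair.isTestLimit_of_chart {u : X → ℝ} {G : ∀ x : X, TangentSpace (𝓡 N) x}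
    (h : SobolevPair N u G) (q : X) {K : Set (EuclideanSpace ℝ (Fin N))} (hK : IsCompact K)
    (hKT : K ⊆ (extChartAt (𝓡 N) q).target) (hu0 : ∀ x ∉ param N q '' K, u x = 0)
    (hG0 : ∀ x ∉ param N q '' K, G x = 0) : IsTestLimit N u G := by
  set T := (extChartAt (𝓡 N) q).target with hTdef
  have hT : IsOpen T := isOpen_target q
  have hnot : ∀ y ∈ T, y ∉ K → param N q y ∉ param N q '' K := by
    rintro y hyT hyK ⟨z, hz, hzy⟩
    exact hyK ((extChartAt (𝓡 N) q).symm.injOn (hKT hz) hyT hzy ▸ hz)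
  obtain ⟨δ, hδ, hδT⟩ := hK.exists_cthickening_subset_open hT hKT
  set L := Metric.cthickening δ K with hL
  have hLc : IsCompact L := hK.cthickening
  have hKL : K ⊆ L := Metric.self_subset_cthickening K
  -- the function and the components of the gradient, as functions on `ℝᴺ`
  let w : EuclideanSpace ℝ (Fin N) → ℝ := T.indicator fun y => u (param N q y)
  let W : EuclideanSpace ℝ (Fin N) → EuclideanSpace ℝ (Fin N) → ℝ :=
    fun v => T.indicator fun y => inner ℝ (G (param N q y)) (coordVector N q y v)
  have hwT : ∀ y ∈ T, w y = u (param N q y) := fun y hy => Set.indicator_of_mem hy _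
  have hWT : ∀ v, ∀ y ∈ T, W v y = inner ℝ (G (param N q y)) (coordVector N q y v) :=
    fun v y hy => Set.indicator_of_mem hy _
  have hwK : ∀ y ∉ K, w y = 0 := by
    intro y hy
    by_cases hyT : y ∈ T
    · rw [hwT y hyT]; exact hu0 _ (hnot y hyT hy)
    · exact Set.indicator_of_notMem hyT _
  have hWK : ∀ v, ∀ y ∉ K, W v y = 0 := by
    intro v y hy
    by_cases hyT : y ∈ T
    · rw [hWT v y hyT, hG0 _ (hnot y hyT hy), inner_zero_left]
    · exact Set.indicator_of_notMem hyT _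
  have hwm : AEStronglyMeasurable w volume :=
    (aestronglyMeasurable_indicator_iff hT.measurableSet).2
      (h.hasWeakGradient.locallyIntegrable q).aestronglyMeasurable
  have hWm : ∀ v, AEStronglyMeasurable (W v) volume := fun v =>
    (aestronglyMeasurable_indicator_iff hT.measurableSet).2
      (h.hasWeakGradient.locallyIntegrable_gradient q v).aestronglyMeasurable
  have hl2 : ∀ g : EuclideanSpace ℝ (Fin N) → ℝ, AEStronglyMeasurable g volume →
      (∀ y ∉ K, g y = 0) → ∫⁻ y in K, ‖g y‖ₑ ^ 2 < ⊤ → MemLp g 2 volume := by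
    intro g hg hgK hgl
    refine ⟨hg, ?_⟩
    have e : ∫⁻ y, ‖g y‖ₑ ^ 2 = ∫⁻ y in K, ‖g y‖ₑ ^ 2 := by
      rw [← lintegral_indicator hK.measurableSet]
      refine lintegral_congr fun y => ?_
      by_cases hy : y ∈ K
      · rw [Set.indicator_of_mem hy]
      · rw [Set.indicator_of_notMem hy, hgK y hy]; simp
    have h2 : eLpNorm g 2 volume ^ 2 < ⊤ := by rw [eLpNorm_two_pow, e]; exact hgl
    exact (ENNReal.pow_lt_top_iff.1 h2).resolve_right (by norm_num)
  obtain ⟨C, hC, hCF⟩ := exists_chart_le_lintegral (N := N) q hK hKT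
  have hw2 : MemLp w 2 volume := by
    refine hl2 w hwm hwK ?_
    have h1 := hCF (fun x => ‖u x‖ₑ ^ 2) (h.memLp.1.enorm.pow_const 2)
    have h2 : ∫⁻ x, ‖u x‖ₑ ^ 2 ∂(riemannianVolume N X) < ⊤ := by
      rw [← eLpNorm_two_pow]; exact ENNReal.pow_lt_top h.memLp.2
    refine lt_of_eq_of_lt (setLIntegral_congr_fun hK.measurableSet fun y hy => ?_)
      (h1.trans_lt (ENNReal.mul_lt_top hC.lt_top h2))
    rw [hwT y (hKT hy)]
  have hGm : AEMeasurable (fun x => ‖G x‖ₑ ^ 2) (riemannianVolume N X) := by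
    simp only [enorm_sq_eq_ofReal]
    exact h.hasWeakGradient.aestronglyMeasurable_norm_sq.aemeasurable.ennreal_ofReal
  have hW2 : ∀ v, MemLp (W v) 2 volume := by
    intro v
    refine hl2 (W v) (hWm v) (hWK v) ?_
    obtain ⟨M, hM⟩ := hK.exists_bound_of_continuousOn
      ((continuousOn_inner_coordVector q v v).mono hKT)
    have h1 := hCF (fun x => ‖G x‖ₑ ^ 2) hGm
    refine lt_of_le_of_lt (setLIntegral_mono' hK.measurableSet
      (g := fun y => ENNReal.ofReal M * ‖G (param N q y)‖ₑ ^ 2) fun y hy => ?_) ?_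
    · rw [hWT v y (hKT hy), enorm_sq_eq_ofReal, enorm_sq_eq_ofReal,
        ← ENNReal.ofReal_mul' (sq_nonneg _)]
      refine ENNReal.ofReal_le_ofReal ?_
      have h3 := abs_real_inner_le_norm (G (param N q y)) (coordVector N q y v)
      have h4 := (le_abs_self _).trans (hM y hy)
      rw [real_inner_self_eq_norm_sq] at h4
      rw [Real.norm_eq_abs]
      calc _ ≤ (‖G (param N q y)‖ * ‖coordVector N q y v‖) ^ 2 := by gcongr
        _ = ‖coordVector N q y v‖ ^ 2 * ‖G (param N q y)‖ ^ 2 := by ring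
        _ ≤ _ := by gcongr
    · rw [lintegral_const_mul' _ _ ENNReal.ofReal_ne_top]
      exact ENNReal.mul_lt_top ENNReal.ofReal_lt_top
        (h1.trans_lt (ENNReal.mul_lt_top hC.lt_top h.lintegral_lt_top))
  -- the components are weak derivatives on all of `ℝᴺ`
  have hder : ∀ v, ∀ η : EuclideanSpace ℝ (Fin N) → ℝ, ContDiff ℝ ∞ η → HasCompactSupport η →
      ∫ y, w y * fderiv ℝ η y v = - ∫ y, W v y * η y := by
    intro v η hη _
    -- `η` need not be supported in the chart, but may be cut off outside of `K`
    obtain ⟨θ, hθ1, hθ0, -⟩ := exists_contMDiffMap_one_nhds_of_subset_interior (n := (⊤ : ℕ∞))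
      (𝓡 N) (s := K) (t := L) hK.isClosed ((Metric.self_subset_thickening hδ K).trans
        (interior_maximal (Metric.thickening_subset_cthickening δ K) Metric.isOpen_thickening))
    have hθs : tsupport θ ⊆ L := closure_minimal (fun y hy => by
      by_contra hyL; exact hy (hθ0 y hyL)) hLc.isClosed
    have hθd : ContDiff ℝ ∞ θ := θ.contMDiff.contDiff
    have key := h.hasWeakGradient.integral_eq q v (fun y => θ y * η y) (hθd.mul hη)
      ((HasCompactSupport.intro hLc hθ0).mul_right)
      ((tsupport_mul_subset_left).trans (hθs.trans hδT))
    rw [eventually_nhdsSet_iff_forall] at hθ1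
    have e1 : ∀ y, w y * fderiv ℝ η y v
        = u (param N q y) * fderiv ℝ (fun y => θ y * η y) y v := by
      intro y
      by_cases hy : y ∈ K
      · have : (fun y => θ y * η y) =ᶠ[𝓝 y] η := by
          filter_upwards [hθ1 y hy] with z hz
          rw [hz, one_mul]
        rw [this.fderiv_eq, hwT y (hKT hy)]
      · rw [hwK y hy, zero_mul]
        by_cases hyT : y ∈ T
        · rw [hu0 _ (hnot y hyT hy), zero_mul]
        · have : fderiv ℝ (fun y => θ y * η y) y = 0 := by
            by_contra hne
            exact hyT (hδT (hθs (tsupport_mul_subset_left (tsupport_fderiv_subset ℝ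
              (f := fun y => θ y * η y) (subset_tsupport _ hne)))))
          rw [this]; simp
    have e2 : ∀ y, W v y * η y
        = inner ℝ (G (param N q y)) (coordVector N q y v) * (θ y * η y) := by
      intro y
      by_cases hy : y ∈ K
      · rw [hWT v y (hKT hy), (hθ1 y hy).self_of_nhds, one_mul]
      · rw [hWK v y hy, zero_mul]
        by_cases hyT : y ∈ T
        · rw [hG0 _ (hnot y hyT hy), inner_zero_left, zero_mul]
        · rw [hθ0 y (fun hyL => hyT (hδT hyL))]; simp
    simp only [e1, e2]
    exact key
  -- the mollified functions
  let ρ : ℕ → ContDiffBump (0 : EuclideanSpace ℝ (Fin N)) := fun n =>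
    ⟨δ / (n + 1) / 2, δ / (n + 1), by positivity, half_lt_self (by positivity)⟩
  have hρr : Tendsto (fun n => (ρ n).rOut) atTop (𝓝 0) := by
    have := (tendsto_one_div_add_atTop_nhds_zero_nat (𝕜 := ℝ)).const_mul δ
    simp only [mul_one_div, mul_zero] at this
    exact this
  have hρδ : ∀ n, (ρ n).rOut ≤ δ := fun n => div_le_self hδ.le (by simp)
  let wn : ℕ → EuclideanSpace ℝ (Fin N) → ℝ := fun n =>
    MeasureTheory.convolution ((ρ n).normed volume) w (ContinuousLinearMap.lsmul ℝ ℝ) volume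
  have hρd : ∀ n, ContDiff ℝ ∞ ((ρ n).normed volume) := fun n => (ρ n).contDiff_normed
  have hρc : ∀ n, HasCompactSupport ((ρ n).normed volume) := fun n => (ρ n).hasCompactSupport_normed
  have hwl : LocallyIntegrable w volume := hw2.locallyIntegrable (by norm_num)
  have hwnd : ∀ n, ContDiff ℝ ∞ (wn n) := fun n =>
    (hρc n).contDiff_convolution_left (ContinuousLinearMap.lsmul ℝ ℝ) (hρd n) hwl
  have hwn0 : ∀ n, ∀ y ∉ L, wn n y = 0 := by
    intro n y hy
    by_contra hne
    obtain ⟨a, ha, b, hb, hab⟩ :=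
      support_convolution_subset (ContinuousLinearMap.lsmul ℝ ℝ) (μ := volume) hne
    rw [(ρ n).support_normed_eq, mem_ball_zero_iff] at ha
    have hbK : b ∈ K := by by_contra hbK; exact hb (hwK b hbK)
    refine hy (Metric.mem_cthickening_of_dist_le _ b _ _ hbK ?_)
    rw [← hab]
    simp only [dist_add_self_left]
    exact ha.le.trans (hρδ n)
  let ψ : ℕ → X → ℝ := fun n =>
    (extChartAt (𝓡 N) q).source.indicator fun x => wn n (extChartAt (𝓡 N) q x)
  have hψ : ∀ n, IsTestFunction N (ψ n) := fun n =>
    contMDiff_extend_chart q (hwnd n) hLc hδT (hwn0 n)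
  have hψT : ∀ n, ∀ y ∈ T, ψ n (param N q y) = wn n y := by
    intro n y hy
    simp only [ψ]
    rw [Set.indicator_of_mem (param_mem_source q hy)]
    exact congrArg (wn n) ((extChartAt (𝓡 N) q).right_inv hy)
  have hψ0 : ∀ n, ∀ x ∉ param N q '' L, ψ n x = 0 := by
    intro n x hx
    by_cases hxS : x ∈ (extChartAt (𝓡 N) q).source
    · simp only [ψ]
      rw [Set.indicator_of_mem hxS]
      exact hwn0 n _ fun hxK => hx ⟨_, hxK, (extChartAt (𝓡 N) q).left_inv hxS⟩
    · exact Set.indicator_of_notMem hxS _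
  have hψg0 : ∀ n, ∀ x ∉ param N q '' L, grad (N := N) (ψ n) x = 0 := by
    intro n x hx
    refine grad_eq_zero_of_notMem_tsupport fun hxt => hx ?_
    exact closure_minimal (fun z hz => by by_contra hzL; exact hz (hψ0 n z hzL))
      (isCompact_image_param q hLc hδT).isClosed hxt
  -- the components of the gradient of `ψ n` are the mollified components of `G`
  have hψg : ∀ n, ∀ y ∈ T, ∀ v,
      inner ℝ (grad (N := N) (ψ n) (param N q y)) (coordVector N q y v)
        = MeasureTheory.convolution ((ρ n).normed volume) (W v) (ContinuousLinearMap.lsmul ℝ ℝ)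
          volume y := by
    intro n y hy v
    rw [inner_grad_coordVector q hy ((hψ n).1.mdifferentiableAt (by simp)),
      ← fderiv_convolution_eq (hρd n) (hρc n) hwl (hder v)]
    congr 1
    refine Filter.EventuallyEq.fderiv_eq ?_
    filter_upwards [hT.mem_nhds hy] with z hz
    exact hψT n z hz
  obtain ⟨M, hM0, hM⟩ := exists_norm_sq_le_of_isCompact (N := N) q hLc hδT
  obtain ⟨D, hD, hDF⟩ := exists_lintegral_le_chart (N := N) q hLc hδT
  have hwg : ∀ n, HasWeakGradient N (fun x => u x - ψ n x) (fun x => G x - grad (ψ n) x) :=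
    fun n => h.hasWeakGradient.sub
      (hasWeakGradient_grad (locallyLipschitzInCharts_of_contMDiff (hψ n).1))
  have hFm : ∀ n, AEMeasurable (fun x => ‖u x - ψ n x‖ₑ ^ 2 + ‖G x - grad (ψ n) x‖ₑ ^ 2)
      (riemannianVolume N X) := by
    intro n
    refine ((hwg n).aestronglyMeasurable.enorm.pow_const 2).add ?_
    simp only [enorm_sq_eq_ofReal]
    exact (hwg n).aestronglyMeasurable_norm_sq.aemeasurable.ennreal_ofReal
  -- the error is bounded by the errors of mollification on the compact set `L`
  have hbound : ∀ n, ∫⁻ x, (‖u x - ψ n x‖ₑ ^ 2 + ‖G x - grad (ψ n) x‖ₑ ^ 2)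
      ∂(riemannianVolume N X)
      ≤ D * (eLpNorm (wn n - w) 2 volume ^ 2 + ENNReal.ofReal M * ∑ i : Fin N,
        eLpNorm (MeasureTheory.convolution ((ρ n).normed volume) (W (EuclideanSpace.single i 1))
          (ContinuousLinearMap.lsmul ℝ ℝ) volume - W (EuclideanSpace.single i 1)) 2 volume ^ 2) := by
    intro n
    refine (hDF _ (hFm n) fun x hx => ?_).trans ?_
    · have hxK : x ∉ param N q '' K := fun hxK => hx (Set.image_mono hKL hxK)
      rw [hu0 x hxK, hG0 x hxK, hψ0 n x hx, hψg0 n x hx]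
      simp
    · gcongr
      simp only [eLpNorm_two_pow]
      have hm1 : AEStronglyMeasurable (fun y => (wn n - w) y) volume :=
        (hwnd n).continuous.aestronglyMeasurable.sub hwm
      have hm2 : ∀ v, AEStronglyMeasurable (fun y => (MeasureTheory.convolution
          ((ρ n).normed volume) (W v) (ContinuousLinearMap.lsmul ℝ ℝ) volume - W v) y) volume :=
        fun v => (((hρc n).continuous_convolution_left _ (hρd n).continuous
          ((hW2 v).locallyIntegrable (by norm_num))).aestronglyMeasurable).sub (hWm v)
      rw [← lintegral_finsetSum' _ fun i _ => (hm2 _).enorm.pow_const 2,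
        ← lintegral_const_mul' _ _ ENNReal.ofReal_ne_top,
        ← lintegral_add_left' (hm1.enorm.pow_const 2)]
      refine (setLIntegral_mono' hLc.measurableSet fun y hy => ?_).trans
        (setLIntegral_le_lintegral L _)
      have hyT := hδT hy
      refine add_le_add ?_ ?_
      · rw [hψT n y hyT, Pi.sub_apply, hwT y hyT, ← enorm_neg, neg_sub]
      · have h1 := hM y hy (G (param N q y) - grad (ψ n) (param N q y))
        rw [enorm_sq_eq_ofReal]
        refine (ENNReal.ofReal_le_ofReal h1).trans_eq ?_
        rw [ENNReal.ofReal_mul hM0, ENNReal.ofReal_sum_of_nonneg fun i _ => sq_nonneg _]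
        congr 1
        refine Finset.sum_congr rfl fun i _ => ?_
        rw [inner_sub_left, hψg n y hyT, ← hWT _ y hyT, enorm_sq_eq_ofReal, Real.norm_eq_abs,
          sq_abs, Pi.sub_apply, ← neg_sub, neg_sq]
  have hlim : Tendsto (fun n => D * (eLpNorm (wn n - w) 2 volume ^ 2
      + ENNReal.ofReal M * ∑ i : Fin N,
        eLpNorm (MeasureTheory.convolution ((ρ n).normed volume) (W (EuclideanSpace.single i 1))
          (ContinuousLinearMap.lsmul ℝ ℝ) volume - W (EuclideanSpace.single i 1)) 2 volume ^ 2))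
      atTop (𝓝 0) := by
    have h1 : ∀ {a : ℕ → ENNReal}, Tendsto a atTop (𝓝 0) →
        Tendsto (fun n => a n ^ 2) atTop (𝓝 0) := fun {a} ha => by
      simpa [Function.comp_def] using ((ENNReal.continuous_pow 2).tendsto 0).comp ha
    have h2 := h1 (tendsto_eLpNorm_convolution_sub (μ := volume) hρr hw2)
    have h3 := tendsto_finsetSum (Finset.univ : Finset (Fin N)) fun i _ =>
      h1 (tendsto_eLpNorm_convolution_sub (μ := volume) hρr (hW2 (EuclideanSpace.single i 1)))
    rw [Finset.sum_const_zero] at h3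
    have h4 := ENNReal.Tendsto.const_mul (a := ENNReal.ofReal M) h3
      (Or.inr ENNReal.ofReal_ne_top)
    have h5 := ENNReal.Tendsto.const_mul (a := D) (h2.add h4) (Or.inr hD)
    simpa using h5
  intro ε hε
  obtain ⟨n, hn⟩ := (hlim.eventually_le_const hε).exists
  exact ⟨ψ n, hψ n, (hbound n).trans hn⟩

end ChartDensity

/-! ### Approximation of Sobolev functions with compact support -/

section CompactSupport

variable {N : ℕ} {X : Type*} [TopologicalSpace X] [ChartedSpace (EuclideanSpace ℝ (Fin N)) X]
  [IsManifold (𝓡 N) ∞ X] [RiemannianBundle (fun x : X => TangentSpace (𝓡 N) x)]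

lemma grad_add {u u' : X → ℝ} {x : X} (h : MDifferentiableAt (𝓡 N) 𝓘(ℝ) u x)
    (h' : MDifferentiableAt (𝓡 N) 𝓘(ℝ) u' x) :
    grad (N := N) (fun x => u x + u' x) x = grad u x + grad u' x := by
  refine ext_inner_right ℝ fun ξ => ?_
  rw [inner_add_left, inner_grad, inner_grad, inner_grad,
    show (fun x => u x + u' x) = u + u' from rfl, (h.hasMFDerivAt.add h'.hasMFDerivAt).mfderiv]
  rfl

lemma grad_mul {u u' : X → ℝ} {x : X} (h : MDifferentiableAt (𝓡 N) 𝓘(ℝ) u x)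
    (h' : MDifferentiableAt (𝓡 N) 𝓘(ℝ) u' x) :
    grad (N := N) (fun x => u x * u' x) x = u x • grad u' x + u' x • grad u x := by
  refine ext_inner_right ℝ fun ξ => ?_
  rw [inner_add_left, inner_smul_left, inner_smul_left, inner_grad, inner_grad, inner_grad,
    show (fun x => u x * u' x) = u * u' from rfl, (h.hasMFDerivAt.mul' h'.hasMFDerivAt).mfderiv]
  simp only [conj_trivial]
  change u x * _ + _ * u' x = _
  rw [mul_comm _ (u' x)]
  rfl

omit [IsManifold (𝓡 N) ∞ X] [RiemannianBundle (fun x : X => TangentSpace (𝓡 N) x)] in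
lemma IsTestFunction.add {ψ ψ' : X → ℝ} (h : IsTestFunction N ψ) (h' : IsTestFunction N ψ') :
    IsTestFunction N (fun x => ψ x + ψ' x) :=
  ⟨h.1.add h'.1, h.2.add h'.2⟩

lemma IsTestFunction.mdifferentiableAt {ψ : X → ℝ} (h : IsTestFunction N ψ) (x : X) :
    MDifferentiableAt (𝓡 N) 𝓘(ℝ) ψ x := h.1.mdifferentiableAt (by simp)

variable [hsm : IsContMDiffRiemannianBundle (𝓡 N) ∞ (EuclideanSpace ℝ (Fin N))
      (fun x : X => TangentSpace (𝓡 N) x)] [MeasurableSpace X] [BorelSpace X]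

lemma memLp_two_of_lintegral_lt_top {α : Type*} [MeasurableSpace α] {μ : Measure α} {g : α → ℝ}
    (hg : AEStronglyMeasurable g μ) (h : ∫⁻ x, ‖g x‖ₑ ^ 2 ∂μ < ⊤) : MemLp g 2 μ := by
  refine ⟨hg, ?_⟩
  rw [← eLpNorm_two_pow] at h
  exact (ENNReal.pow_lt_top_iff.1 h).resolve_right (by norm_num)

lemma lintegral_enorm_sq_lt_top_of_memLp {α : Type*} [MeasurableSpace α] {μ : Measure α} {g : α → ℝ}
    (hg : MemLp g 2 μ) : ∫⁻ x, ‖g x‖ₑ ^ 2 ∂μ < ⊤ := by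
  rw [← eLpNorm_two_pow]; exact ENNReal.pow_lt_top hg.2

lemma IsTestLimit.congr_ae {u : X → ℝ} {G G' : ∀ x : X, TangentSpace (𝓡 N) x}
    (h : IsTestLimit N u G) (hG : ∀ᵐ x ∂(riemannianVolume N X), G x = G' x) :
    IsTestLimit N u G' := by
  intro ε hε
  obtain ⟨ψ, hψ, hle⟩ := h ε hε
  refine ⟨ψ, hψ, le_of_eq_of_le (lintegral_congr_ae ?_) hle⟩
  filter_upwards [hG] with x hx
  rw [hx]

variable [SecondCountableTopology X]

lemma HasWeakGradient.aemeasurable_enorm_sq {u : X → ℝ} {G : ∀ x : X, TangentSpace (𝓡 N) x}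
    (h : HasWeakGradient N u G) :
    AEMeasurable (fun x => ‖G x‖ₑ ^ 2) (riemannianVolume N X) := by
  simp only [enorm_sq_eq_ofReal]
  exact h.aestronglyMeasurable_norm_sq.aemeasurable.ennreal_ofReal

lemma HasWeakGradient.aemeasurable_enorm_sq_add {u : X → ℝ} {G : ∀ x : X, TangentSpace (𝓡 N) x}
    (h : HasWeakGradient N u G) :
    AEMeasurable (fun x => ‖u x‖ₑ ^ 2 + ‖G x‖ₑ ^ 2) (riemannianVolume N X) :=
  (h.aestronglyMeasurable.enorm.pow_const 2).add h.aemeasurable_enorm_sq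

lemma IsTestFunction.hasWeakGradient {ψ : X → ℝ} (h : IsTestFunction N ψ) :
    HasWeakGradient N ψ (grad ψ) :=
  hasWeakGradient_grad (locallyLipschitzInCharts_of_contMDiff h.1)

lemma IsTestLimit.add {u u' : X → ℝ} {G G' : ∀ x : X, TangentSpace (𝓡 N) x}
    (h : IsTestLimit N u G) (h' : IsTestLimit N u' G') (hG : HasWeakGradient N u G) :
    IsTestLimit N (fun x => u x + u' x) (fun x => G x + G' x) := by
  intro ε hε
  have hε4 : 0 < ε / 4 := ENNReal.div_pos hε.ne' (by simp)
  obtain ⟨ψ, hψ, hle⟩ := h (ε / 4) hε4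
  obtain ⟨ψ', hψ', hle'⟩ := h' (ε / 4) hε4
  refine ⟨_, hψ.add hψ', ?_⟩
  have hm := (hG.sub hψ.hasWeakGradient).aemeasurable_enorm_sq_add
  calc ∫⁻ x, (‖u x + u' x - (ψ x + ψ' x)‖ₑ ^ 2
        + ‖G x + G' x - grad (fun x => ψ x + ψ' x) x‖ₑ ^ 2) ∂(riemannianVolume N X)
      ≤ ∫⁻ x, (2 * (‖u x - ψ x‖ₑ ^ 2 + ‖G x - grad ψ x‖ₑ ^ 2)
          + 2 * (‖u' x - ψ' x‖ₑ ^ 2 + ‖G' x - grad ψ' x‖ₑ ^ 2)) ∂(riemannianVolume N X) := by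
        refine lintegral_mono fun x => ?_
        rw [grad_add (hψ.mdifferentiableAt x) (hψ'.mdifferentiableAt x), add_sub_add_comm,
          add_sub_add_comm]
        refine (add_le_add (enorm_add_sq_le _ _) (enorm_add_sq_le _ _)).trans_eq ?_
        ring
    _ = 2 * ∫⁻ x, (‖u x - ψ x‖ₑ ^ 2 + ‖G x - grad ψ x‖ₑ ^ 2) ∂(riemannianVolume N X)
        + 2 * ∫⁻ x, (‖u' x - ψ' x‖ₑ ^ 2 + ‖G' x - grad ψ' x‖ₑ ^ 2) ∂(riemannianVolume N X) := by
        rw [lintegral_add_left' (hm.const_mul 2), lintegral_const_mul' _ _ (by simp),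
          lintegral_const_mul' _ _ (by simp)]
    _ ≤ 2 * (ε / 4) + 2 * (ε / 4) := by gcongr
    _ = ε := by
        rw [← two_mul, ← mul_assoc, show (2 * 2 : ENNReal) = 4 by norm_num,
          ENNReal.mul_div_cancel (by simp) (by simp)]

lemma isTestLimit_zero : IsTestLimit N (fun _ : X => 0) (fun _ => 0) := by
  intro ε hε
  refine ⟨fun _ => 0, ⟨contMDiff_const, HasCompactSupport.zero⟩, ?_⟩
  have : ∀ x : X, grad (N := N) (fun _ : X => (0 : ℝ)) x = 0 := fun x =>
    grad_eq_zero_of_notMem_tsupport (by simp)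
  simp [this]

lemma SobolevPair.add {u u' : X → ℝ} {G G' : ∀ x : X, TangentSpace (𝓡 N) x}
    (h : SobolevPair N u G) (h' : SobolevPair N u' G') :
    SobolevPair N (fun x => u x + u' x) (fun x => G x + G' x) := by
  refine ⟨h.memLp.add h'.memLp, h.hasWeakGradient.add h'.hasWeakGradient, ?_⟩
  refine lt_of_le_of_lt (lintegral_mono fun x => enorm_add_sq_le (G x) (G' x)) ?_
  rw [lintegral_add_left' (h.hasWeakGradient.aemeasurable_enorm_sq.const_mul 2),
    lintegral_const_mul' _ _ (by simp), lintegral_const_mul' _ _ (by simp)]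
  exact ENNReal.add_lt_top.2 ⟨ENNReal.mul_lt_top (by simp) h.lintegral_lt_top,
    ENNReal.mul_lt_top (by simp) h'.lintegral_lt_top⟩

lemma SobolevPair.const_mul {u : X → ℝ} {G : ∀ x : X, TangentSpace (𝓡 N) x}
    (h : SobolevPair N u G) (c : ℝ) :
    SobolevPair N (fun x => c * u x) (fun x => c • G x) := by
  refine ⟨h.memLp.const_mul c, h.hasWeakGradient.const_mul c, ?_⟩
  simp only [enorm_smul, mul_pow]
  rw [lintegral_const_mul' _ _ (ENNReal.pow_ne_top enorm_ne_top)]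
  exact ENNReal.mul_lt_top (ENNReal.pow_lt_top enorm_lt_top) h.lintegral_lt_top

lemma SobolevPair.sub {u u' : X → ℝ} {G G' : ∀ x : X, TangentSpace (𝓡 N) x}
    (h : SobolevPair N u G) (h' : SobolevPair N u' G') :
    SobolevPair N (fun x => u x - u' x) (fun x => G x - G' x) := by
  have := h.add (h'.const_mul (-1))
  simpa [sub_eq_add_neg] using this

/-- The product of a Sobolev function with compact support and a smooth function. -/
lemma SobolevPair.contMDiff_mul {u : X → ℝ} {G : ∀ x : X, TangentSpace (𝓡 N) x}
    (h : SobolevPair N u G) {φ : X → ℝ} (hφ : ContMDiff (𝓡 N) 𝓘(ℝ) ∞ φ) {K : Set X}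
    (hK : IsCompact K) (h0 : ∀ x ∉ K, φ x = 0 ∧ grad (N := N) φ x = 0 ∨ u x = 0 ∧ G x = 0) :
    SobolevPair N (fun x => φ x * u x) (fun x => φ x • G x + u x • grad φ x) := by
  obtain ⟨C, hC⟩ := hK.exists_bound_of_continuousOn hφ.continuous.continuousOn
  obtain ⟨D, hD⟩ := hK.exists_bound_of_continuousOn
    (continuous_norm_sq_grad (N := N) hφ).continuousOn
  have hw := h.hasWeakGradient.contMDiff_mul hφ
  have b1 : ∀ x, ‖φ x * u x‖ₑ ^ 2 ≤ ENNReal.ofReal (C ^ 2) * ‖u x‖ₑ ^ 2 := by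
    intro x
    by_cases hx : x ∈ K
    · rw [enorm_mul, mul_pow, enorm_sq_eq_ofReal (φ x)]
      gcongr
      exact hC x hx
    · rcases h0 x hx with hz | hz <;> simp [hz.1]
  have b2 : ∀ x, ‖φ x • G x + u x • grad φ x‖ₑ ^ 2
      ≤ 2 * (ENNReal.ofReal (C ^ 2) * ‖G x‖ₑ ^ 2) + 2 * (ENNReal.ofReal D * ‖u x‖ₑ ^ 2) := by
    intro x
    by_cases hx : x ∈ K
    · refine (enorm_add_sq_le _ _).trans ?_
      rw [enorm_smul, mul_pow, enorm_sq_eq_ofReal (φ x), enorm_smul, mul_pow,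
        enorm_sq_eq_ofReal (grad φ x), mul_comm (‖u x‖ₑ ^ 2)]
      gcongr
      · exact hC x hx
      · exact (le_abs_self _).trans (hD x hx)
    · rcases h0 x hx with hz | hz <;> simp [hz.1, hz.2]
  have hu := lintegral_enorm_sq_lt_top_of_memLp h.memLp
  refine ⟨memLp_two_of_lintegral_lt_top hw.aestronglyMeasurable ?_, hw, ?_⟩
  · refine (lintegral_mono b1).trans_lt ?_
    rw [lintegral_const_mul' _ _ ENNReal.ofReal_ne_top]
    exact ENNReal.mul_lt_top ENNReal.ofReal_lt_top hu
  · refine (lintegral_mono b2).trans_lt ?_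
    rw [lintegral_add_left' ((h.hasWeakGradient.aemeasurable_enorm_sq.const_mul _).const_mul 2),
      lintegral_const_mul' _ _ (by simp), lintegral_const_mul' _ _ ENNReal.ofReal_ne_top,
      lintegral_const_mul' _ _ (by simp), lintegral_const_mul' _ _ ENNReal.ofReal_ne_top]
    exact ENNReal.add_lt_top.2
      ⟨ENNReal.mul_lt_top (by simp) (ENNReal.mul_lt_top ENNReal.ofReal_lt_top h.lintegral_lt_top),
        ENNReal.mul_lt_top (by simp) (ENNReal.mul_lt_top ENNReal.ofReal_lt_top hu)⟩

variable [T2Space X]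

lemma IsTestFunction.sobolevPair {ψ : X → ℝ} (h : IsTestFunction N ψ) :
    SobolevPair N ψ (grad ψ) := by
  have := isFiniteMeasureOnCompacts_riemannianVolume (N := N) (X := X)
  refine ⟨h.1.continuous.memLp_of_hasCompactSupport h.2, h.hasWeakGradient, ?_⟩
  have hi : Integrable (fun x => ‖grad (N := N) ψ x‖ ^ 2) (riemannianVolume N X) := by
    refine (continuous_norm_sq_grad h.1).integrable_of_hasCompactSupport
      (HasCompactSupport.intro h.2 fun x hx => ?_)
    rw [grad_eq_zero_of_notMem_tsupport hx]; simp
  simp only [enorm_sq_eq_ofReal]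
  exact (lintegral_ofReal_le_lintegral_enorm _).trans_lt hi.2

/-- A Sobolev function with compact support is a limit of test functions: cut it into pieces
supported in charts. -/
lemma SobolevPair.isTestLimit_of_isCompact {u : X → ℝ} {G : ∀ x : X, TangentSpace (𝓡 N) x}
    (h : SobolevPair N u G) {K : Set X} (hK : IsCompact K)
    (h0 : ∀ x ∉ K, u x = 0 ∧ G x = 0) : IsTestLimit N u G := by
  have : LocallyCompactSpace X := Manifold.locallyCompact_of_finiteDimensional (𝓡 N)
  obtain ⟨f, hf⟩ := SmoothPartitionOfUnity.exists_isSubordinate_chartAt_source (𝓡 N) X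
  have hfin : {i | (Function.support (f i) ∩ K).Nonempty}.Finite :=
    f.locallyFinite.finite_nonempty_inter_compact hK
  set S := hfin.toFinset with hS
  -- each piece is a limit of test functions
  have hpair : ∀ i, SobolevPair N (fun x => f i x * u x)
      (fun x => f i x • G x + u x • grad (f i) x) := fun i =>
    h.contMDiff_mul (f i).contMDiff hK fun x hx => Or.inr (h0 x hx)
  have hpiece : ∀ i, IsTestLimit N (fun x => f i x * u x)
      (fun x => f i x • G x + u x • grad (f i) x) := by
    intro i
    have hKi : IsCompact (tsupport (f i) ∩ K) := hK.inter_left (isClosed_tsupport _)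
    have hsub : tsupport (f i) ∩ K ⊆ (extChartAt (𝓡 N) i).source := by
      rw [extChartAt_source]
      exact Set.inter_subset_left.trans (hf i)
    have hLT : extChartAt (𝓡 N) i '' (tsupport (f i) ∩ K) ⊆ (extChartAt (𝓡 N) i).target := by
      rintro _ ⟨x, hx, rfl⟩; exact (extChartAt (𝓡 N) i).map_source (hsub hx)
    have hLc : IsCompact (extChartAt (𝓡 N) i '' (tsupport (f i) ∩ K)) :=
      hKi.image_of_continuousOn ((continuousOn_extChartAt i).mono hsub)
    have hz : ∀ x ∉ param N i '' (extChartAt (𝓡 N) i '' (tsupport (f i) ∩ K)),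
        f i x * u x = 0 ∧ f i x • G x + u x • grad (f i) x = 0 := by
      intro x hx
      have hx' : x ∉ tsupport (f i) ∩ K := fun hxK =>
        hx ⟨_, ⟨x, hxK, rfl⟩, (extChartAt (𝓡 N) i).left_inv (hsub hxK)⟩
      by_cases hxK : x ∈ K
      · have hxt : x ∉ tsupport (f i) := fun hxt => hx' ⟨hxt, hxK⟩
        rw [image_eq_zero_of_notMem_tsupport hxt, grad_eq_zero_of_notMem_tsupport hxt]
        simp
      · rw [(h0 x hxK).1, (h0 x hxK).2]; simp
    exact (hpair i).isTestLimit_of_chart i hLc hLT (fun x hx => (hz x hx).1)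
      (fun x hx => (hz x hx).2)
  have hsum : ∀ s : Finset X, HasWeakGradient N (fun x => ∑ i ∈ s, f i x * u x)
        (fun x => ∑ i ∈ s, (f i x • G x + u x • grad (f i) x)) ∧
      IsTestLimit N (fun x => ∑ i ∈ s, f i x * u x)
        (fun x => ∑ i ∈ s, (f i x • G x + u x • grad (f i) x)) := by
    classical
    intro s
    induction s using Finset.induction_on with
    | empty =>
      simp only [Finset.sum_empty]
      refine ⟨?_, isTestLimit_zero⟩
      have := h.hasWeakGradient.const_mul 0
      simpa using this
    | insert a s ha ih =>
      simp only [Finset.sum_insert ha]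
      exact ⟨(hpair a).hasWeakGradient.add ih.1, (hpiece a).add ih.2 (hpair a).hasWeakGradient⟩
  have hu : (fun x => ∑ i ∈ S, f i x * u x) = u := by
    funext x
    by_cases hx : x ∈ K
    · rw [← Finset.sum_mul]
      have h1 := f.sum_eq_one (Set.mem_univ x)
      rw [finsum_eq_sum_of_support_subset (s := S)] at h1
      · rw [h1, one_mul]
      · intro i hi
        simp only [hS, Set.Finite.coe_toFinset]
        exact ⟨x, hi, hx⟩
    · rw [(h0 x hx).1]; simp
  obtain ⟨h1, h2⟩ := hsum S
  rw [hu] at h1 h2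
  exact h2.congr_ae (h1.ae_unique h.hasWeakGradient)

end CompactSupport

/-! ### Completeness and Lipschitz cutoff functions -/

section Distance

section Length

variable {N : ℕ} {X : Type*} [EMetricSpace X] [ChartedSpace (EuclideanSpace ℝ (Fin N)) X]
  [IsManifold (𝓡 N) ∞ X] [RiemannianBundle (fun x : X => TangentSpace (𝓡 N) x)]
  [hriem : IsRiemannianManifold (𝓡 N) X]

/-- The distance of two points of a chart is at most the length of the coordinate segment. -/
lemma edist_param_le (q : X) {y z : EuclideanSpace ℝ (Fin N)} {c : ℝ}
    (h : ∀ t ∈ Set.Icc (0 : ℝ) 1, y + t • z ∈ (extChartAt (𝓡 N) q).target ∧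
      ‖coordVector N q (y + t • z) z‖ ≤ c) :
    edist (param N q y) (param N q (y + z)) ≤ ENNReal.ofReal c := by
  set η : ℝ → EuclideanSpace ℝ (Fin N) := fun t => y + t • z with hη
  have hηs : ContDiff ℝ ∞ η := by fun_prop
  have hγ : ContMDiffOn 𝓘(ℝ, ℝ) (𝓡 N) 1 (fun t => param N q (η t)) (Set.Icc 0 1) := by
    have := (contMDiffOn_param (N := N) q).comp (s := Set.Icc (0 : ℝ) 1)
      (hηs.contMDiff.contMDiffOn) fun t ht => (h t ht).1
    exact this.of_le (by simp)
  rw [hriem.out]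
  refine (riemannianEDist_le_pathELength hγ (by simp [hη]) (by simp [hη]) zero_le_one).trans ?_
  rw [pathELength_eq_lintegral_mfderiv_Icc]
  calc ∫⁻ t in Set.Icc (0 : ℝ) 1, ‖mfderiv 𝓘(ℝ, ℝ) (𝓡 N) (fun t => param N q (η t)) t 1‖ₑ
      ≤ ∫⁻ _ in Set.Icc (0 : ℝ) 1, ENNReal.ofReal c := by
        refine setLIntegral_mono' measurableSet_Icc fun t ht => ?_
        have h1 : HasFDerivAt η (ContinuousLinearMap.toSpanSingleton ℝ z) t := by
          have : HasDerivAt η z t := by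
            simpa [hη] using ((hasDerivAt_id t).smul_const z).const_add y
          exact this.hasFDerivAt
        have h2 := (mdifferentiableAt_param q (h t ht).1).hasMFDerivAt.comp t h1.hasMFDerivAt
        have h3 : mfderiv 𝓘(ℝ, ℝ) (𝓡 N) (fun t => param N q (η t)) t 1
            = coordVector N q (η t) z := by
          refine (DFunLike.congr_fun h2.mfderiv (1 : ℝ)).trans ?_
          change mfderiv (𝓡 N) (𝓡 N) (param N q) (η t)
            (ContinuousLinearMap.toSpanSingleton ℝ z (1 : ℝ)) = _
          simp [coordVector]
        rw [h3, ← ofReal_norm]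
        exact ENNReal.ofReal_le_ofReal (h t ht).2
    _ = ENNReal.ofReal c := by simp

variable [hsm : IsContMDiffRiemannianBundle (𝓡 N) ∞ (EuclideanSpace ℝ (Fin N))
      (fun x : X => TangentSpace (𝓡 N) x)]

omit hriem in
lemma continuousOn_norm_coordVector (q : X) (v : EuclideanSpace ℝ (Fin N)) :
    ContinuousOn (fun y => ‖coordVector N q y v‖) (extChartAt (𝓡 N) q).target := by
  simp only [norm_eq_sqrt_real_inner]
  exact (continuousOn_inner_coordVector q v v).sqrt

omit hriem hsm in
lemma norm_coordVector_le (q : X) (y v : EuclideanSpace ℝ (Fin N)) :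
    ‖coordVector N q y v‖ ≤ (∑ i, ‖coordVector N q y (EuclideanSpace.single i 1)‖) * ‖v‖ := by
  rw [coordVector_eq_sum q y v, Finset.sum_mul]
  refine (norm_sum_le _ _).trans (Finset.sum_le_sum fun i _ => ?_)
  rw [norm_smul, mul_comm]
  gcongr
  exact PiLp.norm_apply_le v i

/-- Lipschitz functions for the Riemannian distance are locally Lipschitz in charts, as coordinate
segments bound the distance. -/
lemma locallyLipschitzInCharts_of_lipschitzWith {w : X → ℝ} {L : NNReal} (hw : LipschitzWith L w) :
    LocallyLipschitzInCharts N w := by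
  intro q y hy
  set F : EuclideanSpace ℝ (Fin N) → ℝ :=
    fun z => ∑ i, ‖coordVector N q z (EuclideanSpace.single i 1)‖ with hF
  have hFc : ContinuousAt F y :=
    (continuousOn_finsetSum _ fun i _ => continuousOn_norm_coordVector q _).continuousAt
      ((isOpen_target q).mem_nhds hy)
  obtain ⟨r, hr, hball⟩ := Metric.eventually_nhds_iff_ball.1
    ((hFc.eventually_lt_const (lt_add_one (F y))).and ((isOpen_target q).mem_nhds hy))
  have hF0 : 0 ≤ F y + 1 := add_nonneg (Finset.sum_nonneg fun i _ => norm_nonneg _) zero_le_one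
  refine ⟨L * (F y + 1).toNNReal, Metric.ball y r,
    mem_nhdsWithin_of_mem_nhds (Metric.ball_mem_nhds y hr), fun a ha b hb => ?_⟩
  refine (hw _ _).trans ?_
  rw [ENNReal.coe_mul, mul_assoc]
  gcongr
  have := edist_param_le (N := N) q (y := a) (z := b - a) (c := (F y + 1) * ‖b - a‖) fun t ht => by
    have hm : a + t • (b - a) ∈ Metric.ball y r :=
      (convex_ball y r).add_smul_sub_mem ha hb ht
    refine ⟨(hball _ hm).2, (norm_coordVector_le q _ _).trans ?_⟩
    gcongr
    exact (hball _ hm).1.le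
  rw [add_sub_cancel] at this
  refine this.trans_eq ?_
  rw [ENNReal.ofReal_mul hF0, edist_comm, edist_eq_enorm_sub, ← ofReal_norm]
  rfl

/-- A `1`-Lipschitz function has a gradient of norm at most `1`. -/
lemma norm_grad_le_one {w : X → ℝ} (hw : LipschitzWith 1 w) (x : X) :
    ‖grad (N := N) w x‖ ≤ 1 := by
  by_cases hd : MDifferentiableAt (𝓡 N) 𝓘(ℝ) w x
  swap
  · have : grad (N := N) w x = 0 := by
      refine ext_inner_right ℝ fun ξ => ?_
      rw [inner_grad, mfderiv_zero_of_not_mdifferentiableAt hd, inner_zero_left]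
      rfl
    rw [this, norm_zero]; exact zero_le_one
  set y := extChartAt (𝓡 N) x x with hy
  have hyt : y ∈ (extChartAt (𝓡 N) x).target := mem_extChartAt_target x
  have hx : param N x y = x := extChartAt_to_inv x
  have key : ∀ v, inner ℝ (grad (N := N) w (param N x y)) (coordVector N x y v)
      ≤ ‖coordVector N x y v‖ := by
    intro v
    have hd' : MDifferentiableAt (𝓡 N) 𝓘(ℝ) w (param N x y) := by rw [hx]; exact hd
    rw [inner_grad_coordVector x hyt hd']
    -- compare `w` along the coordinate line in the direction `v` with the length of this line
    refine le_of_forall_pos_le_add fun ε hε => ?_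
    set c := ‖coordVector N x y v‖ + ε with hc
    have hc0 : 0 ≤ c := by positivity
    have h1 : HasDerivAt (fun t : ℝ => w (param N x (y + t • v)))
        (fderiv ℝ (fun y => w (param N x y)) y v) 0 := by
      have hl : HasDerivAt (fun t : ℝ => y + t • v) v 0 := by
        simpa using ((hasDerivAt_id (0 : ℝ)).smul_const v).const_add y
      have hf : HasFDerivAt (fun y => w (param N x y)) (fderiv ℝ (fun y => w (param N x y)) y)
          (y + (0 : ℝ) • v) := by
        rw [zero_smul, add_zero]; exact (differentiableAt_chart x hyt hd').hasFDerivAt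
      exact hf.comp_hasDerivAt (0 : ℝ) hl
    refine (le_abs_self _).trans (h1.le_of_lip' hc0 ?_)
    have hcont : ContinuousAt (fun z => ‖coordVector N x z v‖) y :=
      (continuousOn_norm_coordVector x v).continuousAt ((isOpen_target x).mem_nhds hyt)
    obtain ⟨r, hr, hball⟩ := Metric.eventually_nhds_iff_ball.1
      ((hcont.eventually_lt_const (lt_add_of_pos_right _ hε)).and
        ((isOpen_target x).mem_nhds hyt))
    have hsmall : ∀ᶠ t : ℝ in 𝓝 0, y + t • v ∈ Metric.ball y r := by
      have : ContinuousAt (fun t : ℝ => y + t • v) 0 := by fun_prop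
      exact this.eventually_mem (by simpa using Metric.ball_mem_nhds y hr)
    filter_upwards [hsmall] with t ht
    have hle := edist_param_le (N := N) x (y := y) (z := t • v) (c := c * |t|) fun τ hτ => by
      have hm : y + τ • (t • v) ∈ Metric.ball y r := by
        have := (convex_ball y r).add_smul_sub_mem (Metric.mem_ball_self hr) ht hτ
        simpa using this
      refine ⟨(hball _ hm).2, ?_⟩
      rw [coordVector_smul, norm_smul, mul_comm, Real.norm_eq_abs]
      gcongr
      exact (hball _ hm).1.le
    have h2 := (hw (param N x (y + t • v)) (param N x y))
    rw [ENNReal.coe_one, one_mul, edist_comm (param N x _)] at h2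
    have h3 := h2.trans hle
    rw [edist_eq_enorm_sub, ← ofReal_norm, ENNReal.ofReal_le_ofReal_iff (by positivity)] at h3
    simpa using h3
  obtain ⟨v, hv⟩ := exists_coordVector_eq x hyt (grad (N := N) w (param N x y))
  have := key v
  rw [hv, real_inner_self_eq_norm_sq] at this
  rw [hx] at this
  nlinarith [norm_nonneg (grad (N := N) w x)]

/-- In a length space, two points at distance less than `a + b` have a point in between, at distance
at most `a` from the first and at most `b` from the second. -/
lemma exists_edist_le_edist_le (N : ℕ) {X : Type*} [EMetricSpace X]
    [ChartedSpace (EuclideanSpace ℝ (Fin N)) X]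
    [RiemannianBundle (fun x : X => TangentSpace (𝓡 N) x)]
    [hriem : IsRiemannianManifold (𝓡 N) X] {x y : X} {a b : ENNReal} (h : edist x y < a + b) :
    ∃ z, edist x z ≤ a ∧ edist z y ≤ b := by
  rcases le_total (edist x y) a with hle | hle
  · exact ⟨y, hle, by simp⟩
  have ha : a ≠ ⊤ := (hle.trans_lt (h.trans_le le_top)).ne
  have h' := h
  rw [hriem.out] at h'
  obtain ⟨γ, h0, h1, hγ, hlen⟩ := exists_lt_of_riemannianEDist_lt h'
  have hcont : ContinuousOn (fun t => edist x (γ t)) (Set.Icc (0 : ℝ) 1) :=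
    continuous_edist.comp_continuousOn (continuousOn_const.prodMk hγ.continuousOn)
  obtain ⟨t, ht, hta⟩ := intermediate_value_Icc zero_le_one hcont
    (show a ∈ Set.Icc _ _ by simp [h0, h1, hle])
  refine ⟨γ t, hta.le, ?_⟩
  rw [← pathELength_add ht.1 ht.2] at hlen
  have e1 : a ≤ pathELength (𝓡 N) γ 0 t := by
    rw [← hta]; dsimp only; rw [hriem.out]
    exact riemannianEDist_le_pathELength (hγ.mono (Set.Icc_subset_Icc_right ht.2)) h0 rfl ht.1
  have e2 : edist (γ t) y ≤ pathELength (𝓡 N) γ t 1 := by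
    rw [hriem.out]
    exact riemannianEDist_le_pathELength (hγ.mono (Set.Icc_subset_Icc_left ht.1)) rfl h1 ht.2
  refine e2.trans (le_of_lt ?_)
  exact (ENNReal.add_lt_add_iff_left ha).1 ((add_le_add_left e1 _).trans_lt hlen)

end Length
section Proper

variable {X : Type*} [EMetricSpace X] [CompleteSpace X]

/-- Closed balls are compact in a complete locally compact length space (Hopf–Rinow). -/
lemma isCompact_closedEBall [LocallyCompactSpace X]
    (hlen : ∀ (x y : X) (a b : ENNReal), edist x y < a + b → ∃ z, edist x z ≤ a ∧ edist z y ≤ b)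
    (x : X) {R : ℝ} (hR : 0 ≤ R) : IsCompact (Metric.closedEBall x (ENNReal.ofReal R)) := by
  set s : Set ℝ := {r | IsCompact (Metric.closedEBall x (ENNReal.ofReal r))} with hs
  have hmono : ∀ {r r' : ℝ}, r ≤ r' → r' ∈ s → r ∈ s := fun h hr' =>
    IsCompact.of_isClosed_subset hr' Metric.isClosed_closedEBall
      (Metric.closedEBall_subset_closedEBall (ENNReal.ofReal_le_ofReal h))
  suffices h : Set.Icc 0 R ⊆ s from h ⟨hR, le_rfl⟩
  refine IsClosed.Icc_subset_of_forall_exists_gt ?_ ?_ ?_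
  · -- a ball is totally bounded if the slightly smaller ones are
    refine isClosed_of_closure_subset fun r hr => ?_
    have hrI : r ∈ Set.Icc 0 R := by
      have := closure_mono Set.inter_subset_right hr
      rwa [isClosed_Icc.closure_eq] at this
    refine ⟨?_, hrI⟩
    refine isCompact_iff_totallyBounded_isComplete.2
      ⟨EMetric.totallyBounded_iff.2 fun ε hε => ?_, Metric.isClosed_closedEBall.isComplete⟩
    obtain ⟨δ, hδ, hδε⟩ : ∃ δ : ℝ, 0 < δ ∧ ENNReal.ofReal δ + ENNReal.ofReal δ ≤ ε := by
      rcases eq_or_ne ε ⊤ with rfl | hε'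
      · exact ⟨1, one_pos, le_top⟩
      · refine ⟨ε.toReal / 2, half_pos (ENNReal.toReal_pos hε.ne' hε'), ?_⟩
        rw [← ENNReal.ofReal_add (by positivity) (by positivity), add_halves,
          ENNReal.ofReal_toReal hε']
    obtain ⟨r', hr', hdist⟩ := Metric.mem_closure_iff.1 hr (δ / 2) (half_pos hδ)
    rw [Real.dist_eq] at hdist
    obtain ⟨t, ht, hcov⟩ := EMetric.totallyBounded_iff.1 hr'.1.totallyBounded
      (ENNReal.ofReal δ) (ENNReal.ofReal_pos.2 hδ)
    refine ⟨t, ht, fun z hz => ?_⟩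
    have hz' : edist x z < ENNReal.ofReal r' + ENNReal.ofReal (δ / 2) := by
      rw [← ENNReal.ofReal_add hr'.2.1 (by positivity)]
      refine (Metric.mem_closedEBall'.1 hz).trans_lt ?_
      rw [ENNReal.ofReal_lt_ofReal_iff_of_nonneg hrI.1]
      linarith [le_abs_self (r - r')]
    obtain ⟨w, hw1, hw2⟩ := hlen _ _ _ _ hz'
    have := hcov (Metric.mem_closedEBall'.2 hw1)
    simp only [Set.mem_iUnion, Metric.mem_eball, exists_prop] at this ⊢
    obtain ⟨y, hy, hwy⟩ := this
    refine ⟨y, hy, (edist_triangle z w y).trans_lt (lt_of_lt_of_le ?_ hδε)⟩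
    refine ENNReal.add_lt_add_of_le_of_lt (by rw [edist_comm]; exact ne_top_of_le_ne_top (by simp) hw2) ?_ hwy
    rw [edist_comm]
    exact hw2.trans (ENNReal.ofReal_le_ofReal (by linarith))
  · have : Metric.closedEBall x (ENNReal.ofReal 0) = {x} := by
      ext z; simp
    change IsCompact _
    rw [this]; exact isCompact_singleton
  · -- a compact ball has a compact neighbourhood, which contains a larger ball
    rintro r ⟨hr, hrI⟩ r' (hr' : r < r')
    obtain ⟨δ, hδ, hc⟩ := IsCompact.exists_isCompact_cthickening hr
    refine ⟨min r' (r + δ / 2), ?_, lt_min hr' (by linarith), min_le_left _ _⟩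
    refine hmono (min_le_right _ _) (hc.of_isClosed_subset Metric.isClosed_closedEBall ?_)
    intro z hz
    have hz' : edist x z < ENNReal.ofReal r + ENNReal.ofReal δ := by
      rw [← ENNReal.ofReal_add hrI.1 hδ.le]
      refine (Metric.mem_closedEBall'.1 hz).trans_lt ?_
      rw [ENNReal.ofReal_lt_ofReal_iff (by linarith [hrI.1])]
      linarith
    obtain ⟨w, hw1, hw2⟩ := hlen _ _ _ _ hz'
    exact Metric.mem_cthickening_of_edist_le z w δ _ (Metric.mem_closedEBall'.2 hw1)
      (by rwa [edist_comm])

/-- An exhaustion by compact sets, each with a `1`-Lipschitz cutoff function. -/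
lemma exists_exhaustion_lipschitz_cutoff [SecondCountableTopology X]
    (hball : ∀ (x : X) (R : ℝ), 0 ≤ R → IsCompact (Metric.closedEBall x (ENNReal.ofReal R))) :
    ∃ K : ℕ → Set X, Monotone K ∧ (∀ x, ∃ m, x ∈ interior (K m)) ∧
      ∀ m, ∃ χ : X → ℝ, LipschitzWith 1 χ ∧ HasCompactSupport χ ∧ (∀ x, 0 ≤ χ x ∧ χ x ≤ 1) ∧
        ∀ x ∈ K m, χ x = 1 := by
  rcases isEmpty_or_nonempty X with hX | hX
  · exact ⟨fun _ => ∅, fun _ _ _ => le_rfl, fun x => hX.elim x,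
      fun _ => ⟨fun _ => 0, LipschitzWith.const' 0, HasCompactSupport.zero, fun x => hX.elim x,
        fun x => hX.elim x⟩⟩
  obtain ⟨d, hd⟩ := TopologicalSpace.exists_dense_seq X
  set K : ℕ → Set X := fun m => ⋃ i ∈ Finset.range (m + 1),
    Metric.closedEBall (d i) (ENNReal.ofReal m) with hK
  have hmono : Monotone K := by
    intro m n hmn
    refine Set.iUnion₂_subset fun i hi => ?_
    refine (Metric.closedEBall_subset_closedEBall
      (ENNReal.ofReal_le_ofReal (Nat.cast_le.2 hmn))).trans ?_
    exact Set.subset_biUnion_of_mem (u := fun i => Metric.closedEBall (d i) (ENNReal.ofReal n))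
      (Finset.mem_coe.2 (Finset.mem_range.2 ((Finset.mem_range.1 hi).trans_le (by omega))))
  refine ⟨K, hmono, fun x => ?_, fun m => ?_⟩
  · obtain ⟨y, hy, i, rfl⟩ := EMetric.dense_iff.1 hd x 1 one_pos
    refine ⟨i + 1, mem_interior.2 ⟨Metric.eball (d i) 1, ?_, Metric.isOpen_eball,
      Metric.mem_eball'.2 hy⟩⟩
    intro z hz
    refine Set.mem_biUnion (Finset.mem_coe.2 (Finset.mem_range.2 (by omega : i < i + 1 + 1))) ?_
    refine Metric.mem_closedEBall.2 ((Metric.mem_eball.1 hz).le.trans ?_)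
    rw [← ENNReal.ofReal_one]
    exact ENNReal.ofReal_le_ofReal (by push_cast; linarith [Nat.cast_nonneg (α := ℝ) i])
  · refine ⟨fun x => (thickenedIndicator one_pos (K m) x : ℝ), ?_, ?_, fun x => ⟨NNReal.coe_nonneg _,
      NNReal.coe_le_one.2 (thickenedIndicator_le_one _ _ _)⟩, fun x hx => by
        simp only [thickenedIndicator_one _ _ hx, NNReal.coe_one]⟩
    · have h := lipschitzWith_thickenedIndicator one_pos (K m)
      rw [Real.toNNReal_one, inv_one] at h
      have := (NNReal.isometry_coe.lipschitz).comp h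
      rwa [mul_one] at this
    · refine HasCompactSupport.intro (K := ⋃ i ∈ Finset.range (m + 1),
        Metric.closedEBall (d i) (ENNReal.ofReal (m + 1)))
        ((Finset.range (m + 1)).isCompact_biUnion fun i _ => hball _ _ (by positivity))
        fun x hx => ?_
      rw [thickenedIndicator_zero, NNReal.coe_zero]
      intro hxt
      obtain ⟨z, hz, hxz⟩ := (Metric.mem_thickening_iff_exists_edist_lt _ _).1 hxt
      obtain ⟨i, hi, hzi⟩ := Set.mem_iUnion₂.1 hz
      refine hx (Set.mem_biUnion hi (Metric.mem_closedEBall.2 ?_))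
      refine (edist_triangle x z (d i)).trans ?_
      rw [ENNReal.ofReal_add (Nat.cast_nonneg m) zero_le_one, add_comm]
      exact add_le_add (Metric.mem_closedEBall.1 hzi) hxz.le

end Proper

end Distance

/-! ### Density of test functions -/

section Density

lemma locallyLipschitzOn_mul {α : Type*} [PseudoEMetricSpace α] {s : Set α} {f g : α → ℝ}
    (hf : LocallyLipschitzOn s f) (hg : LocallyLipschitzOn s g) :
    LocallyLipschitzOn s (fun x => f x * g x) := by
  intro x hx
  obtain ⟨K, t, ht, h⟩ := hf hx
  obtain ⟨K', t', ht', h'⟩ := hg hx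
  obtain ⟨L, v, hv, hL⟩ := ((contDiff_mul (𝕜 := ℝ) (𝔸 := ℝ) (n := 1)).contDiffAt
    (x := (f x, g x))).exists_lipschitzOnWith
  have hc : ContinuousWithinAt (fun x => (f x, g x)) s x :=
    (hf.continuousOn x hx).prodMk (hg.continuousOn x hx)
  refine ⟨L * max K K', t ∩ t' ∩ (fun x => (f x, g x)) ⁻¹' v,
    inter_mem (inter_mem ht ht') (hc hv), ?_⟩
  exact hL.comp (((h.mono fun _ hz => hz.1.1).prodMk (h'.mono fun _ hz => hz.1.2)))
    fun _ hz => hz.2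

variable {N : ℕ} {X : Type*} [TopologicalSpace X] [ChartedSpace (EuclideanSpace ℝ (Fin N)) X]
  [IsManifold (𝓡 N) ∞ X] [RiemannianBundle (fun x : X => TangentSpace (𝓡 N) x)]

omit [IsManifold (𝓡 N) ∞ X] [RiemannianBundle (fun x : X => TangentSpace (𝓡 N) x)] in
lemma LocallyLipschitzInCharts.mul {w w' : X → ℝ} (h : LocallyLipschitzInCharts N w)
    (h' : LocallyLipschitzInCharts N w') : LocallyLipschitzInCharts N (fun x => w x * w' x) :=
  fun q => locallyLipschitzOn_mul (h q) (h' q)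

variable [hsm : IsContMDiffRiemannianBundle (𝓡 N) ∞ (EuclideanSpace ℝ (Fin N))
      (fun x : X => TangentSpace (𝓡 N) x)] [MeasurableSpace X] [BorelSpace X]
  [SecondCountableTopology X]

/-- Rademacher's theorem on a manifold. -/
lemma LocallyLipschitzInCharts.ae_mdifferentiableAt {w : X → ℝ}
    (h : LocallyLipschitzInCharts N w) :
    ∀ᵐ x ∂(riemannianVolume N X), MDifferentiableAt (𝓡 N) 𝓘(ℝ) w x := by
  refine ae_of_forall_chart fun q => ?_
  filter_upwards [ae_differentiableAt_of_locallyLipschitzOn (isOpen_target q) (h q),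
    ae_restrict_mem (isOpen_target q).measurableSet] with y h1 h2
  exact mdifferentiableAt_of_chart q h2 h1

/-- Limits of limits of test functions are limits of test functions. -/
lemma isTestLimit_of_forall_exists {u : X → ℝ} {G : ∀ x : X, TangentSpace (𝓡 N) x}
    (hG : HasWeakGradient N u G)
    (h : ∀ ε : ENNReal, 0 < ε → ∃ (w : X → ℝ) (W : ∀ x : X, TangentSpace (𝓡 N) x),
      HasWeakGradient N w W ∧ IsTestLimit N w W ∧
      ∫⁻ x, (‖u x - w x‖ₑ ^ 2 + ‖G x - W x‖ₑ ^ 2) ∂(riemannianVolume N X) ≤ ε) :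
    IsTestLimit N u G := by
  intro ε hε
  have hε4 : 0 < ε / 4 := ENNReal.div_pos hε.ne' (by simp)
  obtain ⟨w, W, hW, hlim, hle⟩ := h (ε / 4) hε4
  obtain ⟨ψ, hψ, hle'⟩ := hlim (ε / 4) hε4
  refine ⟨ψ, hψ, ?_⟩
  have hm := (hG.sub hW).aemeasurable_enorm_sq_add
  calc ∫⁻ x, (‖u x - ψ x‖ₑ ^ 2 + ‖G x - grad ψ x‖ₑ ^ 2) ∂(riemannianVolume N X)
      ≤ ∫⁻ x, (2 * (‖u x - w x‖ₑ ^ 2 + ‖G x - W x‖ₑ ^ 2)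
          + 2 * (‖w x - ψ x‖ₑ ^ 2 + ‖W x - grad ψ x‖ₑ ^ 2)) ∂(riemannianVolume N X) := by
        refine lintegral_mono fun x => ?_
        rw [← sub_add_sub_cancel (u x) (w x) (ψ x), ← sub_add_sub_cancel (G x) (W x) (grad ψ x)]
        refine (add_le_add (enorm_add_sq_le _ _) (enorm_add_sq_le _ _)).trans_eq ?_
        ring
    _ = 2 * ∫⁻ x, (‖u x - w x‖ₑ ^ 2 + ‖G x - W x‖ₑ ^ 2) ∂(riemannianVolume N X)
        + 2 * ∫⁻ x, (‖w x - ψ x‖ₑ ^ 2 + ‖W x - grad ψ x‖ₑ ^ 2) ∂(riemannianVolume N X) := by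
        rw [lintegral_add_left' (hm.const_mul 2), lintegral_const_mul' _ _ (by simp),
          lintegral_const_mul' _ _ (by simp)]
    _ ≤ 2 * (ε / 4) + 2 * (ε / 4) := by gcongr
    _ = ε := by
        rw [← two_mul, ← mul_assoc, show (2 * 2 : ENNReal) = 4 by norm_num,
          ENNReal.mul_div_cancel (by simp) (by simp)]

lemma enorm_smul_sq_le {V : Type*} [SeminormedAddCommGroup V] [NormedSpace ℝ V] {c : ℝ}
    (h0 : 0 ≤ c) (h1 : c ≤ 1) (a : V) : ‖c • a‖ₑ ^ 2 ≤ ‖a‖ₑ ^ 2 := by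
  rw [enorm_sq_eq_ofReal, enorm_sq_eq_ofReal, norm_smul, Real.norm_of_nonneg h0]
  refine ENNReal.ofReal_le_ofReal (pow_le_pow_left₀ (by positivity) ?_ 2)
  exact mul_le_of_le_one_left (norm_nonneg a) h1

/-- The error made by replacing `u` and its gradient `a` by `c p` and its gradient
`c b + p z`, where `c` is the value of a cutoff function and `z` its gradient. -/
lemma enorm_sub_cutoff_sq_add_le {V : Type*} [SeminormedAddCommGroup V] [NormedSpace ℝ V]
    {c u p : ℝ} {a b z : V} (h0 : 0 ≤ c) (h1 : c ≤ 1) (hz : ‖z‖ ≤ 1) :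
    ‖u - c * p‖ₑ ^ 2 + ‖a - (c • b + p • z)‖ₑ ^ 2
      ≤ 6 * (‖u‖ₑ ^ 2 + ‖a‖ₑ ^ 2) + 6 * (‖u - p‖ₑ ^ 2 + ‖a - b‖ₑ ^ 2) := by
  have h0' : 0 ≤ 1 - c := by linarith
  have h1' : 1 - c ≤ 1 := by linarith
  have e1 : ‖u - c * p‖ₑ ^ 2 ≤ 2 * ‖u‖ₑ ^ 2 + 2 * ‖u - p‖ₑ ^ 2 := by
    rw [show u - c * p = (1 - c) • u + c • (u - p) by simp; ring]
    refine (enorm_add_sq_le _ _).trans ?_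
    gcongr 2 * ?_ + 2 * ?_
    · exact enorm_smul_sq_le h0' h1' u
    · exact enorm_smul_sq_le h0 h1 _
  have e2 : ‖(1 - c) • a + c • (a - b)‖ₑ ^ 2 ≤ 2 * ‖a‖ₑ ^ 2 + 2 * ‖a - b‖ₑ ^ 2 := by
    refine (enorm_add_sq_le _ _).trans ?_
    gcongr 2 * ?_ + 2 * ?_
    · exact enorm_smul_sq_le h0' h1' a
    · exact enorm_smul_sq_le h0 h1 _
  have e3 : ‖(-p) • z‖ₑ ^ 2 ≤ 2 * ‖u‖ₑ ^ 2 + 2 * ‖u - p‖ₑ ^ 2 := by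
    have : ‖(-p) • z‖ₑ ^ 2 ≤ ‖-p‖ₑ ^ 2 := by
      rw [enorm_sq_eq_ofReal, enorm_sq_eq_ofReal, norm_smul]
      refine ENNReal.ofReal_le_ofReal (pow_le_pow_left₀ (by positivity) ?_ 2)
      exact mul_le_of_le_one_right (norm_nonneg _) hz
    refine this.trans ?_
    rw [show -p = -u + (u - p) by ring]
    exact (enorm_add_sq_le _ _).trans_eq (by rw [enorm_neg])
  have e4 : ‖a - (c • b + p • z)‖ₑ ^ 2
      ≤ 2 * (2 * ‖a‖ₑ ^ 2 + 2 * ‖a - b‖ₑ ^ 2) + 2 * (2 * ‖u‖ₑ ^ 2 + 2 * ‖u - p‖ₑ ^ 2) := by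
    rw [show a - (c • b + p • z) = ((1 - c) • a + c • (a - b)) + (-p) • z by module]
    refine (enorm_add_sq_le _ _).trans ?_
    gcongr
  refine (add_le_add e1 e4).trans ?_
  calc _ = (6 * ‖u‖ₑ ^ 2 + 4 * ‖a‖ₑ ^ 2) + (6 * ‖u - p‖ₑ ^ 2 + 4 * ‖a - b‖ₑ ^ 2) := by ring
    _ ≤ (6 * ‖u‖ₑ ^ 2 + 6 * ‖a‖ₑ ^ 2) + (6 * ‖u - p‖ₑ ^ 2 + 6 * ‖a - b‖ₑ ^ 2) := by
        gcongr <;> norm_num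
    _ = _ := by ring

variable [T2Space X]

omit [T2Space X] in
lemma HasWeakGradient.congr_ae {u : X → ℝ} {G G' : ∀ x : X, TangentSpace (𝓡 N) x}
    (h : HasWeakGradient N u G) (hG : ∀ᵐ x ∂(riemannianVolume N X), G x = G' x) :
    HasWeakGradient N u G' := by
  have hae : ∀ q : X, ∀ᵐ y ∂(volume.restrict (extChartAt (𝓡 N) q).target),
      G (param N q y) = G' (param N q y) := fun q => ae_chart_of_ae q hG
  refine ⟨h.locallyIntegrable, fun q v => ?_, fun q v η h1 h2 h3 => ?_⟩
  · refine locallyIntegrableOn_congr_ae (isOpen_target q) (h.locallyIntegrable_gradient q v) ?_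
    filter_upwards [hae q] with y hy
    rw [hy]
  · rw [h.integral_eq q v η h1 h2 h3]
    congr 1
    refine integral_congr_ae ?_
    filter_upwards [(ae_restrict_iff' (isOpen_target q).measurableSet).1 (hae q)] with y hy
    by_cases hyt : y ∈ tsupport η
    · rw [hy (h3 hyt)]
    · rw [image_eq_zero_of_notMem_tsupport hyt, mul_zero, mul_zero]

/-- The product of a test function and a Lipschitz cutoff is a limit of test functions. -/
lemma isTestLimit_cutoff_mul {χ ψ : X → ℝ} (hχ : LocallyLipschitzInCharts N χ)
    (hχc : HasCompactSupport χ) (hχb : ∀ x, 0 ≤ χ x ∧ χ x ≤ 1)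
    (hχg : ∀ x, ‖grad (N := N) χ x‖ ≤ 1) (hψ : IsTestFunction N ψ) :
    HasWeakGradient N (fun x => χ x * ψ x) (fun x => χ x • grad ψ x + ψ x • grad χ x) ∧
    IsTestLimit N (fun x => χ x * ψ x) (fun x => χ x • grad ψ x + ψ x • grad χ x) := by
  have hw := hχ.mul (locallyLipschitzInCharts_of_contMDiff hψ.1)
  have hwg := hasWeakGradient_grad hw
  have hae : ∀ᵐ x ∂(riemannianVolume N X), grad (N := N) (fun x => χ x * ψ x) x
      = χ x • grad ψ x + ψ x • grad χ x := by
    filter_upwards [hχ.ae_mdifferentiableAt] with x hx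
    exact grad_mul hx (hψ.mdifferentiableAt x)
  have hwG := hwg.congr_ae hae
  have hψp := hψ.sobolevPair
  refine ⟨hwG, SobolevPair.isTestLimit_of_isCompact ⟨?_, hwG, ?_⟩ hχc fun x hx => ?_⟩
  · refine memLp_two_of_lintegral_lt_top hwG.aestronglyMeasurable ?_
    refine (lintegral_mono fun x => ?_).trans_lt
      (lintegral_enorm_sq_lt_top_of_memLp hψp.memLp)
    exact enorm_smul_sq_le (hχb x).1 (hχb x).2 (ψ x)
  · have : ∀ x, ‖χ x • grad (N := N) ψ x + ψ x • grad χ x‖ₑ ^ 2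
        ≤ 2 * ‖grad (N := N) ψ x‖ₑ ^ 2 + 2 * ‖ψ x‖ₑ ^ 2 := by
      intro x
      refine (enorm_add_sq_le _ _).trans ?_
      gcongr 2 * ?_ + 2 * ?_
      · exact enorm_smul_sq_le (hχb x).1 (hχb x).2 _
      · rw [enorm_sq_eq_ofReal, enorm_sq_eq_ofReal, norm_smul]
        refine ENNReal.ofReal_le_ofReal (pow_le_pow_left₀ (by positivity) ?_ 2)
        exact mul_le_of_le_one_right (norm_nonneg _) (hχg x)
    refine (lintegral_mono this).trans_lt ?_
    rw [lintegral_add_left' (hψp.hasWeakGradient.aemeasurable_enorm_sq.const_mul 2),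
      lintegral_const_mul' _ _ (by simp), lintegral_const_mul' _ _ (by simp)]
    exact ENNReal.add_lt_top.2 ⟨ENNReal.mul_lt_top (by simp) hψp.lintegral_lt_top,
      ENNReal.mul_lt_top (by simp) (lintegral_enorm_sq_lt_top_of_memLp hψp.memLp)⟩
  · rw [grad_eq_zero_of_notMem_tsupport hx, image_eq_zero_of_notMem_tsupport hx]
    simp

/-- Test functions are dense in the Sobolev space, given an exhaustion with cutoff functions of
bounded gradient. -/
lemma SobolevPair.isTestLimit_of_exhaustion {u : X → ℝ} {G : ∀ x : X, TangentSpace (𝓡 N) x}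
    (h : SobolevPair N u G) {K : ℕ → Set X} (hmono : Monotone K)
    (hcov : ∀ x, ∃ m, x ∈ interior (K m))
    (hχ : ∀ m, ∃ χ : X → ℝ, LocallyLipschitzInCharts N χ ∧ HasCompactSupport χ ∧
      (∀ x, 0 ≤ χ x ∧ χ x ≤ 1) ∧ (∀ x, ‖grad (N := N) χ x‖ ≤ 1) ∧ ∀ x ∈ K m, χ x = 1) :
    IsTestLimit N u G := by
  have : LocallyCompactSpace X := Manifold.locallyCompact_of_finiteDimensional (𝓡 N)
  set μ := riemannianVolume N X with hμ
  set g : X → ENNReal := fun x => ‖u x‖ₑ ^ 2 + ‖G x‖ₑ ^ 2 with hg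
  have hgm : AEMeasurable g μ := h.hasWeakGradient.aemeasurable_enorm_sq_add
  have hgfin : ∫⁻ x, g x ∂μ ≠ ⊤ := by
    rw [hg, lintegral_add_left' (h.hasWeakGradient.aestronglyMeasurable.enorm.pow_const 2)]
    exact (ENNReal.add_lt_top.2 ⟨lintegral_enorm_sq_lt_top_of_memLp h.memLp, h.lintegral_lt_top⟩).ne
  refine isTestLimit_of_forall_exists h.hasWeakGradient fun ε hε => ?_
  have hε' : 0 < ε / 12 := ENNReal.div_pos hε.ne' (by simp)
  -- outside a large compact set of the exhaustion the pair is small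
  obtain ⟨m, hm⟩ : ∃ m, ∫⁻ x in (interior (K m))ᶜ, g x ∂μ ≤ ε / 12 := by
    have : IsFiniteMeasure (μ.withDensity g) := isFiniteMeasure_withDensity hgfin
    have ht := tendsto_measure_iInter_atTop (μ := μ.withDensity g)
      (s := fun m => (interior (K m))ᶜ)
      (fun m => isOpen_interior.measurableSet.compl.nullMeasurableSet)
      (fun a b hab => Set.compl_subset_compl.2 (interior_mono (hmono hab)))
      ⟨0, measure_ne_top _ _⟩
    have he : ⋂ m, (interior (K m))ᶜ = ∅ := by
      rw [← Set.compl_iUnion, Set.compl_empty_iff]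
      exact Set.eq_univ_of_forall fun x => Set.mem_iUnion.2 (hcov x)
    rw [he, measure_empty] at ht
    obtain ⟨m, hm⟩ := (ht.eventually_lt_const hε').exists
    refine ⟨m, ?_⟩
    rw [← withDensity_apply _ isOpen_interior.measurableSet.compl]
    exact hm.le
  obtain ⟨χ, hχl, hχc, hχb, hχg, hχ1⟩ := hχ m
  obtain ⟨K', hK', hsub⟩ := exists_compact_superset hχc
  -- `φ` is smooth with compact support and equals `1` near the support of `χ`, so `φ u` can be
  -- approximated by a test function `ψ`, and `χ ψ` approximates `u`
  obtain ⟨φ, hφ1, hφ0, hφb⟩ := exists_contMDiffMap_one_nhds_of_subset_interior (𝓡 N)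
    (n := (⊤ : ℕ∞)) (isClosed_tsupport χ) hsub
  have hφz : ∀ x ∉ K', φ x = 0 ∧ grad (N := N) φ x = 0 := by
    intro x hx
    have hx' : x ∉ tsupport φ := by
      intro hxt
      refine hx ((closure_minimal (fun z hz => ?_) hK'.isClosed) hxt)
      by_contra hzK
      exact hz (hφ0 z hzK)
    exact ⟨image_eq_zero_of_notMem_tsupport hx', grad_eq_zero_of_notMem_tsupport hx'⟩
  have hφL : ∀ x ∈ tsupport χ, φ x = 1 ∧ grad (N := N) φ x = 0 := by
    intro x hx
    have hev : (φ : X → ℝ) =ᶠ[𝓝 x] fun _ => 1 :=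
      (eventually_nhdsSet_iff_forall.1 hφ1) x hx
    refine ⟨hev.self_of_nhds, ext_inner_right ℝ fun ξ => ?_⟩
    rw [inner_grad, hev.mfderiv_eq, mfderiv_const, inner_zero_left]
    rfl
  have hv := h.contMDiff_mul φ.contMDiff hK' fun x hx => Or.inl (hφz x hx)
  have hvl : IsTestLimit N (fun x => φ x * u x) (fun x => φ x • G x + u x • grad φ x) :=
    hv.isTestLimit_of_isCompact hK' fun x hx => by
      rw [(hφz x hx).1, (hφz x hx).2]; simp
  obtain ⟨ψ, hψ, hψle⟩ := hvl (ε / 12) hε'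
  obtain ⟨hw, hwl⟩ := isTestLimit_cutoff_mul hχl hχc hχb hχg hψ
  refine ⟨_, _, hw, hwl, ?_⟩
  set D : X → ENNReal := fun x => ‖φ x * u x - ψ x‖ₑ ^ 2
    + ‖φ x • G x + u x • grad φ x - grad ψ x‖ₑ ^ 2 with hD
  have hpt : ∀ x, ‖u x - χ x * ψ x‖ₑ ^ 2 + ‖G x - (χ x • grad ψ x + ψ x • grad χ x)‖ₑ ^ 2
      ≤ 6 * (interior (K m))ᶜ.indicator g x + 6 * D x := by
    intro x
    by_cases hxL : x ∈ tsupport χ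
    · have hDx : D x = ‖u x - ψ x‖ₑ ^ 2 + ‖G x - grad ψ x‖ₑ ^ 2 := by
        simp only [hD, (hφL x hxL).1, (hφL x hxL).2, one_mul, one_smul, smul_zero, add_zero]
      by_cases hxU : x ∈ interior (K m)
      · have hg0 : grad (N := N) χ x = 0 := by
          have hev : χ =ᶠ[𝓝 x] fun _ => 1 := by
            filter_upwards [isOpen_interior.mem_nhds hxU] with z hz
            exact hχ1 z (interior_subset hz)
          refine ext_inner_right ℝ fun ξ => ?_
          rw [inner_grad, hev.mfderiv_eq, mfderiv_const, inner_zero_left]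
          rfl
        rw [hg0, hχ1 x (interior_subset hxU), one_mul, one_smul, smul_zero, add_zero, ← hDx]
        refine le_add_left ?_
        calc D x = 1 * D x := (one_mul _).symm
          _ ≤ 6 * D x := by gcongr; norm_num
      · rw [Set.indicator_of_mem (by exact hxU), hDx]
        exact enorm_sub_cutoff_sq_add_le (hχb x).1 (hχb x).2 (hχg x)
    · have hxU : x ∈ (interior (K m))ᶜ := fun hxU => hxL (subset_tsupport _ (by
        rw [Function.mem_support, hχ1 x (interior_subset hxU)]; exact one_ne_zero))
      rw [grad_eq_zero_of_notMem_tsupport hxL, image_eq_zero_of_notMem_tsupport hxL,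
        Set.indicator_of_mem hxU]
      simp only [zero_mul, sub_zero, zero_smul, smul_zero, add_zero]
      refine le_add_right ?_
      calc ‖u x‖ₑ ^ 2 + ‖G x‖ₑ ^ 2 = 1 * g x := (one_mul _).symm
        _ ≤ 6 * g x := by gcongr; norm_num
  refine (lintegral_mono hpt).trans ?_
  rw [lintegral_add_left' ((hgm.indicator isOpen_interior.measurableSet.compl).const_mul 6),
    lintegral_const_mul' _ _ (by simp), lintegral_const_mul' _ _ (by simp),
    lintegral_indicator isOpen_interior.measurableSet.compl]
  calc _ ≤ 6 * (ε / 12) + 6 * (ε / 12) := by gcongr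
    _ = ε := by
      rw [← two_mul, ← mul_assoc, show (2 * 6 : ENNReal) = 12 by norm_num,
        ENNReal.mul_div_cancel (by simp) (by simp)]

/-- On a complete Riemannian manifold, test functions are dense in the Sobolev space. -/
theorem SobolevPair.isTestLimit {N : ℕ} {X : Type*} [EMetricSpace X] [SecondCountableTopology X]
    [CompleteSpace X] [ChartedSpace (EuclideanSpace ℝ (Fin N)) X] [IsManifold (𝓡 N) ∞ X]
    [RiemannianBundle (fun x : X => TangentSpace (𝓡 N) x)]
    [IsContMDiffRiemannianBundle (𝓡 N) ∞ (EuclideanSpace ℝ (Fin N))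
      (fun x : X => TangentSpace (𝓡 N) x)]
    [IsRiemannianManifold (𝓡 N) X] [MeasurableSpace X] [BorelSpace X]
    {u : X → ℝ} {G : ∀ x : X, TangentSpace (𝓡 N) x} (h : SobolevPair N u G) :
    IsTestLimit N u G := by
  have : LocallyCompactSpace X := Manifold.locallyCompact_of_finiteDimensional (𝓡 N)
  obtain ⟨K, hmono, hcov, hχ⟩ := exists_exhaustion_lipschitz_cutoff fun (x : X) R hR =>
    isCompact_closedEBall (fun _ _ _ _ h => exists_edist_le_edist_le N h) x hR
  refine h.isTestLimit_of_exhaustion hmono hcov fun m => ?_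
  obtain ⟨χ, h1, h2, h3, h4⟩ := hχ m
  exact ⟨χ, locallyLipschitzInCharts_of_lipschitzWith h1, h2, h3, norm_grad_le_one h1, h4⟩

end Density

/-! ### Derivatives of the Yamabe quotient along a line -/

section Derivatives

section Calculus

/-- The first two derivatives at `0` of a quotient `e / n ^ (2 / p)` with `e` a quadratic
polynomial, written in terms of `λ = e(0) / n(0)`, `n'(0) = p A`, and `n''(0) = p (p - 1) B`. -/
lemma hasDerivAt_quadratic_div_rpow {e₀ e₁ e₂ p A B : ℝ} {H n n' : ℝ → ℝ} (hp : p ≠ 0)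
    (hH : ∀ t, H t = (e₀ + 2 * e₁ * t + e₂ * t ^ 2) / n t ^ (2 / p)) (hn0 : 0 < n 0)
    (hn : ∀ᶠ t in 𝓝 (0 : ℝ), HasDerivAt n (n' t) t) (hn'0 : n' 0 = p * A)
    (hn' : HasDerivAt n' (p * (p - 1) * B) 0) :
    HasDerivAt H (2 * n 0 ^ (-(2 / p)) * (e₁ - e₀ / n 0 * A)) 0 ∧
    (∀ᶠ t in 𝓝 (0 : ℝ), DifferentiableAt ℝ H t) ∧
    HasDerivAt (deriv H) (2 * n 0 ^ (-(2 / p)) * (e₂ - 4 * (e₁ * A / n 0)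
      + e₀ / n 0 * ((p + 2) * A ^ 2 / n 0 - (p - 1) * B))) 0 := by
  set β := 2 / p with hβ
  have hβp : β * p = 2 := div_mul_cancel₀ _ hp
  have hnc : ContinuousAt n 0 := hn.self_of_nhds.continuousAt
  have hpos : ∀ᶠ t in 𝓝 (0 : ℝ), 0 < n t := hnc.eventually_const_lt hn0
  have hHe : ∀ᶠ t in 𝓝 (0 : ℝ), H t = (e₀ + 2 * e₁ * t + e₂ * t ^ 2) * n t ^ (-β) := by
    filter_upwards [hpos] with t ht
    rw [hH, Real.rpow_neg ht.le, div_eq_mul_inv]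
  have he : ∀ t : ℝ, HasDerivAt (fun t => e₀ + 2 * e₁ * t + e₂ * t ^ 2) (2 * e₁ + 2 * e₂ * t) t := by
    intro t
    have h := (((hasDerivAt_id t).const_mul (2 * e₁)).const_add e₀).add
      (((hasDerivAt_id t).pow 2).const_mul e₂)
    refine h.congr_deriv ?_
    simp; ring
  set D : ℝ → ℝ := fun t => (2 * e₁ + 2 * e₂ * t) * n t ^ (-β)
    + (e₀ + 2 * e₁ * t + e₂ * t ^ 2) * (n' t * (-β) * n t ^ (-β - 1)) with hD
  have hHD : ∀ᶠ t in 𝓝 (0 : ℝ), HasDerivAt H (D t) t := by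
    filter_upwards [hn, hpos, hHe.eventually_nhds] with t h1 h2 h3
    exact ((he t).mul (h1.rpow_const (p := -β) (Or.inl h2.ne'))).congr_of_eventuallyEq h3
  have e1 : n 0 ^ (-β - 1) = n 0 ^ (-β) / n 0 := by
    rw [Real.rpow_sub hn0, Real.rpow_one]
  have e2 : n 0 ^ (-β - 1 - 1) = n 0 ^ (-β) / n 0 ^ 2 := by
    rw [Real.rpow_sub hn0, e1, Real.rpow_one]; field_simp
  refine ⟨?_, hHD.mono fun t h => h.differentiableAt, ?_⟩
  · refine hHD.self_of_nhds.congr_deriv ?_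
    simp only [hD, hn'0, e1]
    field_simp
    linear_combination (-e₀ * A) * hβp
  · have hd : deriv H =ᶠ[𝓝 0] D := hHD.mono fun t h => h.deriv
    refine HasDerivAt.congr_of_eventuallyEq ?_ hd
    have hl : HasDerivAt (fun t : ℝ => 2 * e₁ + 2 * e₂ * t) (2 * e₂) 0 := by
      simpa using ((hasDerivAt_id (0 : ℝ)).const_mul (2 * e₂)).const_add (2 * e₁)
    have h1 := hn.self_of_nhds.rpow_const (p := -β) (Or.inl hn0.ne')
    have h2 := hn.self_of_nhds.rpow_const (p := -β - 1) (Or.inl hn0.ne')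
    have h := (hl.mul h1).add ((he 0).mul ((hn'.mul_const (-β)).mul h2))
    refine h.congr_deriv ?_
    simp only [hn'0, e1, e2, Pi.mul_apply]
    have hβ' : β = 2 / p := hβ
    generalize n 0 ^ (-β) = y
    rw [hβ']
    field_simp
    ring

variable {X : Type*} [TopologicalSpace X]

/-- A positive function stays positive under small perturbations with compact support. -/
lemma exists_pos_add_mul {f u : X → ℝ} (hf : Continuous f) (hf0 : ∀ x, 0 < f x)
    (hu : Continuous u) (huc : HasCompactSupport u) :
    ∃ δ > 0, ∀ t ∈ Set.Icc (-δ) δ, ∀ x, 0 < f x + t * u x := by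
  obtain ⟨C, hC⟩ := huc.exists_bound_of_continuousOn (f := fun x => u x / f x)
    (hu.div hf fun x => (hf0 x).ne').continuousOn
  refine ⟨(|C| + 1)⁻¹, by positivity, fun t ht x => ?_⟩
  by_cases hx : x ∈ tsupport u
  · have h1 := hC x hx
    rw [norm_div, Real.norm_eq_abs, Real.norm_of_nonneg (hf0 x).le, div_le_iff₀ (hf0 x)] at h1
    have h2 : |t| * |u x| < f x := by
      calc |t| * |u x| ≤ (|C| + 1)⁻¹ * (|C| * f x) := by
            gcongr
            · exact abs_le.2 ht
            · exact h1.trans (mul_le_mul_of_nonneg_right (le_abs_self C) (hf0 x).le)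
        _ = (|C| / (|C| + 1)) * f x := by ring
        _ < 1 * f x := by
            have := hf0 x
            gcongr
            rw [div_lt_one (by positivity)]; linarith
        _ = f x := one_mul _
    rw [← abs_mul] at h2
    linarith [neg_abs_le (t * u x)]
  · rw [image_eq_zero_of_notMem_tsupport hx, mul_zero, add_zero]; exact hf0 x

/-- Differentiation of `∫ (f + t u) ^ r g` under the integral sign. -/
lemma hasDerivAt_integral_rpow_mul [MeasurableSpace X] [OpensMeasurableSpace X]
    [SecondCountableTopology X] {μ : Measure X} [IsFiniteMeasureOnCompacts μ] {f u g : X → ℝ}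
    (hf : Continuous f) (hu : Continuous u) (huc : HasCompactSupport u) (hg : Continuous g)
    {δ r : ℝ} (hpos : ∀ t ∈ Set.Icc (-δ) δ, ∀ x, 0 < f x + t * u x)
    (hint : ∀ t ∈ Set.Icc (-δ) δ, Integrable (fun x => (f x + t * u x) ^ r * g x) μ)
    {t : ℝ} (ht : t ∈ Set.Ioo (-δ) δ) :
    HasDerivAt (fun t => ∫ x, (f x + t * u x) ^ r * g x ∂μ)
      (r * ∫ x, (f x + t * u x) ^ (r - 1) * (u x * g x) ∂μ) t := by
  have hsub : Set.Ioo (-δ) δ ⊆ Set.Icc (-δ) δ := Set.Ioo_subset_Icc_self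
  set F' : ℝ → X → ℝ := fun t x => r * ((f x + t * u x) ^ (r - 1) * (u x * g x)) with hF'
  have hcont : ContinuousOn (Function.uncurry F') (Set.Icc (-δ) δ ×ˢ tsupport u) := by
    refine continuousOn_const.mul (ContinuousOn.mul ?_ (by fun_prop))
    refine ContinuousOn.rpow_const (by fun_prop) fun z hz => Or.inl (hpos z.1 hz.1 z.2).ne'
  obtain ⟨C, hC⟩ := (isCompact_Icc.prod huc).exists_bound_of_continuousOn hcont
  have hF'm : ∀ t ∈ Set.Icc (-δ) δ, Continuous (F' t) := by
    intro t ht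
    refine continuous_const.mul (Continuous.mul ?_ (by fun_prop))
    exact Continuous.rpow_const (by fun_prop) fun x => Or.inl (hpos t ht x).ne'
  have hFm : ∀ t ∈ Set.Icc (-δ) δ, Continuous (fun x => (f x + t * u x) ^ r * g x) := by
    intro t ht
    exact (Continuous.rpow_const (by fun_prop) fun x => Or.inl (hpos t ht x).ne').mul hg
  have key := (hasDerivAt_integral_of_dominated_loc_of_deriv_le (μ := μ)
    (F := fun t x => (f x + t * u x) ^ r * g x) (F' := F') (x₀ := t)
    (bound := (tsupport u).indicator fun _ => C) (isOpen_Ioo.mem_nhds ht)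
    (eventually_of_mem (isOpen_Ioo.mem_nhds ht) fun t ht =>
      (hFm t (hsub ht)).aestronglyMeasurable)
    (hint t (hsub ht)) (hF'm t (hsub ht)).aestronglyMeasurable
    (Eventually.of_forall fun x τ hτ => ?_) ?_ (Eventually.of_forall fun x τ hτ => ?_)).2
  · simp only [hF', integral_const_mul] at key
    exact key
  · by_cases hx : x ∈ tsupport u
    · rw [Set.indicator_of_mem hx]
      exact hC (τ, x) ⟨hsub hτ, hx⟩
    · rw [Set.indicator_of_notMem hx]
      simp [hF', image_eq_zero_of_notMem_tsupport hx]
  · exact (integrable_indicator_iff (isClosed_tsupport u).measurableSet).2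
      (integrableOn_const huc.measure_lt_top.ne)
  · have h1 : HasDerivAt (fun t => f x + t * u x) (u x) τ := by
      simpa using ((hasDerivAt_id τ).mul_const (u x)).const_add (f x)
    refine ((h1.rpow_const (p := r) (Or.inl (hpos τ (hsub hτ) x).ne')).mul_const (g x)).congr_deriv ?_
    simp only [hF']; ring

end Calculus

end Derivatives

/-! ### The quadratic forms of energy and weighted norm -/

section QuadraticForms

section Weighted

variable {α : Type*} [MeasurableSpace α] {μ : Measure α} {f u v : α → ℝ} {p : ℝ}

/-- The weighted `L²` inner product `∫ f ^ (p - 2) u v`. -/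
def weightedForm (μ : Measure α) (f : α → ℝ) (p : ℝ) (u v : α → ℝ) : ℝ :=
  ∫ x, f x ^ (p - 2) * (u x * v x) ∂μ

/-- An elementary form of Young's inequality: compare `a` and `|b|`. -/
lemma rpow_mul_sq_le {a b p : ℝ} (ha : 0 < a) (hp : 2 ≤ p) :
    a ^ (p - 2) * b ^ 2 ≤ a ^ p + |b| ^ p := by
  have key : ∀ c : ℝ, 0 < c → c ^ p = c ^ (p - 2) * c ^ 2 := fun c hc => by
    rw [← Real.rpow_natCast c 2, ← Real.rpow_add hc]; norm_num
  rw [← sq_abs b]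
  rcases le_total |b| a with h | h
  · have : a ^ (p - 2) * |b| ^ 2 ≤ a ^ p := by rw [key a ha]; gcongr
    linarith [Real.rpow_nonneg (abs_nonneg b) p]
  · have : a ^ (p - 2) * |b| ^ 2 ≤ |b| ^ p := by
      rw [key |b| (ha.trans_le h)]
      gcongr
    linarith [Real.rpow_nonneg ha.le p]

lemma integrable_weight_mul_sq (hf : ∀ x, 0 < f x) (hp : 2 ≤ p) (hfm : AEStronglyMeasurable f μ)
    (hum : AEStronglyMeasurable u μ) (hfp : Integrable (fun x => |f x| ^ p) μ)
    (hup : Integrable (fun x => |u x| ^ p) μ) :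
    Integrable (fun x => f x ^ (p - 2) * u x ^ 2) μ := by
  refine (hfp.add hup).mono' ?_ (Eventually.of_forall fun x => ?_)
  · exact ((hfm.aemeasurable.pow_const _).mul (hum.aemeasurable.pow_const 2)).aestronglyMeasurable
  · rw [Real.norm_of_nonneg (mul_nonneg (Real.rpow_nonneg (hf x).le _) (sq_nonneg _))]
    have := rpow_mul_sq_le (b := u x) (hf x) hp
    simpa [abs_of_pos (hf x)] using this

lemma integrable_weight_mul_mul (hf : ∀ x, 0 < f x) (hfm : AEStronglyMeasurable f μ)
    (hum : AEStronglyMeasurable u μ) (hvm : AEStronglyMeasurable v μ)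
    (hu : Integrable (fun x => f x ^ (p - 2) * u x ^ 2) μ)
    (hv : Integrable (fun x => f x ^ (p - 2) * v x ^ 2) μ) :
    Integrable (fun x => f x ^ (p - 2) * (u x * v x)) μ := by
  refine (hu.add hv).mono' ?_ (Eventually.of_forall fun x => ?_)
  · exact ((hfm.aemeasurable.pow_const _).mul
      (hum.aemeasurable.mul hvm.aemeasurable)).aestronglyMeasurable
  · have h0 : 0 ≤ f x ^ (p - 2) := Real.rpow_nonneg (hf x).le _
    rw [norm_mul, Real.norm_of_nonneg h0, Real.norm_eq_abs]
    change _ ≤ f x ^ (p - 2) * u x ^ 2 + f x ^ (p - 2) * v x ^ 2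
    rw [← mul_add]
    refine mul_le_mul_of_nonneg_left (abs_le.2 ⟨?_, ?_⟩) h0 <;>
      nlinarith [sq_nonneg (u x + v x), sq_nonneg (u x - v x), sq_nonneg (u x), sq_nonneg (v x)]

lemma weightedForm_self (u : α → ℝ) :
    weightedForm μ f p u u = ∫ x, f x ^ (p - 2) * u x ^ 2 ∂μ := by
  simp only [weightedForm, sq]

lemma weightedForm_self_nonneg (hf : ∀ x, 0 < f x) (u : α → ℝ) : 0 ≤ weightedForm μ f p u u :=
  integral_nonneg fun x => mul_nonneg (Real.rpow_nonneg (hf x).le _) (mul_self_nonneg _)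

lemma integral_add_const_mul_add_const_mul {A B C : α → ℝ} (hA : Integrable A μ)
    (hB : Integrable B μ) (hC : Integrable C μ) (b c : ℝ) :
    ∫ x, (A x + b * B x + c * C x) ∂μ = ∫ x, A x ∂μ + b * ∫ x, B x ∂μ + c * ∫ x, C x ∂μ := by
  have h1 : Integrable (fun x => A x + b * B x) μ := hA.add (hB.const_mul b)
  rw [integral_add h1 (hC.const_mul c), integral_add hA (hB.const_mul b), integral_const_mul,
    integral_const_mul]

lemma weightedForm_add_mul (huu : Integrable (fun x => f x ^ (p - 2) * u x ^ 2) μ)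
    (hvv : Integrable (fun x => f x ^ (p - 2) * v x ^ 2) μ)
    (huv : Integrable (fun x => f x ^ (p - 2) * (u x * v x)) μ) (t : ℝ) :
    weightedForm μ f p (fun x => u x + t * v x) (fun x => u x + t * v x)
      = weightedForm μ f p u u + 2 * weightedForm μ f p u v * t
        + weightedForm μ f p v v * t ^ 2 := by
  simp only [weightedForm_self]
  have e : ∀ x, f x ^ (p - 2) * (u x + t * v x) ^ 2
      = f x ^ (p - 2) * u x ^ 2 + (2 * t) * (f x ^ (p - 2) * (u x * v x))
        + t ^ 2 * (f x ^ (p - 2) * v x ^ 2) := fun x => by ring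
  simp only [e]
  rw [integral_add_const_mul_add_const_mul huu huv hvv]
  simp only [weightedForm]
  ring

lemma weightedForm_self_eq_normPow (hf : ∀ x, 0 < f x) :
    weightedForm μ f p f f = ∫ x, |f x| ^ p ∂μ := by
  refine integral_congr_ae (Eventually.of_forall fun x => ?_)
  simp only [abs_of_pos (hf x)]
  rw [← sq, ← Real.rpow_natCast (f x) 2, ← Real.rpow_add (hf x)]
  norm_num

lemma weightedForm_left (hf : ∀ x, 0 < f x) (u : α → ℝ) :
    weightedForm μ f p f u = ∫ x, f x ^ (p - 1) * u x ∂μ := by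
  refine integral_congr_ae (Eventually.of_forall fun x => ?_)
  simp only
  rw [← mul_assoc, show p - 1 = (p - 2) + 1 by ring, Real.rpow_add (hf x), Real.rpow_one]

/-- The Cauchy–Schwarz inequality for a nonnegative quadratic polynomial. -/
lemma abs_le_sqrt_mul_of_forall_nonneg {a b c : ℝ} (ha : 0 ≤ a)
    (h : ∀ t : ℝ, 0 ≤ a + 2 * b * t + c * t ^ 2) : |b| ≤ √a * √c := by
  rw [← Real.sqrt_mul ha]
  refine Real.abs_le_sqrt ?_
  have := discrim_le_zero (a := c) (b := 2 * b) (c := a) fun t => by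
    have := h t; nlinarith
  rw [discrim] at this
  nlinarith

lemma ae_eq_zero_of_weightedForm_eq_zero (hf : ∀ x, 0 < f x)
    (hu : Integrable (fun x => f x ^ (p - 2) * u x ^ 2) μ) (h : weightedForm μ f p u u = 0) :
    u =ᵐ[μ] 0 := by
  rw [weightedForm_self, integral_eq_zero_iff_of_nonneg
    (fun x => mul_nonneg (Real.rpow_nonneg (hf x).le _) (sq_nonneg _)) hu] at h
  filter_upwards [h] with x hx
  have := (mul_eq_zero.1 hx).resolve_left (Real.rpow_pos_of_pos (hf x) _).ne'
  simpa using this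

end Weighted

section Forms

variable {N : ℕ} {X : Type*} [TopologicalSpace X] [ChartedSpace (EuclideanSpace ℝ (Fin N)) X]
  [IsManifold (𝓡 N) ∞ X] [RiemannianBundle (fun x : X => TangentSpace (𝓡 N) x)]
  [hsm : IsContMDiffRiemannianBundle (𝓡 N) ∞ (EuclideanSpace ℝ (Fin N))
      (fun x : X => TangentSpace (𝓡 N) x)] [MeasurableSpace X] [BorelSpace X]
  [SecondCountableTopology X]

variable (N) in
/-- The bilinear form `∫ (a h(∇u, ∇v) + s u v)`, as a function of `u`, `v` and their gradients. -/
def sobolevForm {X : Type*} [TopologicalSpace X] [ChartedSpace (EuclideanSpace ℝ (Fin N)) X]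
    [RiemannianBundle (fun x : X => TangentSpace (𝓡 N) x)] [MeasurableSpace X] (a s : ℝ)
    (u : X → ℝ) (G : ∀ x : X, TangentSpace (𝓡 N) x) (v : X → ℝ)
    (H : ∀ x : X, TangentSpace (𝓡 N) x) : ℝ :=
  ∫ x, (a * inner ℝ (G x) (H x) + s * (u x * v x)) ∂(riemannianVolume N X)

variable {u v : X → ℝ} {G H : ∀ x : X, TangentSpace (𝓡 N) x}

omit [IsManifold (𝓡 N) ∞ X] hsm [BorelSpace X] [SecondCountableTopology X] in
lemma SobolevPair.memSobolev (h : SobolevPair N u G) : MemSobolev N u :=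
  ⟨h.memLp, G, h.hasWeakGradient, h.lintegral_lt_top⟩

omit [IsManifold (𝓡 N) ∞ X] hsm [BorelSpace X] [SecondCountableTopology X] in
lemma MemSobolev.exists_sobolevPair (h : MemSobolev N u) :
    ∃ G, SobolevPair N u G := by
  obtain ⟨h1, G, h2, h3⟩ := h
  exact ⟨G, h1, h2, h3⟩

lemma SobolevPair.integrable_norm_sq (h : SobolevPair N u G) :
    Integrable (fun x => ‖G x‖ ^ 2) (riemannianVolume N X) := by
  refine ⟨h.hasWeakGradient.aestronglyMeasurable_norm_sq, ?_⟩
  refine lt_of_le_of_lt (le_of_eq ?_) h.lintegral_lt_top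
  refine lintegral_congr fun x => ?_
  rw [enorm_sq_eq_ofReal, Real.enorm_eq_ofReal (by positivity)]

lemma SobolevPair.integrable_inner (h : SobolevPair N u G) (h' : SobolevPair N v H) :
    Integrable (fun x => inner ℝ (G x) (H x)) (riemannianVolume N X) := by
  have := (((h.add h').integrable_norm_sq.sub h.integrable_norm_sq).sub
    h'.integrable_norm_sq).div_const 2
  refine this.congr (Eventually.of_forall fun x => ?_)
  simp only [Pi.sub_apply]
  rw [real_inner_eq_norm_add_mul_self_sub_norm_mul_self_sub_norm_mul_self_div_two]
  ring

lemma SobolevPair.integrable_form (h : SobolevPair N u G) (h' : SobolevPair N v H) (a s : ℝ) :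
    Integrable (fun x => a * inner ℝ (G x) (H x) + s * (u x * v x)) (riemannianVolume N X) :=
  ((h.integrable_inner h').const_mul a).add ((h.memLp.integrable_mul h'.memLp).const_mul s)

lemma SobolevPair.add_mul (h : SobolevPair N u G) (h' : SobolevPair N v H) (t : ℝ) :
    SobolevPair N (fun x => u x + t * v x) (fun x => G x + t • H x) :=
  h.add (h'.const_mul t)

lemma sobolevForm_add_mul (h : SobolevPair N u G) (h' : SobolevPair N v H) (a s t : ℝ) :
    sobolevForm N a s (fun x => u x + t * v x) (fun x => G x + t • H x)
        (fun x => u x + t * v x) (fun x => G x + t • H x)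
      = sobolevForm N a s u G u G + 2 * sobolevForm N a s u G v H * t
        + sobolevForm N a s v H v H * t ^ 2 := by
  have e : ∀ x, a * inner ℝ (G x + t • H x) (G x + t • H x)
        + s * ((u x + t * v x) * (u x + t * v x))
      = (a * inner ℝ (G x) (G x) + s * (u x * u x))
        + (2 * t) * (a * inner ℝ (G x) (H x) + s * (u x * v x))
        + t ^ 2 * (a * inner ℝ (H x) (H x) + s * (v x * v x)) := fun x => by
    simp only [inner_add_left, inner_add_right, inner_smul_left, inner_smul_right, conj_trivial]
    rw [real_inner_comm (G x) (H x)]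
    ring
  simp only [sobolevForm, e]
  rw [integral_add_const_mul_add_const_mul (h.integrable_form h a s) (h.integrable_form h' a s)
    (h'.integrable_form h' a s)]
  ring

omit [IsManifold (𝓡 N) ∞ X] hsm [BorelSpace X] [SecondCountableTopology X] in
lemma sobolevForm_self_nonneg {a s : ℝ} (ha : 0 ≤ a) (hs : 0 ≤ s) (u : X → ℝ)
    (G : ∀ x : X, TangentSpace (𝓡 N) x) : 0 ≤ sobolevForm N a s u G u G :=
  integral_nonneg fun _ => add_nonneg (mul_nonneg ha real_inner_self_nonneg)
    (mul_nonneg hs (mul_self_nonneg _))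

lemma SobolevPair.energy_eq (h : SobolevPair N u G) {s : ℝ}
    (hscal : ∀ x : X, scalarCurvature N x = s) :
    energy N u = sobolevForm N (yamabeConst N) s u G u G := by
  refine integral_congr_ae ?_
  filter_upwards [h.hasWeakGradient.weakGradient_ae_eq] with x hx
  rw [hx, hscal, real_inner_self_eq_norm_sq, sq (u x)]

lemma SobolevPair.sobolevNorm_eq (h : SobolevPair N u G) :
    sobolevNorm N u = √(sobolevForm N 1 1 u G u G) := by
  refine congrArg Real.sqrt (integral_congr_ae ?_)
  filter_upwards [h.hasWeakGradient.weakGradient_ae_eq] with x hx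
  rw [hx, real_inner_self_eq_norm_sq, sq (u x), one_mul, one_mul]

omit [IsManifold (𝓡 N) ∞ X] hsm [BorelSpace X] [SecondCountableTopology X] in
lemma sobolevForm_const_mul_self (a s t : ℝ) (u : X → ℝ) (G : ∀ x : X, TangentSpace (𝓡 N) x) :
    sobolevForm N a s (fun x => t * u x) (fun x => t • G x) (fun x => t * u x) (fun x => t • G x)
      = t ^ 2 * sobolevForm N a s u G u G := by
  simp only [sobolevForm, inner_smul_left, inner_smul_right, conj_trivial, ← integral_const_mul]
  refine integral_congr_ae (Eventually.of_forall fun x => ?_)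
  simp only; ring

lemma sobolevForm_self_le {a s : ℝ} (ha : 0 ≤ a) (hs : 0 ≤ s) (h : SobolevPair N u G) :
    sobolevForm N a s u G u G ≤ (a + s) * sobolevForm N 1 1 u G u G := by
  simp only [sobolevForm, ← integral_const_mul]
  refine integral_mono (h.integrable_form h a s) ((h.integrable_form h 1 1).const_mul _) fun x => ?_
  have h1 : 0 ≤ inner ℝ (G x) (G x) := real_inner_self_nonneg
  have h2 := mul_self_nonneg (u x)
  simp only
  nlinarith [mul_nonneg ha h2, mul_nonneg hs h1]

lemma two_lt_yamabeExponent (hN : 3 ≤ N) : 2 < yamabeExponent N := by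
  have : (3 : ℝ) ≤ N := by exact_mod_cast hN
  rw [yamabeExponent, lt_div_iff₀ (by linarith)]
  linarith

lemma yamabeConst_pos (hN : 3 ≤ N) : 0 < yamabeConst N := by
  have : (3 : ℝ) ≤ N := by exact_mod_cast hN
  exact div_pos (by linarith) (by linarith)

/-- The Sobolev embedding in terms of integrals. -/
lemma exists_integral_rpow_le (hN : 3 ≤ N) (hSob : SobolevEmbedding N X) :
    ∃ K : ℝ, 0 ≤ K ∧ ∀ (u : X → ℝ) (G : ∀ x : X, TangentSpace (𝓡 N) x), SobolevPair N u G →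
      Integrable (fun x => |u x| ^ yamabeExponent N) (riemannianVolume N X) ∧
      (sobolevForm N 1 1 u G u G ≤ 1 → normPow N u ≤ K) := by
  obtain ⟨C, hC⟩ := hSob
  have hp := two_lt_yamabeExponent hN
  set p := yamabeExponent N with hpdef
  have hp0 : 0 < p := by linarith
  refine ⟨max C 0 ^ p, by positivity, fun u G h => ?_⟩
  have hle := hC u h.memSobolev
  have hmem : MemLp u (ENNReal.ofReal p) (riemannianVolume N X) :=
    ⟨h.memLp.1, hle.trans_lt ENNReal.ofReal_lt_top⟩
  have hne : ENNReal.ofReal p ≠ 0 := (ENNReal.ofReal_pos.2 hp0).ne'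
  have hint := hmem.integrable_norm_rpow hne ENNReal.ofReal_ne_top
  rw [ENNReal.toReal_ofReal hp0.le] at hint
  refine ⟨hint, fun h1 => ?_⟩
  rw [MemLp.eLpNorm_eq_integral_rpow_norm hne ENNReal.ofReal_ne_top hmem,
    ENNReal.toReal_ofReal hp0.le] at hle
  have hn : (0 : ℝ) ≤ ∫ x, ‖u x‖ ^ p ∂(riemannianVolume N X) :=
    integral_nonneg fun x => Real.rpow_nonneg (norm_nonneg _) _
  have hs1 : sobolevNorm N u ≤ 1 := by
    rw [h.sobolevNorm_eq]; exact Real.sqrt_le_one.2 h1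
  have hs0 : 0 ≤ sobolevNorm N u := Real.sqrt_nonneg _
  have h2 : (∫ x, ‖u x‖ ^ p ∂(riemannianVolume N X)) ^ p⁻¹ ≤ max C 0 := by
    have h3 : ENNReal.ofReal (C * sobolevNorm N u) ≤ ENNReal.ofReal (max C 0) := by
      refine ENNReal.ofReal_le_ofReal ?_
      calc C * sobolevNorm N u ≤ max C 0 * sobolevNorm N u := by gcongr; exact le_max_left _ _
        _ ≤ max C 0 * 1 := by gcongr
        _ = max C 0 := mul_one _
    exact (ENNReal.ofReal_le_ofReal_iff (le_max_right _ _)).1 (hle.trans h3)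
  have h4 := Real.rpow_le_rpow (Real.rpow_nonneg hn _) h2 hp0.le
  rwa [← Real.rpow_mul hn, inv_mul_cancel₀ hp0.ne', Real.rpow_one] at h4

end Forms

end QuadraticForms

/-! ### The second variation -/

section SecondVariation

variable {N : ℕ} {X : Type*} [TopologicalSpace X] [ChartedSpace (EuclideanSpace ℝ (Fin N)) X]
  [IsManifold (𝓡 N) ∞ X] [RiemannianBundle (fun x : X => TangentSpace (𝓡 N) x)]
  [hsm : IsContMDiffRiemannianBundle (𝓡 N) ∞ (EuclideanSpace ℝ (Fin N))
      (fun x : X => TangentSpace (𝓡 N) x)] [MeasurableSpace X] [BorelSpace X]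
  [SecondCountableTopology X]

lemma riemannianVolume_ne_zero [Nonempty X] : riemannianVolume N X ≠ 0 := by
  intro h0
  obtain ⟨q⟩ := ‹Nonempty X›
  have h1 := ae_chart_of_ae (N := N) q (P := fun _ => False) (by rw [h0]; simp)
  have h2 : volume (extChartAt (𝓡 N) q).target = 0 := by
    rw [ae_iff] at h1
    simpa using h1
  exact ((isOpen_target q).measure_pos volume ⟨_, mem_extChartAt_target q⟩).ne' h2

lemma normPow_pos [Nonempty X] {f : X → ℝ} (hf : ∀ x, 0 < f x)
    (hint : Integrable (fun x => |f x| ^ yamabeExponent N) (riemannianVolume N X)) :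
    0 < normPow N f := by
  rw [normPow, integral_pos_iff_support_of_nonneg
    (fun x => Real.rpow_nonneg (abs_nonneg _) _) hint]
  have : Function.support (fun x => |f x| ^ yamabeExponent N) = Set.univ :=
    Set.eq_univ_of_forall fun x => (Real.rpow_pos_of_pos (abs_pos.2 (hf x).ne') _).ne'
  rw [this]
  exact (Measure.measure_univ_pos).2 riemannianVolume_ne_zero

/-- The weighted norm is controlled by the Sobolev norm. -/
lemma weightedForm_le_of_sobolevForm_le (hN : 3 ≤ N) {K : ℝ}
    (hK : ∀ (u : X → ℝ) (G : ∀ x : X, TangentSpace (𝓡 N) x), SobolevPair N u G →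
      Integrable (fun x => |u x| ^ yamabeExponent N) (riemannianVolume N X) ∧
      (sobolevForm N 1 1 u G u G ≤ 1 → normPow N u ≤ K))
    {f w : X → ℝ} {F W : ∀ x : X, TangentSpace (𝓡 N) x} (hf : ∀ x, 0 < f x)
    (hfp : SobolevPair N f F) (h : SobolevPair N w W) {σ : ℝ} (hσ : 0 < σ)
    (hle : sobolevForm N 1 1 w W w W ≤ σ) :
    weightedForm (riemannianVolume N X) f (yamabeExponent N) w w ≤ σ * (normPow N f + K) := by
  set p := yamabeExponent N with hp
  have hp2 : 2 ≤ p := (two_lt_yamabeExponent hN).le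
  set r := √σ⁻¹ with hr
  have hr2 : r ^ 2 = σ⁻¹ := Real.sq_sqrt (by positivity)
  have hw := h.const_mul r
  obtain ⟨hi, hn⟩ := hK _ _ hw
  have hfi := (hK _ _ hfp).1
  have h1 : normPow N (fun x => r * w x) ≤ K := by
    refine hn ?_
    rw [sobolevForm_const_mul_self, hr2, inv_mul_le_one₀ hσ]
    exact hle
  have h2 : r ^ 2 * weightedForm (riemannianVolume N X) f p w w ≤ normPow N f + K := by
    calc r ^ 2 * weightedForm (riemannianVolume N X) f p w w
        = ∫ x, f x ^ (p - 2) * (r * w x) ^ 2 ∂(riemannianVolume N X) := by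
          rw [weightedForm_self, ← integral_const_mul]
          refine integral_congr_ae (Eventually.of_forall fun x => ?_)
          simp only; ring
      _ ≤ ∫ x, (|f x| ^ p + |r * w x| ^ p) ∂(riemannianVolume N X) := by
          refine integral_mono (integrable_weight_mul_sq hf hp2 hfp.memLp.1 hw.memLp.1 hfi hi)
            (hfi.add hi) fun x => ?_
          simpa [abs_of_pos (hf x)] using rpow_mul_sq_le (b := r * w x) (hf x) hp2
      _ = normPow N f + normPow N (fun x => r * w x) := integral_add hfi hi
      _ ≤ normPow N f + K := by gcongr
  rw [hr2, inv_mul_le_iff₀ hσ] at h2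
  exact h2

variable (N) in
/-- The quadratic form `E(u) - λ (p - 1) ∫ f ^ (p - 2) u² + λ (p - 2) (∫ f ^ (p - 1) u)² / ‖f‖ₚᵖ`
with `λ = E(f) / ‖f‖ₚᵖ`: up to a positive factor, the second variation of the Yamabe functional
at a critical point `f`. -/
def secondVariation {X : Type*} [TopologicalSpace X] [ChartedSpace (EuclideanSpace ℝ (Fin N)) X]
    [RiemannianBundle (fun x : X => TangentSpace (𝓡 N) x)] [MeasurableSpace X]
    (f u : X → ℝ) : ℝ :=
  energy N u
    - energy N f / normPow N f * ((yamabeExponent N - 1) *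
        weightedForm (riemannianVolume N X) f (yamabeExponent N) u u)
    + energy N f / normPow N f * ((yamabeExponent N - 2) *
        (weightedForm (riemannianVolume N X) f (yamabeExponent N) f u ^ 2 / normPow N f))

variable [T2Space X]

/-- The derivatives of `∫ |f + t u| ^ p` at `t = 0`. -/
lemma exists_hasDerivAt_normPow {f u : X → ℝ} (hf : Continuous f) (hf0 : ∀ x, 0 < f x)
    (hu : IsTestFunction N u)
    (hint : ∀ t : ℝ, Integrable (fun x => |f x + t * u x| ^ yamabeExponent N)
      (riemannianVolume N X)) :
    ∃ n' : ℝ → ℝ,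
      (∀ᶠ t in 𝓝 (0 : ℝ), HasDerivAt (fun t => normPow N (fun x => f x + t * u x)) (n' t) t) ∧
      n' 0 = yamabeExponent N
        * weightedForm (riemannianVolume N X) f (yamabeExponent N) f u ∧
      HasDerivAt n' (yamabeExponent N * (yamabeExponent N - 1)
        * weightedForm (riemannianVolume N X) f (yamabeExponent N) u u) 0 := by
  have := isFiniteMeasureOnCompacts_riemannianVolume (N := N) (X := X)
  set p := yamabeExponent N with hp
  set μ := riemannianVolume N X with hμ
  have huc : Continuous u := hu.1.continuous
  obtain ⟨δ, hδ, hpos⟩ := exists_pos_add_mul hf hf0 huc hu.2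
  have h0 : (0 : ℝ) ∈ Set.Ioo (-δ) δ := ⟨by linarith, hδ⟩
  have hev : ∀ᶠ t in 𝓝 (0 : ℝ), t ∈ Set.Ioo (-δ) δ := isOpen_Ioo.mem_nhds h0
  have hn : ∀ t ∈ Set.Icc (-δ) δ, normPow N (fun x => f x + t * u x)
      = ∫ x, (f x + t * u x) ^ p * 1 ∂μ := by
    intro t ht
    refine integral_congr_ae (Eventually.of_forall fun x => ?_)
    simp only [abs_of_pos (hpos t ht x), mul_one]
    rfl
  have h1 : ∀ t ∈ Set.Ioo (-δ) δ, HasDerivAt (fun t => ∫ x, (f x + t * u x) ^ p * 1 ∂μ)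
      (p * ∫ x, (f x + t * u x) ^ (p - 1) * (u x * 1) ∂μ) t := by
    intro t ht
    refine hasDerivAt_integral_rpow_mul hf huc hu.2 continuous_const hpos (fun τ hτ => ?_) ht
    refine (hint τ).congr (Eventually.of_forall fun x => ?_)
    simp only [abs_of_pos (hpos τ hτ x), mul_one]
  have h2 : HasDerivAt (fun t => ∫ x, (f x + t * u x) ^ (p - 1) * u x ∂μ)
      ((p - 1) * ∫ x, (f x + 0 * u x) ^ (p - 1 - 1) * (u x * u x) ∂μ) 0 := by
    refine hasDerivAt_integral_rpow_mul hf huc hu.2 huc hpos (fun τ hτ => ?_) h0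
    refine Continuous.integrable_of_hasCompactSupport ?_ hu.2.mul_left
    exact (Continuous.rpow_const (by fun_prop) fun x => Or.inl (hpos τ hτ x).ne').mul huc
  refine ⟨fun t => p * ∫ x, (f x + t * u x) ^ (p - 1) * u x ∂μ, ?_, ?_, ?_⟩
  · filter_upwards [hev, hev.eventually_nhds] with t ht ht'
    have := h1 t ht
    simp only [mul_one (u _)] at this
    refine this.congr_of_eventuallyEq ?_
    filter_upwards [ht'] with τ hτ
    exact hn τ (Set.Ioo_subset_Icc_self hτ)
  · simp only [zero_mul, add_zero]
    rw [weightedForm_left hf0]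
  · refine (h2.const_mul p).congr_deriv ?_
    rw [weightedForm, mul_assoc]
    simp only [zero_mul, add_zero]
    rw [show p - 1 - 1 = p - 2 by ring]

/-- Stability is nonnegativity of the second variation. -/
lemma isStable_iff_forall_secondVariation_nonneg [Nonempty X] (hN : 3 ≤ N)
    (hint : ∀ (u : X → ℝ) (G : ∀ x : X, TangentSpace (𝓡 N) x), SobolevPair N u G →
      Integrable (fun x => |u x| ^ yamabeExponent N) (riemannianVolume N X))
    {s : ℝ} (hscal : ∀ x : X, scalarCurvature N x = s)
    {f : X → ℝ} (hf : Continuous f) (hf0 : ∀ x, 0 < f x) {F : ∀ x : X, TangentSpace (𝓡 N) x}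
    (hF : SobolevPair N f F) (hcrit : IsCriticalPoint N f) :
    (IsStable N f ↔ ∀ u : X → ℝ, IsTestFunction N u → 0 ≤ secondVariation N f u) ∧
    ∀ u : X → ℝ, IsTestFunction N u →
      sobolevForm N (yamabeConst N) s f F u (grad u) = energy N f / normPow N f
        * weightedForm (riemannianVolume N X) f (yamabeExponent N) f u := by
  have hp := two_lt_yamabeExponent hN
  have hn0 : 0 < normPow N f := normPow_pos hf0 (hint f F hF)
  have hfac : 0 < 2 * normPow N f ^ (-(2 / yamabeExponent N)) :=
    mul_pos two_pos (Real.rpow_pos_of_pos hn0 _)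
  have main : ∀ u : X → ℝ, IsTestFunction N u →
      sobolevForm N (yamabeConst N) s f F u (grad u) = energy N f / normPow N f
        * weightedForm (riemannianVolume N X) f (yamabeExponent N) f u ∧
      (∀ᶠ t in 𝓝 (0 : ℝ), DifferentiableAt ℝ (variation N f u) t) ∧
      HasDerivAt (deriv (variation N f u))
        (2 * normPow N f ^ (-(2 / yamabeExponent N)) * secondVariation N f u) 0 := by
    intro u hu
    have hU := hu.sobolevPair
    obtain ⟨n', h1, h2, h3⟩ := exists_hasDerivAt_normPow hf hf0 hu
      fun t => hint _ _ (hF.add_mul hU t)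
    have hH : ∀ t, variation N f u t = (energy N f
        + 2 * sobolevForm N (yamabeConst N) s f F u (grad u) * t + energy N u * t ^ 2)
        / normPow N (fun x => f x + t * u x) ^ (2 / yamabeExponent N) := by
      intro t
      rw [variation, yamabeFunctional, (hF.add_mul hU t).energy_eq hscal,
        sobolevForm_add_mul hF hU, ← hF.energy_eq hscal, ← hU.energy_eq hscal]
    have hz : normPow N (fun x => f x + 0 * u x) = normPow N f := by simp
    obtain ⟨d1, d2, d3⟩ := hasDerivAt_quadratic_div_rpow
      (n := fun t => normPow N (fun x => f x + t * u x)) (by linarith) hH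
      (by rw [hz]; exact hn0) h1 h2 h3
    rw [hz] at d1 d3
    have hc : sobolevForm N (yamabeConst N) s f F u (grad u) = energy N f / normPow N f
        * weightedForm (riemannianVolume N X) f (yamabeExponent N) f u := by
      have := (d1.unique (hcrit u hu))
      rcases mul_eq_zero.1 this with h | h
      · exact absurd h hfac.ne'
      · linarith
    refine ⟨hc, d2, d3.congr_deriv ?_⟩
    rw [hc, secondVariation]
    ring
  refine ⟨forall₂_congr fun u hu => ?_, fun u hu => (main u hu).1⟩
  obtain ⟨-, h2, h3⟩ := main u hu
  rw [h3.deriv]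
  exact ⟨fun h => nonneg_of_mul_nonneg_right h.2.2 hfac,
    fun h => ⟨h2, h3.differentiableAt, mul_nonneg hfac.le h⟩⟩

end SecondVariation

/-! ### Stability and the lower bound of the quotient -/

section Stability

lemma weightedForm_comm {α : Type*} [MeasurableSpace α] (μ : Measure α) (f : α → ℝ) (p : ℝ)
    (u v : α → ℝ) : weightedForm μ f p u v = weightedForm μ f p v u := by
  simp only [weightedForm, mul_comm (u _)]

variable {N : ℕ} {X : Type*} [TopologicalSpace X] [ChartedSpace (EuclideanSpace ℝ (Fin N)) X]
  [RiemannianBundle (fun x : X => TangentSpace (𝓡 N) x)] [MeasurableSpace X]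

lemma sobolevForm_comm (a s : ℝ) (u v : X → ℝ) (G H : ∀ x : X, TangentSpace (𝓡 N) x) :
    sobolevForm N a s u G v H = sobolevForm N a s v H u G := by
  simp only [sobolevForm, mul_comm (u _), real_inner_comm]

variable [IsManifold (𝓡 N) ∞ X]
  [hsm : IsContMDiffRiemannianBundle (𝓡 N) ∞ (EuclideanSpace ℝ (Fin N))
      (fun x : X => TangentSpace (𝓡 N) x)] [BorelSpace X] [SecondCountableTopology X]

/-- A lower bound of `α(X, h, f)` as an inequality of quadratic forms; functions vanishing almost
everywhere satisfy it trivially. -/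
lemma coe_le_alpha_iff (hN : 3 ≤ N)
    (hint : ∀ (u : X → ℝ) (G : ∀ x : X, TangentSpace (𝓡 N) x), SobolevPair N u G →
      Integrable (fun x => |u x| ^ yamabeExponent N) (riemannianVolume N X))
    {s : ℝ} (hs : 0 < s) (hscal : ∀ x : X, scalarCurvature N x = s)
    {f : X → ℝ} (hf0 : ∀ x, 0 < f x) {F : ∀ x : X, TangentSpace (𝓡 N) x}
    (hF : SobolevPair N f F) (c : ℝ) :
    (c : EReal) ≤ alpha N f ↔ ∀ (u : X → ℝ) (G : ∀ x : X, TangentSpace (𝓡 N) x),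
      SobolevPair N u G →
      weightedForm (riemannianVolume N X) f (yamabeExponent N) f u = 0 →
      c * weightedForm (riemannianVolume N X) f (yamabeExponent N) u u ≤ energy N u := by
  have hp := two_lt_yamabeExponent hN
  have hi : ∀ (u : X → ℝ) (G : ∀ x : X, TangentSpace (𝓡 N) x), SobolevPair N u G →
      Integrable (fun x => f x ^ (yamabeExponent N - 2) * u x ^ 2) (riemannianVolume N X) :=
    fun u G h => integrable_weight_mul_sq hf0 hp.le hF.memLp.1 h.memLp.1 (hint f F hF) (hint u G h)
  have hpos : ∀ (u : X → ℝ) (G : ∀ x : X, TangentSpace (𝓡 N) x), SobolevPair N u G →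
      ¬ (u =ᵐ[riemannianVolume N X] 0) →
      0 < weightedForm (riemannianVolume N X) f (yamabeExponent N) u u := by
    intro u G h hu
    refine lt_of_le_of_ne (weightedForm_self_nonneg hf0 u) fun h0 => hu ?_
    exact ae_eq_zero_of_weightedForm_eq_zero hf0 (hi u G h) h0.symm
  simp only [alpha, le_iInf_iff, EReal.coe_le_coe_iff]
  constructor
  · intro h u G hu hA
    by_cases hu0 : u =ᵐ[riemannianVolume N X] 0
    · have : weightedForm (riemannianVolume N X) f (yamabeExponent N) u u = 0 := by
        refine integral_eq_zero_of_ae ?_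
        filter_upwards [hu0] with x hx
        simp [hx]
      rw [this, mul_zero, hu.energy_eq hscal]
      exact sobolevForm_self_nonneg (yamabeConst_pos hN).le hs.le u G
    · have := h u ⟨hu.memSobolev, hu0, by rw [← weightedForm_left hf0]; exact hA⟩
      rwa [← weightedForm_self, le_div_iff₀ (hpos u G hu hu0)] at this
  · rintro h u ⟨hu, hu0, hA⟩
    obtain ⟨G, hG⟩ := hu.exists_sobolevPair
    rw [← weightedForm_self, le_div_iff₀ (hpos u G hG hu0)]
    exact h u G hG (by rw [weightedForm_left hf0]; exact hA)

variable [T2Space X]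

/-- The second variation is nonnegative on test functions if and only if the quadratic form
`E - λ (p - 1) ∫ f ^ (p - 2) u²` is nonnegative on the Sobolev functions `u` orthogonal to `f`. -/
lemma forall_secondVariation_nonneg_iff [Nonempty X] (hN : 3 ≤ N) {K : ℝ} (hK0 : 0 ≤ K)
    (hK : ∀ (u : X → ℝ) (G : ∀ x : X, TangentSpace (𝓡 N) x), SobolevPair N u G →
      Integrable (fun x => |u x| ^ yamabeExponent N) (riemannianVolume N X) ∧
      (sobolevForm N 1 1 u G u G ≤ 1 → normPow N u ≤ K))
    (hdense : ∀ (u : X → ℝ) (G : ∀ x : X, TangentSpace (𝓡 N) x), SobolevPair N u G →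
      IsTestLimit N u G)
    {s : ℝ} (hs : 0 < s) (hscal : ∀ x : X, scalarCurvature N x = s)
    {f : X → ℝ} (hf0 : ∀ x, 0 < f x) {F : ∀ x : X, TangentSpace (𝓡 N) x}
    (hF : SobolevPair N f F)
    (hcrit : ∀ u : X → ℝ, IsTestFunction N u →
      sobolevForm N (yamabeConst N) s f F u (grad u) = energy N f / normPow N f
        * weightedForm (riemannianVolume N X) f (yamabeExponent N) f u) :
    (∀ u : X → ℝ, IsTestFunction N u → 0 ≤ secondVariation N f u) ↔
      ∀ (u : X → ℝ) (G : ∀ x : X, TangentSpace (𝓡 N) x), SobolevPair N u G →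
      weightedForm (riemannianVolume N X) f (yamabeExponent N) f u = 0 →
      (yamabeExponent N - 1) * (energy N f / normPow N f)
        * weightedForm (riemannianVolume N X) f (yamabeExponent N) u u ≤ energy N u := by
  have hp := two_lt_yamabeExponent hN
  have ha := (yamabeConst_pos hN).le
  have hn0 : 0 < normPow N f := normPow_pos hf0 (hK f F hF).1
  have hi : ∀ (u : X → ℝ) (G : ∀ x : X, TangentSpace (𝓡 N) x), SobolevPair N u G →
      Integrable (fun x => f x ^ (yamabeExponent N - 2) * u x ^ 2) (riemannianVolume N X) :=
    fun u G h => integrable_weight_mul_sq hf0 hp.le hF.memLp.1 h.memLp.1 (hK f F hF).1 (hK u G h).1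
  have hi2 : ∀ (u v : X → ℝ) (G H : ∀ x : X, TangentSpace (𝓡 N) x), SobolevPair N u G →
      SobolevPair N v H →
      Integrable (fun x => f x ^ (yamabeExponent N - 2) * (u x * v x)) (riemannianVolume N X) :=
    fun u v G H h h' => integrable_weight_mul_mul hf0 hF.memLp.1 h.memLp.1 h'.memLp.1
      (hi u G h) (hi v H h')
  have hlam0 : 0 ≤ energy N f / normPow N f := by
    refine div_nonneg ?_ hn0.le
    rw [hF.energy_eq hscal]
    exact sobolevForm_self_nonneg ha hs.le f F
  have hff : weightedForm (riemannianVolume N X) f (yamabeExponent N) f f = normPow N f :=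
    weightedForm_self_eq_normPow hf0
  constructor
  · -- approximate an arbitrary function by test functions
    intro hst u G hu hA
    set lam := energy N f / normPow N f with hlam
    set p := yamabeExponent N with hpdef
    set a := yamabeConst N with hadef
    set μ := riemannianVolume N X with hμ
    set M := normPow N f + K with hM
    have hM0 : 0 ≤ M := by positivity
    set r : ℝ → ℝ := fun η => 2 * (√(energy N u) * √((a + s) * η)) + (a + s) * η
      + lam * ((p - 1) * (2 * (√(weightedForm μ f p u u) * √(η * M))))
      + lam * ((p - 2) * (η * M)) with hr
    have hrc : Tendsto r (𝓝[>] 0) (𝓝 0) := by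
      have h1 : Continuous r := by fun_prop
      have h2 : r 0 = 0 := by simp [hr]
      have h3 := h1.continuousWithinAt (s := Set.Ioi 0) (x := 0)
      rwa [ContinuousWithinAt, h2] at h3
    have hbound : ∀ η : ℝ, 0 < η → 0 ≤ energy N u - lam * ((p - 1) * weightedForm μ f p u u)
        + r η := by
      intro η hη
      obtain ⟨ψ, hψ, hle⟩ := hdense u G hu (ENNReal.ofReal η) (ENNReal.ofReal_pos.2 hη)
      have hψp := hψ.sobolevPair
      have hw := hψp.sub hu
      set w : X → ℝ := fun x => ψ x - u x with hwdef
      set W : ∀ x : X, TangentSpace (𝓡 N) x := fun x => grad ψ x - G x with hWdef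
      have hS : sobolevForm N 1 1 w W w W ≤ η := by
        have hnn : ∀ x, 0 ≤ 1 * inner ℝ (W x) (W x) + 1 * (w x * w x) := fun x => by
          have : 0 ≤ inner ℝ (W x) (W x) := real_inner_self_nonneg
          nlinarith [mul_self_nonneg (w x)]
        rw [← ENNReal.ofReal_le_ofReal_iff hη.le, sobolevForm,
          ofReal_integral_eq_lintegral_ofReal (hw.integrable_form hw 1 1)
            (Eventually.of_forall hnn)]
        refine le_trans (le_of_eq (lintegral_congr fun x => ?_)) hle
        rw [one_mul, one_mul, real_inner_self_eq_norm_sq, ← sq,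
          ENNReal.ofReal_add (by positivity) (by positivity), add_comm, enorm_sub_rev,
          enorm_sub_rev (G x), enorm_sq_eq_ofReal, enorm_sq_eq_ofReal, Real.norm_eq_abs, sq_abs]
      have hEw : sobolevForm N a s w W w W ≤ (a + s) * η :=
        (sobolevForm_self_le ha hs.le hw).trans (by gcongr)
      have hBw : weightedForm μ f p w w ≤ η * M := 
        weightedForm_le_of_sobolevForm_le hN hK hf0 hF hw hη hS
      have hψe : ψ = fun x => u x + 1 * w x := by funext x; simp [hwdef]
      have hψG : (grad ψ : ∀ x : X, TangentSpace (𝓡 N) x) = fun x => G x + (1 : ℝ) • W x := by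
        funext x; simp [hWdef]
      -- the three terms of the second variation of `ψ`
      have hE : energy N ψ ≤ energy N u + 2 * (√(energy N u) * √((a + s) * η)) + (a + s) * η := by
        have hcs := abs_le_sqrt_mul_of_forall_nonneg
          (sobolevForm_self_nonneg (N := N) ha hs.le u G) fun t => by
            rw [← sobolevForm_add_mul hu hw]
            exact sobolevForm_self_nonneg ha hs.le _ _
        rw [hψp.energy_eq hscal, hu.energy_eq hscal, hψG]
        conv_lhs => rw [hψe]
        rw [sobolevForm_add_mul hu hw]
        have h1 := (le_abs_self _).trans hcs
        have h2 : √(sobolevForm N a s w W w W) ≤ √((a + s) * η) := Real.sqrt_le_sqrt hEw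
        have h3 := mul_le_mul_of_nonneg_left h2 (Real.sqrt_nonneg (sobolevForm N a s u G u G))
        linarith
      have hB : weightedForm μ f p u u - 2 * (√(weightedForm μ f p u u) * √(η * M))
          ≤ weightedForm μ f p ψ ψ := by
        have hexp := fun t => weightedForm_add_mul (hi u G hu) (hi w W hw) (hi2 u w G W hu hw) t
        have hcs := abs_le_sqrt_mul_of_forall_nonneg
          (weightedForm_self_nonneg (μ := μ) (p := p) hf0 u) fun t => by
            rw [← hexp t]
            exact weightedForm_self_nonneg hf0 _
        have h1 := (neg_abs_le _).trans' (neg_le_neg hcs)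
        have h2 : √(weightedForm μ f p w w) ≤ √(η * M) := Real.sqrt_le_sqrt hBw
        have h3 := mul_le_mul_of_nonneg_left h2 (Real.sqrt_nonneg (weightedForm μ f p u u))
        have h4 := weightedForm_self_nonneg (μ := μ) (p := p) hf0 w
        rw [hψe, hexp]
        linarith
      have hAψ : weightedForm μ f p f ψ ^ 2 / normPow N f ≤ η * M := by
        have h0 : weightedForm μ f p f ψ = weightedForm μ f p f w := by
          have e : ∀ x, f x ^ (p - 2) * (f x * ψ x)
              = f x ^ (p - 2) * (f x * u x) + f x ^ (p - 2) * (f x * w x) := fun x => by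
            simp only [hwdef]; ring
          simp only [weightedForm, e]
          rw [integral_add (hi2 f u F G hF hu) (hi2 f w F W hF hw)]
          change weightedForm μ f p f u + _ = _
          rw [hA, zero_add]
        have hcs := abs_le_sqrt_mul_of_forall_nonneg
          (weightedForm_self_nonneg (μ := μ) (p := p) hf0 f) fun t => by
            rw [← weightedForm_add_mul (hi f F hF) (hi w W hw) (hi2 f w F W hF hw) t]
            exact weightedForm_self_nonneg hf0 _
        rw [h0, div_le_iff₀ hn0, ← sq_abs]
        calc |weightedForm μ f p f w| ^ 2
            ≤ (√(weightedForm μ f p f f) * √(weightedForm μ f p w w)) ^ 2 := by gcongr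
          _ = weightedForm μ f p w w * normPow N f := by
            rw [mul_pow, Real.sq_sqrt (weightedForm_self_nonneg hf0 f),
              Real.sq_sqrt (weightedForm_self_nonneg hf0 w), hff, mul_comm]
          _ ≤ η * M * normPow N f := by gcongr
      have h := hst ψ hψ
      rw [secondVariation] at h
      have g1 := mul_le_mul_of_nonneg_left
        (mul_le_mul_of_nonneg_left hB (by linarith : (0 : ℝ) ≤ p - 1)) hlam0
      have g2 := mul_le_mul_of_nonneg_left
        (mul_le_mul_of_nonneg_left hAψ (by linarith : (0 : ℝ) ≤ p - 2)) hlam0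
      simp only [hr]
      rw [mul_sub, mul_sub] at g1
      linarith
    have hlim : Tendsto (fun η => energy N u - lam * ((p - 1) * weightedForm μ f p u u) + r η)
        (𝓝[>] 0) (𝓝 (energy N u - lam * ((p - 1) * weightedForm μ f p u u) + 0)) :=
      hrc.const_add _
    have := ge_of_tendsto hlim (eventually_mem_nhdsWithin.mono fun η hη => hbound η hη)
    linarith
  · -- subtract from a test function its component along `f`
    intro h u hu
    have hU := hu.sobolevPair
    set A := weightedForm (riemannianVolume N X) f (yamabeExponent N) f u with hA
    set c := A / normPow N f with hc
    have hcn : c * normPow N f = A := div_mul_cancel₀ _ hn0.ne'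
    have hv := hU.add_mul hF (-c)
    have hAv : weightedForm (riemannianVolume N X) f (yamabeExponent N) f
        (fun x => u x + -c * f x) = 0 := by
      have e : ∀ x, f x ^ (yamabeExponent N - 2) * (f x * (u x + -c * f x))
          = f x ^ (yamabeExponent N - 2) * (f x * u x)
            + -c * (f x ^ (yamabeExponent N - 2) * (f x * f x)) := fun x => by ring
      simp only [weightedForm, e]
      rw [integral_add (hi2 f u _ _ hF hU) ((hi2 f f _ _ hF hF).const_mul _), integral_const_mul]
      change A + -c * weightedForm (riemannianVolume N X) f (yamabeExponent N) f f = 0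
      rw [hff]
      linarith
    have hvE := h _ _ hv hAv
    rw [hv.energy_eq hscal, sobolevForm_add_mul hU hF, ← hU.energy_eq hscal,
      ← hF.energy_eq hscal, sobolevForm_comm, hcrit u hu,
      weightedForm_add_mul (hi _ _ hU) (hi _ _ hF) (hi2 _ _ _ _ hU hF), hff,
      weightedForm_comm _ _ _ u f] at hvE
    have hE : energy N f = energy N f / normPow N f * normPow N f :=
      (div_mul_cancel₀ _ hn0.ne').symm
    rw [secondVariation]
    rw [← hA] at hvE ⊢
    have e1 : A ^ 2 / normPow N f = c * A := by rw [hc]; ring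
    rw [e1]
    generalize energy N f / normPow N f = lam at *
    rw [hE] at hvE
    have e2 : c ^ 2 * normPow N f = c * A := by rw [sq, mul_assoc, hcn]
    have e3 : lam * normPow N f * (-c) ^ 2 = lam * (c * A) := by rw [← e2]; ring
    have e4 : normPow N f * (-c) ^ 2 = c * A := by rw [← e2]; ring
    rw [e3, e4] at hvE
    nlinarith

/-- Without points, every function is stable and `α(X, h, f) = ∞`. -/
lemma isStable_iff_of_isEmpty [IsEmpty X] (f : X → ℝ) (c : ℝ) :
    IsStable N f ↔ (c : EReal) ≤ alpha N f := by
  have hstable : IsStable N f := by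
    intro u _
    have hc : variation N f u = fun _ => variation N f u 0 :=
      funext fun t => congrArg (yamabeFunctional N) (funext fun x => isEmptyElim x)
    rw [hc]
    simp
  refine iff_of_true hstable ?_
  simp only [alpha, le_iInf_iff]
  rintro u ⟨-, hu, -⟩
  exact absurd (Eventually.of_forall fun x => isEmptyElim x) hu

end Stability

end

end Yamabe

theorem theorem1p2 (N : ℕ) (hN : 3 ≤ N)
    {X : Type*} [EMetricSpace X] [SecondCountableTopology X] [CompleteSpace X]
    [ChartedSpace (EuclideanSpace ℝ (Fin N)) X] [IsManifold (𝓡 N) ∞ X]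
    [RiemannianBundle (fun x : X => TangentSpace (𝓡 N) x)]
    [IsContMDiffRiemannianBundle (𝓡 N) ∞ (EuclideanSpace ℝ (Fin N))
      (fun x : X => TangentSpace (𝓡 N) x)]
    [IsRiemannianManifold (𝓡 N) X]
    [MeasurableSpace X] [BorelSpace X]
    (hSob : Yamabe.SobolevEmbedding N X)
    (s : ℝ) (hs : 0 < s) (hscal : ∀ x : X, Yamabe.scalarCurvature N x = s)
    (f : X → ℝ) (hf_smooth : ContMDiff (𝓡 N) 𝓘(ℝ) ∞ f) (hf_pos : ∀ x, 0 < f x)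
    (hf_sob : Yamabe.MemSobolev N f) (hf_crit : Yamabe.IsCriticalPoint N f) :
    Yamabe.IsStable N f ↔
      (((Yamabe.yamabeExponent N - 1) * (Yamabe.energy N f / Yamabe.normPow N f) : ℝ) : EReal)
        ≤ Yamabe.alpha N f := by
  rcases isEmpty_or_nonempty X with hX | hX
  · exact Yamabe.isStable_iff_of_isEmpty f _
  obtain ⟨F, hF⟩ := hf_sob.exists_sobolevPair
  obtain ⟨K, hK0, hK⟩ := Yamabe.exists_integral_rpow_le hN hSob
  obtain ⟨hstable, hcrit⟩ := Yamabe.isStable_iff_forall_secondVariation_nonneg hN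
    (fun u G hu => (hK u G hu).1) hscal hf_smooth.continuous hf_pos hF hf_crit
  rw [hstable, Yamabe.coe_le_alpha_iff hN (fun u G hu => (hK u G hu).1) hs hscal hf_pos hF,
    Yamabe.forall_secondVariation_nonneg_iff hN hK0 hK (fun u G hu => hu.isTestLimit) hs hscal
      hf_pos hF hcrit]
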